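/- **Setting.** Let $d\ge 2$. A $C^2$-hypersurface is a set $\Sigma\subset\mathbb R^d$ (bounded or unbounded, closed or not) with a finite parametrization $\{\varphi_i,U_i,V_i\}_{i\in I}$: $U_i\subset\mathbb R^{d-1}$ and $V_i\subset\mathbb R^d$ are open, $\varphi_i:U_i\to V_i$ is $C^2$ with $\operatorname{rank}D\varphi_i(u)=d-1$ for all $u\in U_i$, $\varphi_i(U_i)=V_i\cap\Sigma$ and $\varphi_i:U_i\to V_i\cap\Sigma$ is a homeomorphism, $\Sigma\subset\bigcup_i V_i$, and there is $C>0$ with $|\varphi_i(u)-\varphi_i(v)|\le C|u-v|$ for all $u,v\in U_i$, $i\in I$. Let $\Sigma$ be such a hypersurface that is orientable, let $\nu$ be a continuous unit normal vector field on $\Sigma$, and let $\sigma$ be the surface measure on $\Sigma$ (given by $\sqrt{\det G_i(u)}\,du$ in the chart $\varphi_i$, where $G_i=(D\varphi_i)^{\top}D\varphi_i$). Let $W(x)$ be the Weingarten map at $x=\varphi_i(u)$, i.e. the linear map on the tangent hyperplane with $W(x)\,\partial_j\varphi_i(u)=-\partial_j(\nu\circ\varphi_i)(u)$. Assume that $\beta>0$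 is such that (a) the map $(x,t)\mapsto x+t\nu(x)$ is injective on $\Sigma\times(-\beta,\beta)$; (b) there is $\eta\in(0,1)$ with $\det(1-tW(x))\in(1-\eta,1+\eta)$ for all $x\in\Sigma$ and $t\in(-\beta,\beta)$; (c) there is $c>0$ with $|\varphi_i(u)+t\nu(\varphi_i(u))-\varphi_i(v)-s\nu(\varphi_i(v))|^2\ge c^2(|u-v|^2+|s-t|^2)$ for all $i\in I$, $u,v\in U_i$ and $s,t\in(-\beta,\beta)$. For $0<\varepsilon\le\beta$ put $\Omega_\varepsilon=\{x+t\nu(x):x\in\Sigma,\ |t|<\varepsilon\}$. Let $Q,V\in L^\infty(\mathbb R^d)$ be real valued with $V=0$ almost everywhere outside $\Omega_\beta$. Define the scaled potentials by $$V_\varepsilon(x+t\nu(x))=\tfrac{\beta}{\varepsilon}\,V\big(x+\tfrac{\beta}{\varepsilon}t\,\nu(x)\big)\quad(x\in\Sigma,\ |t|<\varepsilon),\qquad V_\varepsilon=0\ \text{ outside }\Omega_\varepsilon,$$ let $H_\varepsilon=-\Delta-V_\varepsilon$ in $L^2(\mathbb R^d)$ with $\operatorname{dom}H_\varepsilon=H^2(\mathbb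 R^d)$, and put $$\alpha(x)=\int_{-\beta}^{\beta}V(x+s\nu(x))\,ds\qquad\text{for }\sigma\text{-a.e. }x\in\Sigma .$$ Let $A_{\delta,\alpha}$ be the operator in $L^2(\mathbb R^d)$ associated with the form $$\mathfrak a_{\delta,\alpha}[f,g]=(\nabla f,\nabla g)_{L^2(\mathbb R^d;\mathbb C^d)}-\int_\Sigma\alpha\, f|_\Sigma\,\overline{g|_\Sigma}\,d\sigma,\qquad f,g\in H^1(\mathbb R^d),$$ i.e. $f\in\operatorname{dom}A_{\delta,\alpha}$ and $A_{\delta,\alpha}f=h$ if and only if $f\in H^1(\mathbb R^d)$, $h\in L^2(\mathbb R^d)$ and $\mathfrak a_{\delta,\alpha}[f,g]=(h,g)$ for all $g\in H^1(\mathbb R^d)$; here $f|_\Sigma\in L^2(\Sigma,\sigma)$ is the trace of $f$. Denote by $\rho(\cdot)$ the resolvent set. **Theorem.** One has $\alpha\in L^\infty(\Sigma)$, and there is $\lambda_0<0$ such that $(-\infty,\lambda_0)\subset\rho(A_{\delta,\alpha}+Q)\cap\rho(H_\varepsilon+Q)$ for all sufficiently small $\varepsilon>0$, and for every $\lambda\in(-\infty,\lambda_0)$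 there is a constant $c=c(d,\lambda,\Sigma,V,Q)>0$ such that $$\big\|(H_\varepsilon+Q-\lambda)^{-1}-(A_{\delta,\alpha}+Q-\lambda)^{-1}\big\|\le c\,\varepsilon\,(1+|\ln\varepsilon|)$$ for all sufficiently small $\varepsilon>0$. In particular, $H_\varepsilon+Q$ converges to $A_{\delta,\alpha}+Q$ in the norm resolvent sense as $\varepsilon\to0+$: every $z\in\mathbb C\setminus\mathbb R$ lies in $\rho(A_{\delta,\alpha}+Q)$ and in $\rho(H_\varepsilon+Q)$ for all sufficiently small $\varepsilon>0$, and $\|(H_\varepsilon+Q-z)^{-1}-(A_{\delta,\alpha}+Q-z)^{-1}\|\to0$. -/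

import Mathlib

open MeasureTheory Filter Topology Set TemperedDistribution
open scoped ENNReal SchwartzMap LineDeriv Laplacian

noncomputable section

/-- `ℝᵈ` with its Euclidean norm. -/
abbrev EucSp (d : ℕ) : Type := EuclideanSpace ℝ (Fin d)

/-- The complex Hilbert space `L²(ℝᵈ)`. -/
abbrev L2Sp (d : ℕ) : Type := Lp ℂ 2 (volume : Measure (EucSp d))

/-! ### Unbounded operators: resolvent set, resolvent, norm resolvent convergence -/

section Resolvent

variable {H : Type*} [NormedAddCommGroup H] [NormedSpace ℂ H]

/-- `R` is a bounded, everywhere defined two-sided inverse of `T - z : dom T → H`. -/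
def IsResolventAt (T : H →ₗ.[ℂ] H) (z : ℂ) (R : H →L[ℂ] H) : Prop :=
  (∀ f : H, ∃ h : R f ∈ T.domain, T ⟨R f, h⟩ - z • R f = f) ∧
    ∀ f : T.domain, R (T f - z • (f : H)) = f

/-- The resolvent set `ρ(T)` of an unbounded operator. -/
def unboundedResolventSet (T : H →ₗ.[ℂ] H) : Set ℂ :=
  {z | ∃ R : H →L[ℂ] H, IsResolventAt T z R}

open Classical in
/-- The resolvent `(T - z)⁻¹`, for `z ∈ ρ(T)` (and `0` for other `z`). -/
def unboundedResolvent (T : H →ₗ.[ℂ] H) (z : ℂ) : H →L[ℂ] H :=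
  if h : ∃ R : H →L[ℂ] H, IsResolventAt T z R then h.choose else 0

/-- Convergence of `T ε` to `T₀` in the norm resolvent sense along the filter `l`: convergence of
the resolvents in operator norm at every non-real point. -/
def NormResolventTendsto (T : ℝ → (H →ₗ.[ℂ] H)) (l : Filter ℝ) (T₀ : H →ₗ.[ℂ] H) : Prop :=
  ∀ z : ℂ, z.im ≠ 0 →
    z ∈ unboundedResolventSet T₀ ∧ (∀ᶠ ε in l, z ∈ unboundedResolventSet (T ε)) ∧
      Tendsto (fun ε => ‖unboundedResolvent (T ε) z - unboundedResolvent T₀ z‖) l (𝓝 0)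

end Resolvent

/-! ### Hypersurfaces -/

/-- A `C²`-hypersurface `Σ ⊆ ℝᵈ` with a parametrization `{φ i, U i, V i}` by charts indexed by `ι`
(to be taken finite). Each `φ i` is only relevant on the open set `U i`. -/
structure C2Hypersurface (d : ℕ) (ι : Type*) where
  carrier : Set (EucSp d)
  φ : ι → EucSp (d - 1) → EucSp d
  U : ι → Set (EucSp (d - 1))
  V : ι → Set (EucSp d)
  isOpen_U : ∀ i, IsOpen (U i)
  isOpen_V : ∀ i, IsOpen (V i)
  contDiffOn : ∀ i, ContDiffOn ℝ 2 (φ i) (U i)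
  rank_eq : ∀ i, ∀ u ∈ U i,
    Module.finrank ℝ (LinearMap.range (fderiv ℝ (φ i) u : EucSp (d - 1) →ₗ[ℝ] EucSp d)) = d - 1
  image_eq : ∀ i, φ i '' U i = V i ∩ carrier
  isEmbedding : ∀ i, IsEmbedding ((U i).domRestrict (φ i))
  subset_iUnion : carrier ⊆ ⋃ i, V i
  lipschitz : ∃ C : ℝ, 0 < C ∧ ∀ i, ∀ u ∈ U i, ∀ v ∈ U i, ‖φ i u - φ i v‖ ≤ C * ‖u - v‖

namespace C2Hypersurface

variable {d : ℕ} {ι : Type*} (S : C2Hypersurface d ι)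

/-- The partial derivative `∂ₖ φᵢ (u)`. -/
def chartPartial (i : ι) (u : EucSp (d - 1)) (k : Fin (d - 1)) : EucSp d :=
  fderiv ℝ (S.φ i) u (EuclideanSpace.single k 1)

/-- The matrix `Gᵢ(u)` of the first fundamental form. -/
def metricMatrix (i : ι) (u : EucSp (d - 1)) : Matrix (Fin (d - 1)) (Fin (d - 1)) ℝ :=
  Matrix.of fun k l => inner ℝ (S.chartPartial i u k) (S.chartPartial i u l)

open Classical in
/-- The surface measure `σ` on `Σ`, as a Borel measure on `ℝᵈ` concentrated on `Σ`:
`∫ f dσ = ∑ᵢ ∫_{Uᵢ} χᵢ(φᵢ(u)) f(φᵢ(u)) √(det Gᵢ(u)) du`, where `χᵢ = 1_{Vᵢ} / #{j | · ∈ Vⱼ}`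
is a (measurable) partition of unity on `Σ` subordinate to the sets `Vᵢ`. -/
def surfaceMeasure : Measure (EucSp d) :=
  Measure.sum fun i =>
    (((volume : Measure (EucSp (d - 1))).restrict (S.U i)).withDensity fun u =>
      ENNReal.ofReal (Real.sqrt (S.metricMatrix i u).det / ({j | S.φ i u ∈ S.V j} : Set ι).ncard)).map
      (S.φ i)

/-- `ν` is a continuous unit normal vector field on `Σ`. -/
structure IsUnitNormal (ν : EucSp d → EucSp d) : Prop where
  continuousOn : ContinuousOn ν S.carrier
  norm_eq_one : ∀ x ∈ S.carrier, ‖ν x‖ = 1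
  normal : ∀ i, ∀ u ∈ S.U i, ∀ k, inner ℝ (ν (S.φ i u)) (S.chartPartial i u k) = 0

/-- The matrix `Lᵢ(u)` of the Weingarten map `W(x)`, `x = φᵢ(u)`, in the basis `∂ₖφᵢ(u)` of the
tangent hyperplane. As `W(x) ∂ₗφᵢ(u) = -∂ₗ(ν ∘ φᵢ)(u)` is tangential, its coordinates in this
basis are obtained by applying `Gᵢ(u)⁻¹` to the inner products with the basis vectors. -/
def weingartenMatrix (ν : EucSp d → EucSp d) (i : ι) (u : EucSp (d - 1)) :
    Matrix (Fin (d - 1)) (Fin (d - 1)) ℝ :=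
  (S.metricMatrix i u)⁻¹ * Matrix.of fun k l =>
    inner ℝ (S.chartPartial i u k)
      (-(fderiv ℝ (fun w => ν (S.φ i w)) u (EuclideanSpace.single l 1)))

/-- The layer `Ω_ε = {x + t ν(x) : x ∈ Σ, |t| < ε}`. -/
def layer (ν : EucSp d → EucSp d) (ε : ℝ) : Set (EucSp d) :=
  {x | ∃ y ∈ S.carrier, ∃ t ∈ Ioo (-ε) ε, x = y + t • ν y}

/-- The geometric hypothesis on `Σ`, with layer half-width `β`. -/
structure LayerHypothesis (ν : EucSp d → EucSp d) (β : ℝ) : Prop where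
  pos : 0 < β
  injOn : InjOn (fun p : EucSp d × ℝ => p.1 + p.2 • ν p.1) (S.carrier ×ˢ Ioo (-β) β)
  det_mem : ∃ η ∈ Ioo (0 : ℝ) 1, ∀ i, ∀ u ∈ S.U i, ∀ t ∈ Ioo (-β) β,
    (1 - t • S.weingartenMatrix ν i u).det ∈ Ioo (1 - η) (1 + η)
  lower_bound : ∃ c : ℝ, 0 < c ∧ ∀ i, ∀ u ∈ S.U i, ∀ v ∈ S.U i,
    ∀ s ∈ Ioo (-β) β, ∀ t ∈ Ioo (-β) β,
      c ^ 2 * (‖u - v‖ ^ 2 + |s - t| ^ 2) ≤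
        ‖(S.φ i u + t • ν (S.φ i u)) - (S.φ i v + s • ν (S.φ i v))‖ ^ 2

open Classical in
/-- The scaled potential `V_ε`: `V_ε(y + t ν(y)) = (β/ε) V(y + (β/ε) t ν(y))` for `y ∈ Σ`,
`|t| < ε`, and `V_ε = 0` outside `Ω_ε`. For `ε ≤ β` the pair `(y, t)` is unique under the
geometric hypothesis. -/
def scaledPotential (ν : EucSp d → EucSp d) (β : ℝ) (V : EucSp d → ℝ) (ε : ℝ) (x : EucSp d) : ℝ :=
  if h : ∃ p : EucSp d × ℝ, p.1 ∈ S.carrier ∧ p.2 ∈ Ioo (-ε) ε ∧ x = p.1 + p.2 • ν p.1 then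
    (β / ε) * V (h.choose.1 + (β / ε * h.choose.2) • ν h.choose.1)
  else 0

end C2Hypersurface

/-- The transversal average `α(x) = ∫_{-β}^{β} V(x + s ν(x)) ds`. -/
def transversalAverage {d : ℕ} (ν : EucSp d → EucSp d) (β : ℝ) (V : EucSp d → ℝ) (x : EucSp d) : ℝ :=
  ∫ s in (-β)..β, V (x + s • ν x)

/-! ### Operators in `L²(ℝᵈ)` -/

/-! Linearity of the embedding `L² → 𝓢'` and of the distributional Laplacian. -/

theorem coe_dist_zero {d : ℕ} : ((0 : L2Sp d) : 𝓢'(EucSp d, ℂ)) = 0 :=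
  map_zero (Lp.toTemperedDistributionCLM ℂ (volume : Measure (EucSp d)) 2)

theorem coe_dist_add {d : ℕ} (f g : L2Sp d) :
    ((f + g : L2Sp d) : 𝓢'(EucSp d, ℂ)) = (f : 𝓢'(EucSp d, ℂ)) + (g : 𝓢'(EucSp d, ℂ)) :=
  map_add (Lp.toTemperedDistributionCLM ℂ (volume : Measure (EucSp d)) 2) f g

theorem coe_dist_smul {d : ℕ} (c : ℂ) (f : L2Sp d) :
    ((c • f : L2Sp d) : 𝓢'(EucSp d, ℂ)) = c • (f : 𝓢'(EucSp d, ℂ)) :=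
  map_smul (Lp.toTemperedDistributionCLM ℂ (volume : Measure (EucSp d)) 2) c f

theorem laplacian_dist_zero {d : ℕ} : Δ (0 : 𝓢'(EucSp d, ℂ)) = 0 := by
  simpa only [TemperedDistribution.laplacianCLM_apply] using
    map_zero (LineDeriv.laplacianCLM ℂ (EucSp d) 𝓢'(EucSp d, ℂ))

theorem laplacian_dist_add {d : ℕ} (f g : 𝓢'(EucSp d, ℂ)) : Δ (f + g) = Δ f + Δ g := by
  simpa only [TemperedDistribution.laplacianCLM_apply] using
    map_add (LineDeriv.laplacianCLM ℂ (EucSp d) 𝓢'(EucSp d, ℂ)) f g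

theorem laplacian_dist_smul {d : ℕ} (c : ℂ) (f : 𝓢'(EucSp d, ℂ)) : Δ (c • f) = c • Δ f := by
  simpa only [TemperedDistribution.laplacianCLM_apply] using
    map_smul (LineDeriv.laplacianCLM ℂ (EucSp d) 𝓢'(EucSp d, ℂ)) c f

/-- The free Laplacian `-Δ` in `L²(ℝᵈ)` with domain `H²(ℝᵈ)`, given by its graph; `Δ` is
the distributional Laplacian. -/
def freeLaplacian (d : ℕ) : L2Sp d →ₗ.[ℂ] L2Sp d :=
  Submodule.toLinearPMap
    { carrier := {p | MemSobolev 2 2 (p.1 : 𝓢'(EucSp d, ℂ)) ∧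
        (p.2 : 𝓢'(EucSp d, ℂ)) = -Δ (p.1 : 𝓢'(EucSp d, ℂ))}
      zero_mem' := by
        simp only [mem_ofPred_eq, Prod.fst_zero, Prod.snd_zero, coe_dist_zero]
        exact ⟨memSobolev_fun_zero (EucSp d) ℂ 2 2, by simp [laplacian_dist_zero]⟩
      add_mem' := by
        rintro p q ⟨hp, hp'⟩ ⟨hq, hq'⟩
        simp only [mem_ofPred_eq, Prod.fst_add, Prod.snd_add, coe_dist_add]
        exact ⟨hp.add hq, by rw [hp', hq', laplacian_dist_add]; abel⟩
      smul_mem' := by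
        rintro c p ⟨hp, hp'⟩
        simp only [mem_ofPred_eq, Prod.smul_fst, Prod.smul_snd, coe_dist_smul]
        exact ⟨hp.smul c, by rw [hp', laplacian_dist_smul, smul_neg]⟩ }

/-- The set `{f ∈ L² : W f ∈ L²}` (all of `L²` if `W` is bounded). -/
def mulDomain {d : ℕ} (W : EucSp d → ℝ) : Submodule ℂ (L2Sp d) where
  carrier := {f | MemLp (fun x => (W x : ℂ) * f x) 2 volume}
  zero_mem' := by
    refine MemLp.ae_eq ?_ (MemLp.zero (p := 2))
    filter_upwards [Lp.coeFn_zero ℂ 2 (volume : Measure (EucSp d))] with x hx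
    rw [hx, Pi.zero_apply, mul_zero]
  add_mem' := by
    intro f g hf hg
    refine MemLp.ae_eq ?_ (MemLp.add hf hg)
    filter_upwards [Lp.coeFn_add f g] with x hx
    rw [hx, Pi.add_apply, Pi.add_apply, mul_add]
  smul_mem' := by
    intro c f hf
    refine MemLp.ae_eq ?_ (MemLp.const_smul hf c)
    filter_upwards [Lp.coeFn_smul c f] with x hx
    rw [hx, Pi.smul_apply, Pi.smul_apply, smul_eq_mul, smul_eq_mul, mul_left_comm]

theorem mem_mulDomain {d : ℕ} {W : EucSp d → ℝ} {f : L2Sp d} :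
    f ∈ mulDomain W ↔ MemLp (fun x => (W x : ℂ) * f x) 2 volume :=
  Iff.rfl

/-- The maximal operator of multiplication by the real function `W`. -/
def mulOperator {d : ℕ} (W : EucSp d → ℝ) : L2Sp d →ₗ.[ℂ] L2Sp d where
  domain := mulDomain W
  toFun :=
    { toFun := fun f => MemLp.toLp (fun x => (W x : ℂ) * (f : L2Sp d) x) (mem_mulDomain.1 f.2)
      map_add' := by
        intro f g
        rw [← MemLp.toLp_add]
        refine MemLp.toLp_congr _ _ ?_
        filter_upwards [Lp.coeFn_add (f : L2Sp d) (g : L2Sp d)] with x hx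
        rw [Submodule.coe_add, hx, Pi.add_apply, Pi.add_apply, mul_add]
      map_smul' := by
        intro c f
        rw [RingHom.id_apply, ← MemLp.toLp_const_smul]
        refine MemLp.toLp_congr _ _ ?_
        filter_upwards [Lp.coeFn_smul c (f : L2Sp d)] with x hx
        rw [Submodule.coe_smul, hx, Pi.smul_apply, Pi.smul_apply, smul_eq_mul, smul_eq_mul,
          mul_left_comm] }

/-- `G = ∇ f` in the sense of distributions, with components in `L²`. -/
def IsWeakGradient {d : ℕ} (f : L2Sp d) (G : Fin d → L2Sp d) : Prop :=
  ∀ j, ∂_{(EuclideanSpace.single j 1 : EucSp d)} (f : 𝓢'(EucSp d, ℂ)) = (G j : 𝓢'(EucSp d, ℂ))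

theorem IsWeakGradient.zero {d : ℕ} : IsWeakGradient (0 : L2Sp d) 0 := fun j => by
  simp [coe_dist_zero, LineDeriv.lineDerivOp_zero]

theorem IsWeakGradient.add {d : ℕ} {f g : L2Sp d} {G K : Fin d → L2Sp d}
    (hf : IsWeakGradient f G) (hg : IsWeakGradient g K) : IsWeakGradient (f + g) (G + K) :=
  fun j => by
    rw [coe_dist_add, LineDeriv.lineDerivOp_add, hf j, hg j, Pi.add_apply, coe_dist_add]

theorem IsWeakGradient.smul {d : ℕ} {f : L2Sp d} {G : Fin d → L2Sp d} (c : ℂ)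
    (hf : IsWeakGradient f G) : IsWeakGradient (c • f) (c • G) :=
  fun j => by
    rw [coe_dist_smul, LineDeriv.lineDerivOp_smul, hf j, Pi.smul_apply, coe_dist_smul]

/-- `τ ∈ L²(σ)` is the trace of `f ∈ H¹(ℝᵈ)`: it is the `L²(σ)`-limit of the restrictions of
Schwartz functions which converge to `f` in `H¹(ℝᵈ)`. -/
def HasTrace {d : ℕ} (σ : Measure (EucSp d)) (f : L2Sp d) (τ : Lp ℂ 2 σ) : Prop :=
  ∃ ψ : ℕ → 𝓢(EucSp d, ℂ),
    Tendsto (fun n => (ψ n).toLp 2 volume) atTop (𝓝 f) ∧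
    (∃ G : Fin d → L2Sp d, IsWeakGradient f G ∧ ∀ j, Tendsto
      (fun n => (∂_{(EuclideanSpace.single j 1 : EucSp d)} (ψ n)).toLp 2 volume) atTop (𝓝 (G j))) ∧
    Tendsto (fun n => eLpNorm (fun x => ψ n x - τ x) 2 σ) atTop (𝓝 0)

theorem schwartz_toLp_add {d : ℕ} (f g : 𝓢(EucSp d, ℂ)) :
    (f + g).toLp 2 (volume : Measure (EucSp d)) = f.toLp 2 volume + g.toLp 2 volume :=
  map_add (SchwartzMap.toLpCLM ℂ ℂ 2 (volume : Measure (EucSp d))) f g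

theorem schwartz_toLp_smul {d : ℕ} (c : ℂ) (f : 𝓢(EucSp d, ℂ)) :
    (c • f).toLp 2 (volume : Measure (EucSp d)) = c • f.toLp 2 volume :=
  map_smul (SchwartzMap.toLpCLM ℂ ℂ 2 (volume : Measure (EucSp d))) c f

theorem schwartz_toLp_zero {d : ℕ} :
    (0 : 𝓢(EucSp d, ℂ)).toLp 2 (volume : Measure (EucSp d)) = 0 :=
  map_zero (SchwartzMap.toLpCLM ℂ ℂ 2 (volume : Measure (EucSp d)))

theorem HasTrace.zero {d : ℕ} (σ : Measure (EucSp d)) : HasTrace σ 0 0 := by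
  refine ⟨0, ?_, ⟨0, IsWeakGradient.zero, fun j => ?_⟩, ?_⟩
  · simp [schwartz_toLp_zero]
  · simp [LineDeriv.lineDerivOp_zero, schwartz_toLp_zero]
  · have h0 : (fun x => (0 : 𝓢(EucSp d, ℂ)) x - (0 : Lp ℂ 2 σ) x) =ᵐ[σ] 0 := by
      filter_upwards [Lp.coeFn_zero ℂ 2 σ] with x hx
      rw [hx, Pi.zero_apply, sub_zero]
      rfl
    simp only [Pi.zero_apply, eLpNorm_congr_ae h0]
    simp

theorem HasTrace.add {d : ℕ} {σ : Measure (EucSp d)} {f g : L2Sp d} {τ κ : Lp ℂ 2 σ}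
    (hf : HasTrace σ f τ) (hg : HasTrace σ g κ) : HasTrace σ (f + g) (τ + κ) := by
  obtain ⟨ψ, h1, ⟨G, hG, h2⟩, h3⟩ := hf
  obtain ⟨ψ', h1', ⟨G', hG', h2'⟩, h3'⟩ := hg
  refine ⟨ψ + ψ', ?_, ⟨G + G', hG.add hG', fun j => ?_⟩, ?_⟩
  · simpa only [Pi.add_apply, schwartz_toLp_add] using h1.add h1'
  · simpa only [Pi.add_apply, LineDeriv.lineDerivOp_add, schwartz_toLp_add] using (h2 j).add (h2' j)
  · have h4 := h3.add h3'
    rw [add_zero] at h4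
    refine tendsto_of_tendsto_of_tendsto_of_le_of_le tendsto_const_nhds h4 (fun _ => zero_le) ?_
    intro n
    have h0 : (fun x => (ψ + ψ') n x - (τ + κ : Lp ℂ 2 σ) x) =ᵐ[σ]
        (fun x => ψ n x - τ x) + fun x => ψ' n x - κ x := by
      filter_upwards [Lp.coeFn_add τ κ] with x hx
      simp only [hx, Pi.add_apply, add_apply]
      ring
    simp only [eLpNorm_congr_ae h0]
    exact eLpNorm_add_le ((ψ n).continuous.aestronglyMeasurable.sub (Lp.aestronglyMeasurable τ))
      ((ψ' n).continuous.aestronglyMeasurable.sub (Lp.aestronglyMeasurable κ)) (by norm_num)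

theorem HasTrace.smul {d : ℕ} {σ : Measure (EucSp d)} {f : L2Sp d} {τ : Lp ℂ 2 σ} (c : ℂ)
    (hf : HasTrace σ f τ) : HasTrace σ (c • f) (c • τ) := by
  obtain ⟨ψ, h1, ⟨G, hG, h2⟩, h3⟩ := hf
  refine ⟨c • ψ, ?_, ⟨c • G, hG.smul c, fun j => ?_⟩, ?_⟩
  · simpa only [Pi.smul_apply, schwartz_toLp_smul] using h1.const_smul c
  · simpa only [Pi.smul_apply, LineDeriv.lineDerivOp_smul, schwartz_toLp_smul] using
      (h2 j).const_smul c
  · have h4 := ENNReal.Tendsto.const_mul (a := ‖c‖ₑ) h3 (Or.inr enorm_ne_top)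
    rw [mul_zero] at h4
    refine h4.congr fun n => ?_
    have h0 : (fun x => (c • ψ) n x - (c • τ : Lp ℂ 2 σ) x) =ᵐ[σ]
        c • fun x => ψ n x - τ x := by
      filter_upwards [Lp.coeFn_smul c τ] with x hx
      simp only [hx, Pi.smul_apply, smul_apply, smul_sub]
    rw [eLpNorm_congr_ae h0, eLpNorm_const_smul]

/-- The value `𝔞[f, g] = (∇f, ∇g) - ∫ α f|_Σ conj(g|_Σ) dσ` of the form, in terms of the gradients
`G = ∇f`, `K = ∇g` and the traces `τ = f|_Σ`, `κ = g|_Σ`. The inner product of Mathlib is linear in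
its second argument. -/
def deltaFormValue {d : ℕ} (σ : Measure (EucSp d)) (α : EucSp d → ℝ)
    (G K : Fin d → L2Sp d) (τ κ : Lp ℂ 2 σ) : ℂ :=
  (∑ j, inner ℂ (K j) (G j)) - ∫ x, (α x : ℂ) * τ x * (starRingEnd ℂ) (κ x) ∂σ

/-- The operator `A_{δ,α}` associated with the form `𝔞` on `H¹(ℝᵈ)`: `f ∈ dom A` with `A f = h` iff
`f ∈ H¹(ℝᵈ)` and `𝔞[f, g] = (h, g)` for all `g ∈ H¹(ℝᵈ)`. The integrability condition (automatic
for bounded `α`) says that the integral in the form exists. -/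
def deltaOperator {d : ℕ} (σ : Measure (EucSp d)) (α : EucSp d → ℝ) : L2Sp d →ₗ.[ℂ] L2Sp d :=
  Submodule.toLinearPMap
    { carrier := {p | MemSobolev 1 2 (p.1 : 𝓢'(EucSp d, ℂ)) ∧
        ∃ (G : Fin d → L2Sp d) (τ : Lp ℂ 2 σ), IsWeakGradient p.1 G ∧ HasTrace σ p.1 τ ∧
          ∀ (g : L2Sp d) (K : Fin d → L2Sp d) (κ : Lp ℂ 2 σ),
            MemSobolev 1 2 (g : 𝓢'(EucSp d, ℂ)) → IsWeakGradient g K → HasTrace σ g κ →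
            Integrable (fun x => (α x : ℂ) * τ x * (starRingEnd ℂ) (κ x)) σ ∧
            deltaFormValue σ α G K τ κ = inner ℂ g p.2}
      zero_mem' := by
        refine ⟨by simp [coe_dist_zero], 0, 0,
          IsWeakGradient.zero, HasTrace.zero σ, fun g K κ _ _ _ => ?_⟩
        have h0 : (fun x => (α x : ℂ) * (0 : Lp ℂ 2 σ) x * (starRingEnd ℂ) (κ x)) =ᵐ[σ] 0 := by
          filter_upwards [Lp.coeFn_zero ℂ 2 σ] with x hx
          simp only [hx, Pi.zero_apply, mul_zero, zero_mul]
        refine ⟨(integrable_zero _ _ _).congr h0.symm, ?_⟩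
        rw [deltaFormValue, integral_congr_ae h0]
        simp
      add_mem' := by
        rintro p q ⟨hp, G, τ, hG, hτ, hform⟩ ⟨hq, G', τ', hG', hτ', hform'⟩
        refine ⟨by simpa [coe_dist_add] using hp.add hq, G + G', τ + τ', hG.add hG', hτ.add hτ',
          fun g K κ hg hK hκ => ?_⟩
        obtain ⟨hi, he⟩ := hform g K κ hg hK hκ
        obtain ⟨hi', he'⟩ := hform' g K κ hg hK hκ
        have h0 : (fun x => (α x : ℂ) * (τ + τ' : Lp ℂ 2 σ) x * (starRingEnd ℂ) (κ x)) =ᵐ[σ]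
            fun x => (α x : ℂ) * τ x * (starRingEnd ℂ) (κ x)
              + (α x : ℂ) * τ' x * (starRingEnd ℂ) (κ x) := by
          filter_upwards [Lp.coeFn_add τ τ'] with x hx
          simp only [hx, Pi.add_apply]
          ring
        refine ⟨(hi.add hi').congr h0.symm, ?_⟩
        rw [deltaFormValue, integral_congr_ae h0, integral_add hi hi', Prod.snd_add, inner_add_right,
          ← he, ← he', deltaFormValue, deltaFormValue]
        simp only [Pi.add_apply, inner_add_right, Finset.sum_add_distrib]
        ring
      smul_mem' := by
        rintro c p ⟨hp, G, τ, hG, hτ, hform⟩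
        refine ⟨by simpa [coe_dist_smul] using hp.smul c, c • G, c • τ, hG.smul c, hτ.smul c,
          fun g K κ hg hK hκ => ?_⟩
        obtain ⟨hi, he⟩ := hform g K κ hg hK hκ
        have h0 : (fun x => (α x : ℂ) * (c • τ : Lp ℂ 2 σ) x * (starRingEnd ℂ) (κ x)) =ᵐ[σ]
            fun x => c * ((α x : ℂ) * τ x * (starRingEnd ℂ) (κ x)) := by
          filter_upwards [Lp.coeFn_smul c τ] with x hx
          simp only [hx, Pi.smul_apply, smul_eq_mul]
          ring
        refine ⟨(hi.const_mul c).congr h0.symm, ?_⟩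
        rw [deltaFormValue, integral_congr_ae h0, integral_const_mul, Prod.smul_snd,
          inner_smul_right, ← he, deltaFormValue]
        simp only [Pi.smul_apply, inner_smul_right, ← Finset.mul_sum]
        ring }

/-- The Schrödinger operator `-Δ - W`; its domain is `H²(ℝᵈ)` if `W` is bounded. -/
def schrodinger {d : ℕ} (W : EucSp d → ℝ) : L2Sp d →ₗ.[ℂ] L2Sp d :=
  freeLaplacian d - mulOperator W

end

open scoped NNReal

set_option linter.unusedSectionVars false

/-! ### Resolvents of unbounded operators -/

section ResolventTheory

variable {H : Type*} [NormedAddCommGroup H] [NormedSpace ℂ H]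

/-! Put `B = (1 - (2π)⁻² Δ)^{-1/2}`, which maps `L²` onto `H¹`, and `κ = (2π)²`. With `f = B x`, the
form of `-Δ + s` becomes that of the bounded operator `C_s = κ (1 - B²) + s B²`, and the operator
with form `(∇f, ∇g) - (P x, y)`, `f = B x`, `g = B y`, has the resolvent `B (C_s - P)⁻¹ B` at `-s`
as soon as `C_s - P` is invertible (`HasFormGraph.isResolventAt`). Unbounded operators and varying
domains thereby disappear.

In normal coordinates put `t = a s` with `a = ε/β`. The factor `1/a` of `V_ε` cancels `dt = a ds`,
so `V_ε` contributes `P = T_a† W_a T_a` with `(T_a x)(y, s) = (B x)(y + a s ν(y))` and `W_a` the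
multiplication by `V(y + s ν(y)) det(1 - a s W(y))`, on a fixed `L²` space over `Σ × (-β, β)`. For
`a = 0` the trace does not depend on `s`, and integration in `s` turns `V` into `α`: this is the
`δ`-interaction. Both operators thus belong to one family (`LayerModel.besselOp_scaledPotential`,
`LayerModel.adjoint_transversalAverage`), and it remains to let `a → 0`.

Three estimates enter: the trace inequality `‖T_a x‖² ≤ C ‖B x‖ ‖x‖`, uniform in `a`; the bound
`‖(T_a - T_0) B x‖² ≤ C ε² ‖B x‖ ‖x‖`; and `|det(1 - t W) - 1| ≤ b |t|`. The first makes `C_s - P`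
coercive for all `s` beyond a threshold independent of `ε`. By the second resolvent identity the
theorem reduces to bounding `D f`, where `D = T_a - T_0` and `(C_s - P) f = B x`.

The solution splits as `f = B(...) + C_s⁻¹ T† b`. The first summand corresponds to an `H²` function
and contributes `O(ε)`. The second corresponds to a layer potential, just short of the regularity
needed for `O(ε)`, and the logarithm originates here (`norm_map_energyInv_adjoint_le_log`):
replacing `s` by `4 s` changes `D C_s⁻¹ T† b` by `O(ε)`, uniformly in `s`; after about `log(1/ε)`
replacements the parameter exceeds `ε⁻²`, where the trace inequality alone yields `O(ε)`.

Convergence at non-real points follows from convergence at one real point, because the resolvents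
there are self-adjoint. -/

theorem IsResolventAt.unique {T : H →ₗ.[ℂ] H} {z : ℂ} {R R' : H →L[ℂ] H}
    (h : IsResolventAt T z R) (h' : IsResolventAt T z R') : R = R' := by
  ext f
  obtain ⟨hf, hfe⟩ := h.1 f
  simpa [hfe] using (h'.2 ⟨R f, hf⟩).symm

theorem IsResolventAt.mem_resolventSet {T : H →ₗ.[ℂ] H} {z : ℂ} {R : H →L[ℂ] H}
    (h : IsResolventAt T z R) : z ∈ unboundedResolventSet T :=
  ⟨R, h⟩

theorem IsResolventAt.unboundedResolvent_eq {T : H →ₗ.[ℂ] H} {z : ℂ} {R : H →L[ℂ] H}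
    (h : IsResolventAt T z R) : unboundedResolvent T z = R := by
  have hex : ∃ R : H →L[ℂ] H, IsResolventAt T z R := ⟨R, h⟩
  rw [unboundedResolvent, dif_pos hex]
  exact hex.choose_spec.unique h

/-- The first resolvent identity as a construction of the resolvent at another point. -/
theorem IsResolventAt.shift {T : H →ₗ.[ℂ] H} {w z : ℂ} {R : H →L[ℂ] H}
    (h : IsResolventAt T w R) (hu : IsUnit (1 - (z - w) • R)) :
    IsResolventAt T z (R * Ring.inverse (1 - (z - w) • R)) := by
  set S := Ring.inverse (1 - (z - w) • R) with hS
  have h1 : (1 - (z - w) • R) * S = 1 := Ring.mul_inverse_cancel _ hu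
  have h2 : S * (1 - (z - w) • R) = 1 := Ring.inverse_mul_cancel _ hu
  have hc : R * S = S * R := by
    have hcomm : Commute R (1 - (z - w) • R) :=
      (Commute.one_right R).sub_right ((Commute.refl R).smul_right _)
    calc R * S = (S * (1 - (z - w) • R)) * (R * S) := by rw [h2, one_mul]
      _ = S * ((1 - (z - w) • R) * R) * S := by simp only [mul_assoc]
      _ = S * (R * (1 - (z - w) • R)) * S := by rw [hcomm.eq]
      _ = S * R * ((1 - (z - w) • R) * S) := by simp only [mul_assoc]
      _ = S * R := by rw [h1, mul_one]
  constructor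
  · intro f
    obtain ⟨hf, hfe⟩ := h.1 (S f)
    refine ⟨hf, ?_⟩
    have h3 : S f - (z - w) • R (S f) = f := by
      simpa using congrArg (fun A : H →L[ℂ] H => A f) h1
    change T ⟨R (S f), hf⟩ - z • R (S f) = f
    have h4 : T ⟨R (S f), hf⟩ = S f + w • R (S f) := by rw [← sub_eq_iff_eq_add]; exact hfe
    rw [h4, add_sub_assoc, ← sub_smul, ← neg_sub, neg_smul, ← sub_eq_add_neg, h3]
  · intro f
    rw [hc]
    change S (R (T f - z • (f : H))) = f
    have h3 := h.2 f
    have h4 : R (T f - z • (f : H)) = (f : H) - (z - w) • R f := by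
      have : T f - z • (f : H) = (T f - w • (f : H)) - (z - w) • (f : H) := by
        rw [sub_smul]; abel
      rw [this, map_sub, h3, map_smul]
    rw [h4]
    simpa using congrArg (fun A : H →L[ℂ] H => A (f : H)) h2


section SelfAdjointResolvent

variable {K : Type*} [NormedAddCommGroup K] [InnerProductSpace ℂ K] [CompleteSpace K]

/-- Factor out `c`: `1 - c R = c (c⁻¹ - R)`, and the non-real number `c⁻¹` is not in the real
spectrum of `R`. -/
theorem isUnit_one_sub_smul_of_isSelfAdjoint {R : K →L[ℂ] K} (hR : IsSelfAdjoint R) {c : ℂ}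
    (hc : c.im ≠ 0) : IsUnit (1 - c • R) := by
  have hc0 : c ≠ 0 := fun h => hc (by simp [h])
  have hspec : c⁻¹ ∉ spectrum ℂ R := fun hmem => by
    have h := congrArg Complex.im (hR.mem_spectrum_eq_re hmem)
    rw [Complex.inv_im, Complex.ofReal_im, div_eq_zero_iff, neg_eq_zero] at h
    rcases h with h | h
    · exact hc h
    · exact hc0 (Complex.normSq_eq_zero.1 h)
  have hu : IsUnit (algebraMap ℂ (K →L[ℂ] K) c⁻¹ - R) := spectrum.notMem_iff.1 hspec
  have he : 1 - c • R = (Units.mk0 c hc0) • (algebraMap ℂ (K →L[ℂ] K) c⁻¹ - R) := by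
    rw [Units.smul_def, Units.val_mk0, smul_sub, Algebra.algebraMap_eq_smul_one, smul_smul,
      mul_inv_cancel₀ hc0, one_smul]
  rw [he]
  exact hu.smul _

/-- Norm convergence of self-adjoint resolvents at one real point implies norm resolvent
convergence. -/
theorem normResolventTendsto_of_real {T : ℝ → (K →ₗ.[ℂ] K)} {T₀ : K →ₗ.[ℂ] K} {l : Filter ℝ}
    {R : ℝ → (K →L[ℂ] K)} {R₀ : K →L[ℂ] K} (a : ℝ)
    (h₀ : IsResolventAt T₀ a R₀) (hR₀ : IsSelfAdjoint R₀)
    (h : ∀ᶠ ε in l, IsResolventAt (T ε) a (R ε) ∧ IsSelfAdjoint (R ε))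
    (hlim : Tendsto R l (𝓝 R₀)) : NormResolventTendsto T l T₀ := by
  intro z hz
  have hza : (z - a).im ≠ 0 := by simpa using hz
  have hs₀ := h₀.shift (isUnit_one_sub_smul_of_isSelfAdjoint hR₀ hza)
  have hs : ∀ᶠ ε in l,
      IsResolventAt (T ε) z (R ε * Ring.inverse (1 - (z - a) • R ε)) := by
    filter_upwards [h] with ε hε
    exact hε.1.shift (isUnit_one_sub_smul_of_isSelfAdjoint hε.2 hza)
  refine ⟨hs₀.mem_resolventSet, hs.mono fun ε hε => hε.mem_resolventSet, ?_⟩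
  -- Inversion is continuous at units, so `R_z = R (1 - (z - a) R)⁻¹` depends continuously on `R`.
  have hinv : Tendsto (fun ε => Ring.inverse (1 - (z - a) • R ε)) l
      (𝓝 (Ring.inverse (1 - (z - a) • R₀))) := by
    obtain ⟨u, hu⟩ := isUnit_one_sub_smul_of_isSelfAdjoint hR₀ hza
    have h1 := NormedRing.inverse_continuousAt u
    rw [hu] at h1
    exact h1.tendsto.comp (tendsto_const_nhds.sub (hlim.const_smul _))
  have hprod := (tendsto_iff_norm_sub_tendsto_zero).1 (hlim.mul hinv)
  refine hprod.congr' ?_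
  filter_upwards [hs] with ε hε
  rw [hε.unboundedResolvent_eq, hs₀.unboundedResolvent_eq]

end SelfAdjointResolvent

end ResolventTheory

/-! ### Resolvents of form perturbations -/

section FormPerturbation

open ContinuousLinearMap

variable {K M : Type*} [NormedAddCommGroup K] [InnerProductSpace ℂ K] [CompleteSpace K]
  [NormedAddCommGroup M] [InnerProductSpace ℂ M] [CompleteSpace M]

/-- The Lax–Milgram theorem for a bounded operator. -/
theorem isUnit_of_coercive {A : K →L[ℂ] K} {c : ℝ} (hc : 0 < c)
    (h : ∀ x, c * ‖x‖ ^ 2 ≤ (inner ℂ x (A x)).re) : IsUnit A := by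
  refine isUnit_of_forall_le_norm_inner_map A (c := ⟨c, hc.le⟩) hc fun x => ?_
  rw [norm_inner_symm, mul_comm]
  exact (h x).trans (Complex.re_le_norm _)

theorem norm_le_of_coercive {A : K →L[ℂ] K} {c : ℝ} (hc : 0 < c)
    (h : ∀ x, c * ‖x‖ ^ 2 ≤ (inner ℂ x (A x)).re) (x : K) : ‖x‖ ≤ c⁻¹ * ‖A x‖ := by
  have h1 : c * ‖x‖ ^ 2 ≤ ‖x‖ * ‖A x‖ :=
    (h x).trans ((Complex.re_le_norm _).trans (norm_inner_le_norm _ _))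
  rcases eq_or_lt_of_le (norm_nonneg x) with h0 | h0
  · rw [← h0]; positivity
  · rw [inv_mul_eq_div, le_div_iff₀ hc]
    nlinarith

/-! ### The free energy operator and decay of its inverse in `s`. -/

/-- The operator `κ (1 - B²) + s B²`, which represents the form of `-Δ + s` if `B` is a
Bessel potential. -/
noncomputable def energyOp (κ : ℝ) (B : K →L[ℂ] K) (s : ℝ) : K →L[ℂ] K :=
  (κ : ℂ) • (1 - B * B) + (s : ℂ) • (B * B)

variable {B : K →L[ℂ] K} {κ s : ℝ}

theorem isSelfAdjoint_energyOp (hB : IsSelfAdjoint B) : IsSelfAdjoint (energyOp κ B s) := by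
  have h2 : IsSelfAdjoint (B * B) := by rw [IsSelfAdjoint, star_mul, hB.star_eq]
  have hr : ∀ r : ℝ, IsSelfAdjoint (r : ℂ) := fun r => Complex.conj_ofReal r
  exact ((hr κ).smul ((IsSelfAdjoint.one _).sub h2)).add ((hr s).smul h2)

theorem inner_map_of_isSelfAdjoint (hB : IsSelfAdjoint B) (x y : K) :
    inner ℂ (B x) y = inner ℂ x (B y) :=
  (isSelfAdjoint_iff_isSymmetric.1 hB) x y

theorem re_inner_energyOp (hB : IsSelfAdjoint B) (x : K) :
    (inner ℂ x (energyOp κ B s x)).re = κ * (‖x‖ ^ 2 - ‖B x‖ ^ 2) + s * ‖B x‖ ^ 2 := by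
  have h1 : inner ℂ x (B (B x)) = ((‖B x‖ ^ 2 : ℝ) : ℂ) := by
    rw [← inner_map_of_isSelfAdjoint hB, inner_self_eq_norm_sq_to_K]; simp
  have h2 : inner ℂ x x = ((‖x‖ ^ 2 : ℝ) : ℂ) := by
    rw [inner_self_eq_norm_sq_to_K]; simp
  simp only [energyOp, add_apply, smul_apply, sub_apply, one_apply_eq_self, mul_apply_eq_comp,
    inner_add_right, inner_smul_right, inner_sub_right, h1, h2]
  rw [← Complex.ofReal_sub, ← Complex.ofReal_mul, ← Complex.ofReal_mul, ← Complex.ofReal_add,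
    Complex.ofReal_re]

/-- For `f = B x`, `‖x‖` is an `H¹` norm and `‖B x‖` the `L²` norm of `f`. The energy dominates `κ
‖x‖²` by this lemma and `s ‖B x‖²` by the next one; all decay in `s` stems from the latter. -/
theorem le_re_inner_energyOp (hB : IsSelfAdjoint B) (hs : κ ≤ s) (x : K) :
    κ * ‖x‖ ^ 2 ≤ (inner ℂ x (energyOp κ B s x)).re := by
  rw [re_inner_energyOp hB]
  nlinarith [sq_nonneg ‖B x‖]

theorem le_re_inner_energyOp' (hB : IsSelfAdjoint B) (hB1 : ∀ x, ‖B x‖ ≤ ‖x‖) (hκ : 0 ≤ κ)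
    (x : K) : s * ‖B x‖ ^ 2 ≤ (inner ℂ x (energyOp κ B s x)).re := by
  rw [re_inner_energyOp hB]
  have h := pow_le_pow_left₀ (norm_nonneg _) (hB1 x) 2
  nlinarith

theorem isUnit_energyOp (hB : IsSelfAdjoint B) (hκ : 0 < κ) (hs : κ ≤ s) :
    IsUnit (energyOp κ B s) :=
  isUnit_of_coercive hκ (le_re_inner_energyOp hB hs)

/-- The inverse of the energy operator. -/
noncomputable def energyInv (κ : ℝ) (B : K →L[ℂ] K) (s : ℝ) : K →L[ℂ] K :=
  Ring.inverse (energyOp κ B s)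

theorem energyOp_energyInv (hB : IsSelfAdjoint B) (hκ : 0 < κ) (hs : κ ≤ s) (x : K) :
    energyOp κ B s (energyInv κ B s x) = x := by
  simpa [energyInv] using congrArg (fun A : K →L[ℂ] K => A x)
    (Ring.mul_inverse_cancel _ (isUnit_energyOp hB hκ hs))

theorem energyInv_energyOp (hB : IsSelfAdjoint B) (hκ : 0 < κ) (hs : κ ≤ s) (x : K) :
    energyInv κ B s (energyOp κ B s x) = x := by
  simpa [energyInv] using congrArg (fun A : K →L[ℂ] K => A x)
    (Ring.inverse_mul_cancel _ (isUnit_energyOp hB hκ hs))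

theorem energyOp_apply_comm (x : K) : energyOp κ B s (B x) = B (energyOp κ B s x) := by
  simp [energyOp]

theorem energyInv_apply_comm (hB : IsSelfAdjoint B) (hκ : 0 < κ) (hs : κ ≤ s) (x : K) :
    energyInv κ B s (B x) = B (energyInv κ B s x) := by
  conv_lhs => rw [← energyOp_energyInv hB hκ hs x, ← energyOp_apply_comm,
    energyInv_energyOp hB hκ hs]

/-- With `E_s` the inverse energy operator and `κ` fixed, this lemma and the next two give `E_s =
O(1)`, `B E_s = O(s^{-1/2})` and `B² E_s = O(s⁻¹)`. -/
theorem norm_energyInv_apply_le (hB : IsSelfAdjoint B) (hκ : 0 < κ) (hs : κ ≤ s) (x : K) :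
    ‖energyInv κ B s x‖ ≤ κ⁻¹ * ‖x‖ := by
  have h := norm_le_of_coercive hκ (le_re_inner_energyOp hB hs) (energyInv κ B s x)
  rwa [energyOp_energyInv hB hκ hs] at h

theorem norm_map_energyInv_sq_le (hB : IsSelfAdjoint B) (hB1 : ∀ x, ‖B x‖ ≤ ‖x‖) (hκ : 0 < κ)
    (hs : κ ≤ s) (x : K) : s * ‖B (energyInv κ B s x)‖ ^ 2 ≤ κ⁻¹ * ‖x‖ ^ 2 := by
  have h := le_re_inner_energyOp' (s := s) hB hB1 hκ.le (energyInv κ B s x)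
  rw [energyOp_energyInv hB hκ hs] at h
  have h1 : (inner ℂ (energyInv κ B s x) x).re ≤ ‖energyInv κ B s x‖ * ‖x‖ :=
    (Complex.re_le_norm _).trans (norm_inner_le_norm _ _)
  have h2 := norm_energyInv_apply_le hB hκ hs x
  nlinarith [norm_nonneg x]

/-- The energy bound is applied to `B E_s x` instead of `E_s x`: moving one `B` across the inner
product leaves `B² E_s x` on both sides. -/
theorem norm_map_map_energyInv_le (hB : IsSelfAdjoint B) (hB1 : ∀ x, ‖B x‖ ≤ ‖x‖) (hκ : 0 < κ)
    (hs : κ ≤ s) (x : K) : s * ‖B (B (energyInv κ B s x))‖ ≤ ‖x‖ := by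
  have h := le_re_inner_energyOp' (s := s) hB hB1 hκ.le (B (energyInv κ B s x))
  rw [energyOp_apply_comm, energyOp_energyInv hB hκ hs, ← inner_map_of_isSelfAdjoint hB] at h
  have h1 : (inner ℂ (B (B (energyInv κ B s x))) x).re ≤ ‖B (B (energyInv κ B s x))‖ * ‖x‖ :=
    (Complex.re_le_norm _).trans (norm_inner_le_norm _ _)
  rcases eq_or_lt_of_le (norm_nonneg (B (B (energyInv κ B s x)))) with h0 | h0
  · rw [← h0]; simp
  · nlinarith

/-- The resolvent identity for `C_r - C_s = (r - s) B²`. -/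
theorem energyInv_sub_energyInv (hB : IsSelfAdjoint B) (hκ : 0 < κ) {r : ℝ} (hs : κ ≤ s)
    (hr : κ ≤ r) (x : K) : energyInv κ B s x - energyInv κ B r x =
      ((r - s : ℝ) : ℂ) • energyInv κ B s (B (B (energyInv κ B r x))) := by
  set w := energyInv κ B r x
  have hx : x = energyOp κ B r w := (energyOp_energyInv hB hκ hr x).symm
  have h1 : energyOp κ B r w = energyOp κ B s w + ((r - s : ℝ) : ℂ) • B (B w) := by
    simp only [energyOp, add_apply, smul_apply, sub_apply, one_apply_eq_self, mul_apply_eq_comp,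
      Complex.ofReal_sub, sub_smul]
    abel
  rw [hx, h1, map_add, energyInv_energyOp hB hκ hs, map_smul, add_sub_cancel_left]


/-- If `T` satisfies a trace inequality, then `E_s T†` is bounded by `s^{-1/2}` in the norm induced
by another such operator. -/
theorem norm_map_energyInv_adjoint_le (hB : IsSelfAdjoint B) (hB1 : ∀ x, ‖B x‖ ≤ ‖x‖)
    (hκ : 0 < κ) (hs : κ ≤ s) {C : ℝ} (hC : 0 ≤ C) {T D : K →L[ℂ] M}
    (hT : ∀ x, ‖T x‖ ^ 2 ≤ C * (‖B x‖ * ‖x‖)) (hD : ∀ x, ‖D x‖ ^ 2 ≤ C * (‖B x‖ * ‖x‖)) (b : M) :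
    ‖D (energyInv κ B s (adjoint T b))‖ ≤ C / √(s * κ) * ‖b‖ := by
  set w := energyInv κ B s (adjoint T b) with hw
  set e := (inner ℂ w (energyOp κ B s w)).re with he
  have hsk : 0 < s * κ := mul_pos (hκ.trans_le hs) hκ
  have h1 : κ * ‖w‖ ^ 2 ≤ e := le_re_inner_energyOp hB hs w
  have h2 : s * ‖B w‖ ^ 2 ≤ e := le_re_inner_energyOp' hB hB1 hκ.le w
  have he0 : 0 ≤ e := le_trans (by positivity) h1
  -- Geometric mean of the two lower bounds for the energy `e` of `w`; the product `‖B w‖ ‖w‖` is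
  -- what the trace inequality contains.
  have h3 : ‖B w‖ * ‖w‖ ≤ e / √(s * κ) := by
    rw [le_div_iff₀ (Real.sqrt_pos.2 hsk)]
    refine abs_le_of_sq_le_sq' ?_ he0 |>.2
    rw [mul_pow, Real.sq_sqrt hsk.le]
    have := mul_le_mul h1 h2 (by have := hκ.trans_le hs; positivity) he0
    nlinarith
  -- As `w = E_s T† b`, its energy is `Re (w, T† b) = Re (T w, b)`. Combined with `‖T w‖² ≤ q e`,
  -- this bounds `T w` itself.
  have h4 : e ≤ ‖T w‖ * ‖b‖ := by
    rw [he, hw, energyOp_energyInv hB hκ hs, ← hw, adjoint_inner_right]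
    exact (Complex.re_le_norm _).trans (norm_inner_le_norm _ _)
  set q := C / √(s * κ) with hq
  have hq0 : 0 ≤ q := by positivity
  have h5 : ‖T w‖ ^ 2 ≤ q * e := by
    refine (hT w).trans ((mul_le_mul_of_nonneg_left h3 hC).trans (le_of_eq ?_))
    rw [hq]; ring
  have h6 : ‖D w‖ ^ 2 ≤ q * e := by
    refine (hD w).trans ((mul_le_mul_of_nonneg_left h3 hC).trans (le_of_eq ?_))
    rw [hq]; ring
  have h7 : ‖T w‖ ≤ q * ‖b‖ := by
    rcases eq_or_lt_of_le (norm_nonneg (T w)) with h0 | h0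
    · rw [← h0]; positivity
    · have : ‖T w‖ ^ 2 ≤ q * (‖T w‖ * ‖b‖) := h5.trans (mul_le_mul_of_nonneg_left h4 hq0)
      nlinarith
  refine abs_le_of_sq_le_sq' ?_ (by positivity) |>.2
  calc ‖D w‖ ^ 2 ≤ q * e := h6
    _ ≤ q * (‖T w‖ * ‖b‖) := mul_le_mul_of_nonneg_left h4 hq0
    _ ≤ q * (q * ‖b‖ * ‖b‖) := by gcongr
    _ = (q * ‖b‖) ^ 2 := by ring

/-- On the range of `B` the difference `D` of traces gains a factor `ε`; `D B E_s` is then of size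
`ε s^{-1/4}`. -/
theorem norm_map_map_energyInv_sq_le (hB : IsSelfAdjoint B) (hB1 : ∀ x, ‖B x‖ ≤ ‖x‖)
    (hκ : 0 < κ) (hs : κ ≤ s) {C ε : ℝ} (hC : 0 ≤ C) {D : K →L[ℂ] M}
    (hD : ∀ x, ‖D (B x)‖ ^ 2 ≤ C * ε ^ 2 * (‖B x‖ * ‖x‖)) (x : K) :
    ‖D (B (energyInv κ B s x))‖ ^ 2 ≤ C * ε ^ 2 / (κ * √(s * κ)) * ‖x‖ ^ 2 := by
  have hsk : 0 < s * κ := mul_pos (hκ.trans_le hs) hκ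
  have h1 := norm_energyInv_apply_le hB hκ hs x
  have h2 : ‖B (energyInv κ B s x)‖ ≤ ‖x‖ / √(s * κ) := by
    rw [le_div_iff₀ (Real.sqrt_pos.2 hsk)]
    refine abs_le_of_sq_le_sq' ?_ (norm_nonneg _) |>.2
    rw [mul_pow, Real.sq_sqrt hsk.le]
    have := norm_map_energyInv_sq_le hB hB1 hκ hs x
    rw [inv_mul_eq_div, le_div_iff₀ hκ] at this
    linarith
  calc _ ≤ C * ε ^ 2 * (‖B (energyInv κ B s x)‖ * ‖energyInv κ B s x‖) := hD _
    _ ≤ C * ε ^ 2 * (‖x‖ / √(s * κ) * (κ⁻¹ * ‖x‖)) := by gcongr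
    _ = _ := by field_simp

/-- Rate `s^{-3/4}` for `T B E_s`: the trace inequality takes the geometric mean of `B² E_s =
O(s⁻¹)` and `B E_s = O(s^{-1/2})`. -/
theorem norm_trace_map_energyInv_sq_le (hB : IsSelfAdjoint B) (hB1 : ∀ x, ‖B x‖ ≤ ‖x‖)
    (hκ : 0 < κ) (hs : κ ≤ s) {C : ℝ} (hC : 0 ≤ C) {T : K →L[ℂ] M}
    (hT : ∀ x, ‖T x‖ ^ 2 ≤ C * (‖B x‖ * ‖x‖)) (x : K) :
    ‖T (B (energyInv κ B s x))‖ ^ 2 ≤ C / (s * √(s * κ)) * ‖x‖ ^ 2 := by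
  have hs0 : 0 < s := hκ.trans_le hs
  have hsk : 0 < s * κ := mul_pos hs0 hκ
  have h1 : ‖B (B (energyInv κ B s x))‖ ≤ s⁻¹ * ‖x‖ := by
    rw [inv_mul_eq_div, le_div_iff₀ hs0, mul_comm]
    exact norm_map_map_energyInv_le hB hB1 hκ hs x
  have h2 : ‖B (energyInv κ B s x)‖ ≤ ‖x‖ / √(s * κ) := by
    rw [le_div_iff₀ (Real.sqrt_pos.2 hsk)]
    refine abs_le_of_sq_le_sq' ?_ (norm_nonneg _) |>.2
    rw [mul_pow, Real.sq_sqrt hsk.le]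
    have := norm_map_energyInv_sq_le hB hB1 hκ hs x
    rw [inv_mul_eq_div, le_div_iff₀ hκ] at this
    linarith
  calc _ ≤ C * (‖B (B (energyInv κ B s x))‖ * ‖B (energyInv κ B s x)‖) := hT _
    _ ≤ C * (s⁻¹ * ‖x‖ * (‖x‖ / √(s * κ))) := by gcongr
    _ = _ := by field_simp

theorem isSelfAdjoint_energyInv (hB : IsSelfAdjoint B) : IsSelfAdjoint (energyInv κ B s) :=
  (isSelfAdjoint_energyOp hB).ringInverse

/-- The resolvent identity gives `3 s · D B E_s · B E_{4s} T† b`. The factors are of size `s`, `ε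
s^{-1/4}` and `s^{-3/4}`, so the powers of `s` cancel exactly. This borderline balance is why one
step costs `O(ε)` at every scale. -/
theorem norm_step_le (hB : IsSelfAdjoint B) (hB1 : ∀ x, ‖B x‖ ≤ ‖x‖)
    (hκ : 1 ≤ κ) (hs : κ ≤ s) {C ε : ℝ} (hC : 0 ≤ C) (hε : 0 < ε) {T D : K →L[ℂ] M}
    (hT : ∀ x, ‖T x‖ ^ 2 ≤ C * (‖B x‖ * ‖x‖))
    (hDB : ∀ x, ‖D (B x)‖ ^ 2 ≤ C * ε ^ 2 * (‖B x‖ * ‖x‖)) (b : M) :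
    ‖D (energyInv κ B s (adjoint T b)) - D (energyInv κ B (4 * s) (adjoint T b))‖
      ≤ 3 * C * ε * ‖b‖ := by
  have hκ0 : 0 < κ := by linarith
  have hs0 : 0 < s := by linarith
  have hr : κ ≤ 4 * s := by linarith
  set w := B (energyInv κ B (4 * s) (adjoint T b)) with hw
  have hwb : ‖w‖ ^ 2 ≤ C / (s * √(s * κ)) * ‖b‖ ^ 2 := by
    -- Duality: `B E_{4s} T†` is the adjoint of `T E_{4s} B = T B E_{4s}`, whose norm is known.
    have h1 : ‖w‖ ^ 2 ≤ ‖T (B (energyInv κ B (4 * s) w))‖ * ‖b‖ := by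
      have : inner ℂ w w = inner ℂ (T (B (energyInv κ B (4 * s) w))) b := by
        conv_lhs => rw [hw]
        rw [← inner_map_of_isSelfAdjoint hB, ← inner_map_of_isSelfAdjoint
          (isSelfAdjoint_energyInv hB), adjoint_inner_right, energyInv_apply_comm hB hκ0 hr]
      have h2 : ‖w‖ ^ 2 = ‖inner ℂ w w‖ := by
        rw [inner_self_eq_norm_sq_to_K]; simp
      rw [h2, this]
      exact norm_inner_le_norm _ _
    have h3 := norm_trace_map_energyInv_sq_le hB hB1 hκ0 hr hC hT w
    have h4 : C / (4 * s * √(4 * s * κ)) ≤ C / (s * √(s * κ)) := by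
      gcongr <;> nlinarith
    set p := C / (s * √(s * κ))
    have hp : 0 ≤ p := by positivity
    have h5 : ‖T (B (energyInv κ B (4 * s) w))‖ ^ 2 ≤ p * ‖w‖ ^ 2 :=
      h3.trans (by gcongr)
    rcases eq_or_lt_of_le (norm_nonneg w) with h0 | h0
    · have h6 : ‖w‖ ^ 2 = 0 := by rw [← h0]; norm_num
      rw [h6]; positivity
    · have h6 : (‖w‖ ^ 2) ^ 2 ≤ (p * ‖w‖ ^ 2) * ‖b‖ ^ 2 := by
        calc (‖w‖ ^ 2) ^ 2 ≤ (‖T (B (energyInv κ B (4 * s) w))‖ * ‖b‖) ^ 2 := by gcongr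
          _ = ‖T (B (energyInv κ B (4 * s) w))‖ ^ 2 * ‖b‖ ^ 2 := by ring
          _ ≤ _ := by gcongr
      have h7 : 0 < ‖w‖ ^ 2 := by positivity
      nlinarith
  rw [← map_sub, energyInv_sub_energyInv hB hκ0 hs hr, map_smul, norm_smul, ← hw,
    energyInv_apply_comm hB hκ0 hs, Complex.norm_real]
  have h1 := norm_map_map_energyInv_sq_le hB hB1 hκ0 hs hC hDB w
  refine abs_le_of_sq_le_sq' ?_ (by positivity) |>.2
  have h2 : ‖D (B (energyInv κ B s w))‖ ^ 2 ≤
      C * ε ^ 2 / (κ * √(s * κ)) * (C / (s * √(s * κ)) * ‖b‖ ^ 2) := h1.trans (by gcongr)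
  have h3 : C * ε ^ 2 / (κ * √(s * κ)) * (C / (s * √(s * κ)) * ‖b‖ ^ 2) =
      (C * ε * ‖b‖) ^ 2 / (s ^ 2 * κ ^ 2) := by
    have : √(s * κ) ^ 2 = s * κ := Real.sq_sqrt (by positivity)
    have h0 : √(s * κ) ≠ 0 := by positivity
    field_simp
    rw [mul_comm κ s, this]
    ring
  rw [h3, le_div_iff₀ (by positivity)] at h2
  have h4 : ‖D (B (energyInv κ B s w))‖ ^ 2 * s ^ 2 ≤ (C * ε * ‖b‖) ^ 2 := by
    refine le_trans ?_ h2
    have : (1 : ℝ) ≤ κ ^ 2 := one_le_pow₀ hκ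
    rw [← mul_assoc]
    exact le_mul_of_one_le_right (by positivity) this
  -- The prefactor is `4 s - s = 3 s`, which accounts for the constant `3`.
  rw [Real.norm_eq_abs, mul_pow, sq_abs]
  nlinarith

/-- The logarithmic estimate: a telescoping sum of resolvent differences along the scales
`4ᵏ s ≤ ε⁻²`. -/
theorem norm_map_energyInv_adjoint_le_log (hB : IsSelfAdjoint B) (hB1 : ∀ x, ‖B x‖ ≤ ‖x‖)
    (hκ : 1 ≤ κ) (hs : κ ≤ s) {C ε : ℝ} (hC : 0 ≤ C) (hε : 0 < ε) (hε1 : ε ≤ 1) {T D : K →L[ℂ] M}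
    (hT : ∀ x, ‖T x‖ ^ 2 ≤ C * (‖B x‖ * ‖x‖)) (hD : ∀ x, ‖D x‖ ^ 2 ≤ C * (‖B x‖ * ‖x‖))
    (hDB : ∀ x, ‖D (B x)‖ ^ 2 ≤ C * ε ^ 2 * (‖B x‖ * ‖x‖)) (b : M) :
    ‖D (energyInv κ B s (adjoint T b))‖ ≤ 7 * C * (ε * (1 + |Real.log ε|)) * ‖b‖ := by
  have hκ0 : 0 < κ := by linarith
  have hs0 : 0 < s := by linarith
  set X : ℕ → M := fun k => D (energyInv κ B (4 ^ k * s) (adjoint T b)) with hX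
  have hk : ∀ k : ℕ, κ ≤ 4 ^ k * s := fun k =>
    hs.trans (le_mul_of_one_le_left hs0.le (one_le_pow₀ (by norm_num)))
  have hstep : ∀ N : ℕ, ‖X 0‖ ≤ N * (3 * C * ε * ‖b‖) + ‖X N‖ := by
    intro N
    induction N with
    | zero => simp
    | succ N ih =>
      have h1 := norm_step_le hB hB1 hκ (hk N) hC hε hT hDB b
      rw [← mul_assoc, ← pow_succ'] at h1
      have h2 : ‖X N‖ ≤ ‖X N - X (N + 1)‖ + ‖X (N + 1)‖ := by
        simpa using norm_add_le (X N - X (N + 1)) (X (N + 1))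
      push_cast
      linarith
  -- The least `N` with `N log 2 ≥ |log ε|`, that is `2 ^ N ≥ ε⁻¹`.
  set N := ⌈|Real.log ε| / Real.log 2⌉₊ with hN
  have hl2 : (1 / 2 : ℝ) < Real.log 2 := by have := Real.log_two_gt_d9; linarith
  have hN1 : (N : ℝ) ≤ 1 + 2 * |Real.log ε| := by
    have h1 := (Nat.ceil_lt_add_one (a := |Real.log ε| / Real.log 2) (by positivity)).le
    have h2 : |Real.log ε| / Real.log 2 ≤ 2 * |Real.log ε| := by
      rw [div_le_iff₀ (by linarith)]
      nlinarith [abs_nonneg (Real.log ε)]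
    linarith
  have hN2 : ε⁻¹ ≤ 2 ^ N := by
    have h1 : |Real.log ε| / Real.log 2 ≤ N := Nat.le_ceil _
    rw [div_le_iff₀ (by linarith), abs_of_nonpos (Real.log_nonpos hε.le hε1), ← Real.log_inv,
      ← Real.log_pow] at h1
    exact (Real.log_le_log_iff (by positivity) (by positivity)).1 h1
  -- At this scale `√(4 ^ N s κ) ≥ ε⁻¹`, so the bound without any gain from `D` already has size
  -- `ε`.
  have hlast : ‖X N‖ ≤ C * ε * ‖b‖ := by
    refine (norm_map_energyInv_adjoint_le hB hB1 hκ0 (hk N) hC hT hD b).trans ?_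
    have h1 : ε⁻¹ ≤ √(4 ^ N * s * κ) := by
      refine Real.le_sqrt_of_sq_le ?_
      have h2 : (ε⁻¹) ^ 2 ≤ (2 ^ N : ℝ) ^ 2 := by gcongr
      rw [← pow_mul, mul_comm N 2, pow_mul] at h2
      norm_num at h2 ⊢
      have h3 : (1 : ℝ) ≤ s * κ := by nlinarith
      have h4 : (0 : ℝ) < 4 ^ N := by positivity
      nlinarith
    gcongr
    rw [div_le_iff₀ (lt_of_lt_of_le (by positivity) h1)]
    have h2 : 1 ≤ ε * √(4 ^ N * s * κ) := by
      rwa [inv_le_iff_one_le_mul₀' hε] at h1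
    nlinarith
  have h0 := hstep N
  have h1 : ‖D (energyInv κ B s (adjoint T b))‖ = ‖X 0‖ := by simp [hX]
  rw [h1]
  have h2 : 0 ≤ 3 * C * ε * ‖b‖ := by positivity
  have h3 : (N : ℝ) * (3 * C * ε * ‖b‖) ≤ (1 + 2 * |Real.log ε|) * (3 * C * ε * ‖b‖) := by gcongr
  have h4 : 0 ≤ C * ε * ‖b‖ * |Real.log ε| := by positivity
  have h5 : 0 ≤ C * ε * ‖b‖ := by positivity
  nlinarith

/-! ### Perturbed energy operators and the comparison of their resolvents. -/

/-- The perturbation `T† W T - B Q B` of the energy operator. -/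
noncomputable def formPert (B Q : K →L[ℂ] K) (T : K →L[ℂ] M) (W : M →L[ℂ] M) : K →L[ℂ] K :=
  adjoint T ∘L W ∘L T - B * Q * B

theorem inner_formPert (hB : IsSelfAdjoint B) (Q : K →L[ℂ] K) (T : K →L[ℂ] M) (W : M →L[ℂ] M)
    (x y : K) : inner ℂ y (formPert B Q T W x) =
      inner ℂ (T y) (W (T x)) - inner ℂ (B y) (Q (B x)) := by
  simp only [formPert, sub_apply, comp_apply, mul_apply_eq_comp, inner_sub_right,
    adjoint_inner_right, inner_map_of_isSelfAdjoint hB]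

theorem isSelfAdjoint_formPert (hB : IsSelfAdjoint B) {Q : K →L[ℂ] K} (hQ : IsSelfAdjoint Q)
    (T : K →L[ℂ] M) {W : M →L[ℂ] M} (hW : IsSelfAdjoint W) :
    IsSelfAdjoint (formPert B Q T W) := by
  rw [isSelfAdjoint_iff_isSymmetric]
  intro x y
  change inner ℂ (formPert B Q T W x) y = inner ℂ x (formPert B Q T W y)
  rw [inner_formPert hB, ← inner_conj_symm, inner_formPert hB, map_sub, inner_conj_symm,
    inner_conj_symm, inner_map_of_isSelfAdjoint hW, inner_map_of_isSelfAdjoint hQ]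

/-- The resolvent `B (C_s - P)⁻¹ B` at the point `-s`. -/
noncomputable def formResolvent (κ : ℝ) (B : K →L[ℂ] K) (s : ℝ) (P : K →L[ℂ] K) : K →L[ℂ] K :=
  B * Ring.inverse (energyOp κ B s - P) * B

theorem isSelfAdjoint_formResolvent (hB : IsSelfAdjoint B) {P : K →L[ℂ] K}
    (hP : IsSelfAdjoint P) : IsSelfAdjoint (formResolvent κ B s P) := by
  have h := ((isSelfAdjoint_energyOp (κ := κ) (s := s) hB).sub hP).ringInverse
  rw [IsSelfAdjoint, formResolvent, star_mul, star_mul, hB.star_eq, h.star_eq, mul_assoc]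

/-- A threshold beyond which the perturbed energy operator is coercive. -/
noncomputable def coercivityBound (κ C w q : ℝ) : ℝ := κ + q + (w * C) ^ 2 / (2 * κ)

theorem coercive_energyOp_sub_formPert (hB : IsSelfAdjoint B) (hκ : 0 < κ) {C w q : ℝ}
    (hw : 0 ≤ w) (hs : coercivityBound κ C w q ≤ s)
    {Q : K →L[ℂ] K} (hQ : ‖Q‖ ≤ q) {T : K →L[ℂ] M} {W : M →L[ℂ] M} (hW : ‖W‖ ≤ w)
    (hT : ∀ x, ‖T x‖ ^ 2 ≤ C * (‖B x‖ * ‖x‖)) (x : K) :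
    κ / 2 * ‖x‖ ^ 2 ≤ (inner ℂ x ((energyOp κ B s - formPert B Q T W) x)).re := by
  rw [sub_apply, inner_sub_right, Complex.sub_re, re_inner_energyOp hB, inner_formPert hB,
    Complex.sub_re]
  have h1 : (inner ℂ (T x) (W (T x))).re ≤ w * (C * (‖B x‖ * ‖x‖)) := by
    calc _ ≤ ‖T x‖ * ‖W (T x)‖ := (Complex.re_le_norm _).trans (norm_inner_le_norm _ _)
      _ ≤ ‖T x‖ * (w * ‖T x‖) := by gcongr; exact W.le_of_opNorm_le hW _
      _ = w * ‖T x‖ ^ 2 := by ring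
      _ ≤ _ := by gcongr; exact hT x
  have h2 : -(inner ℂ (B x) (Q (B x))).re ≤ q * ‖B x‖ ^ 2 := by
    calc _ ≤ ‖B x‖ * ‖Q (B x)‖ :=
          (neg_le_abs _).trans ((Complex.abs_re_le_norm _).trans (norm_inner_le_norm _ _))
      _ ≤ ‖B x‖ * (q * ‖B x‖) := by gcongr; exact Q.le_of_opNorm_le hQ _
      _ = _ := by ring
  have h3 : (w * C) ^ 2 / (2 * κ) * ‖B x‖ ^ 2 ≤ (s - κ - q) * ‖B x‖ ^ 2 := by
    rw [coercivityBound] at hs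
    gcongr
    linarith
  -- Young's inequality: half of the coercivity constant `κ` is kept, and the term with `‖B x‖²` is
  -- paid for by `s`. This dictates `coercivityBound`.
  have h4 : w * (C * (‖B x‖ * ‖x‖)) ≤ κ / 2 * ‖x‖ ^ 2 + (w * C) ^ 2 / (2 * κ) * ‖B x‖ ^ 2 := by
    have h5 : κ / 2 * ‖x‖ ^ 2 + (w * C) ^ 2 / (2 * κ) * ‖B x‖ ^ 2 - w * (C * (‖B x‖ * ‖x‖)) =
        (κ * ‖x‖ - w * C * ‖B x‖) ^ 2 / (2 * κ) := by
      field_simp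
      ring
    have h6 : 0 ≤ (κ * ‖x‖ - w * C * ‖B x‖) ^ 2 / (2 * κ) := by positivity
    linarith
  nlinarith

/-- The solution `(C_s - P)⁻¹ B y` is Lipschitz along the layer, up to a logarithm. -/
theorem norm_diff_map_inverse_le (hB : IsSelfAdjoint B) (hB1 : ∀ x, ‖B x‖ ≤ ‖x‖)
    (hκ : 1 ≤ κ) {C w q ε : ℝ} (hC : 0 ≤ C) (hw : 0 ≤ w) (hq : 0 ≤ q)
    (hs : coercivityBound κ C w q ≤ s) (hε : 0 < ε) (hε1 : ε ≤ 1)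
    {Q : K →L[ℂ] K} (hQ : ‖Q‖ ≤ q) {T D : K →L[ℂ] M} {W : M →L[ℂ] M} (hW : ‖W‖ ≤ w)
    (hT : ∀ x, ‖T x‖ ^ 2 ≤ C * (‖B x‖ * ‖x‖)) (hD : ∀ x, ‖D x‖ ^ 2 ≤ C * (‖B x‖ * ‖x‖))
    (hDB : ∀ x, ‖D (B x)‖ ^ 2 ≤ C * ε ^ 2 * (‖B x‖ * ‖x‖)) (y : K) :
    ‖Ring.inverse (energyOp κ B s - formPert B Q T W) (B y)‖ ≤ 2 * ‖y‖ ∧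
    ‖T (Ring.inverse (energyOp κ B s - formPert B Q T W) (B y))‖ ≤ √C * (2 * ‖y‖) ∧
    ‖D (Ring.inverse (energyOp κ B s - formPert B Q T W) (B y))‖ ≤
      (√C * (1 + 2 * q) + 14 * C * (w * √C)) * (ε * (1 + |Real.log ε|)) * ‖y‖ := by
  have hκ0 : 0 < κ := by linarith
  have hsκ : κ ≤ s := by
    have : 0 ≤ (w * C) ^ 2 / (2 * κ) := by positivity
    rw [coercivityBound] at hs
    linarith
  have hco := coercive_energyOp_sub_formPert hB hκ0 hw hs hQ hW hT
  set P := formPert B Q T W with hP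
  set g := Ring.inverse (energyOp κ B s - P) (B y) with hg
  have hsol : (energyOp κ B s - P) g = B y := by
    simpa using congrArg (fun A : K →L[ℂ] K => A (B y))
      (Ring.mul_inverse_cancel _ (isUnit_of_coercive (by positivity) hco))
  have hg1 : ‖g‖ ≤ 2 * ‖y‖ := by
    have h1 := norm_le_of_coercive (by positivity) hco g
    rw [hsol] at h1
    have h2 : (κ / 2)⁻¹ ≤ 2 := by
      rw [inv_le_comm₀ (by positivity) (by positivity)]
      linarith
    calc ‖g‖ ≤ (κ / 2)⁻¹ * ‖B y‖ := h1
      _ ≤ 2 * ‖y‖ := by gcongr; exact hB1 y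
  have hTg : ‖T g‖ ≤ √C * (2 * ‖y‖) := by
    have h1 : ‖T g‖ ≤ √C * ‖g‖ := by
      refine abs_le_of_sq_le_sq' ?_ (by positivity) |>.2
      rw [mul_pow, Real.sq_sqrt hC, sq ‖g‖]
      exact (hT g).trans (by gcongr; exact hB1 g)
    exact h1.trans (by gcongr)
  refine ⟨hg1, hTg, ?_⟩
  -- The equation `C_s g = B (y - Q B g) + T† W T g`, solved by `E_s`, which commutes with `B`.
  have hrep : g = B (energyInv κ B s (y - Q (B g))) + energyInv κ B s (adjoint T (W (T g))) := by
    have h1 : energyOp κ B s g = B (y - Q (B g)) + adjoint T (W (T g)) := by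
      rw [sub_apply, sub_eq_iff_eq_add] at hsol
      rw [hsol, hP]
      simp only [formPert, sub_apply, comp_apply, mul_apply_eq_comp, map_sub]
      abel
    conv_lhs => rw [← energyInv_energyOp hB hκ0 hsκ g, h1, map_add, energyInv_apply_comm hB hκ0 hsκ]
  set l := ε * (1 + |Real.log ε|) with hl
  have hεl : ε ≤ l := le_mul_of_one_le_right hε.le (by linarith [abs_nonneg (Real.log ε)])
  -- The part in the range of `B` is regular enough for an estimate without logarithm.
  have h1 : ‖D (B (energyInv κ B s (y - Q (B g))))‖ ≤ √C * l * ((1 + 2 * q) * ‖y‖) := by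
    have h2 : ‖D (B (energyInv κ B s (y - Q (B g))))‖ ≤ √C * ε * ‖y - Q (B g)‖ := by
      refine abs_le_of_sq_le_sq' ?_ (by positivity) |>.2
      refine (norm_map_map_energyInv_sq_le hB hB1 hκ0 hsκ hC hDB _).trans ?_
      rw [mul_pow, mul_pow, Real.sq_sqrt hC]
      gcongr
      refine div_le_self (by positivity) ?_
      have : 1 ≤ √(s * κ) := Real.one_le_sqrt.2 (by nlinarith)
      nlinarith
    have h3 : ‖y - Q (B g)‖ ≤ (1 + 2 * q) * ‖y‖ := by
      calc ‖y - Q (B g)‖ ≤ ‖y‖ + ‖Q (B g)‖ := norm_sub_le _ _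
        _ ≤ ‖y‖ + q * ‖B g‖ := by gcongr; exact Q.le_of_opNorm_le hQ _
        _ ≤ ‖y‖ + q * (2 * ‖y‖) := by gcongr; exact (hB1 g).trans hg1
        _ = _ := by ring
    exact h2.trans (by gcongr)
  -- The layer-potential part, with density `W T g`; only here does the logarithm enter.
  have h4 : ‖D (energyInv κ B s (adjoint T (W (T g))))‖ ≤ 7 * C * l * (w * (√C * (2 * ‖y‖))) := by
    refine (norm_map_energyInv_adjoint_le_log hB hB1 hκ hsκ hC hε hε1 hT hD hDB _).trans ?_
    gcongr
    exact (W.le_of_opNorm_le hW _).trans (by gcongr)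
  calc ‖D g‖ ≤ _ := by
        conv_lhs => rw [hrep, map_add]
        exact norm_add_le _ _
    _ ≤ √C * l * ((1 + 2 * q) * ‖y‖) + 7 * C * l * (w * (√C * (2 * ‖y‖))) := add_le_add h1 h4
    _ = _ := by ring

/-- The constant `L` is chosen before `ε` and the operators, so it serves all members of the family.
Both resolvents need the regularity estimate, because `T† W T - T₀† W₀ T₀` has the difference `T -
T₀` once on either side. -/
theorem norm_formResolvent_sub_le (hB : IsSelfAdjoint B) (hB1 : ∀ x, ‖B x‖ ≤ ‖x‖)
    (hκ : 1 ≤ κ) {C w q : ℝ} (hC : 0 ≤ C) (hw : 0 ≤ w) (hq : 0 ≤ q)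
    (hs : coercivityBound κ C w q ≤ s) :
    ∃ L : ℝ, 0 < L ∧ ∀ {ε : ℝ}, 0 < ε → ε ≤ 1 →
      ∀ {Q : K →L[ℂ] K} {T T₀ : K →L[ℂ] M} {W W₀ : M →L[ℂ] M}, IsSelfAdjoint Q → IsSelfAdjoint W →
      ‖Q‖ ≤ q → ‖W‖ ≤ w → ‖W₀‖ ≤ w → ‖W - W₀‖ ≤ w * ε →
      (∀ x, ‖T x‖ ^ 2 ≤ C * (‖B x‖ * ‖x‖)) → (∀ x, ‖T₀ x‖ ^ 2 ≤ C * (‖B x‖ * ‖x‖)) →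
      (∀ x, ‖(T - T₀) x‖ ^ 2 ≤ C * (‖B x‖ * ‖x‖)) →
      (∀ x, ‖(T - T₀) (B x)‖ ^ 2 ≤ C * ε ^ 2 * (‖B x‖ * ‖x‖)) →
      ‖formResolvent κ B s (formPert B Q T W) - formResolvent κ B s (formPert B Q T₀ W₀)‖ ≤
        L * ε * (1 + |Real.log ε|) := by
  have hκ0 : 0 < κ := by linarith
  set c := √C * (1 + 2 * q) + 14 * C * (w * √C) with hc
  have hc0 : 0 ≤ c := by positivity
  refine ⟨4 * w * C + c * w * (√C * 2) + (√C * 2) * w * c + 1, by positivity, ?_⟩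
  intro ε hε hε1 Q T T₀ W W₀ hQs hWs hQ hW hW₀ hWW hT hT₀ hD hDB
  set l := ε * (1 + |Real.log ε|) with hl
  have hεl : ε ≤ l := le_mul_of_one_le_right hε.le (by linarith [abs_nonneg (Real.log ε)])
  have hl0 : 0 < l := hε.trans_le hεl
  set P := formPert B Q T W with hP
  set P₀ := formPert B Q T₀ W₀ with hP₀
  have hu : IsUnit (energyOp κ B s - P) :=
    isUnit_of_coercive (by positivity) (coercive_energyOp_sub_formPert hB hκ0 hw hs hQ hW hT)
  have hu₀ : IsUnit (energyOp κ B s - P₀) :=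
    isUnit_of_coercive (by positivity) (coercive_energyOp_sub_formPert hB hκ0 hw hs hQ hW₀ hT₀)
  -- The second resolvent identity.
  have hdiff : formResolvent κ B s P - formResolvent κ B s P₀ =
      B * Ring.inverse (energyOp κ B s - P) * (P - P₀) * Ring.inverse (energyOp κ B s - P₀) * B := by
    rw [formResolvent, formResolvent, ← sub_mul, ← mul_sub,
      Ring.inverse_sub_inverse (iff_of_true hu hu₀)]
    simp only [mul_assoc, sub_sub_sub_cancel_left]
  have hZs : IsSelfAdjoint (Ring.inverse (energyOp κ B s - P)) :=
    ((isSelfAdjoint_energyOp hB).sub (isSelfAdjoint_formPert hB hQs T hWs)).ringInverse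
  refine ContinuousLinearMap.opNorm_le_bound _ (by positivity) fun x => ?_
  set v := (formResolvent κ B s P - formResolvent κ B s P₀) x with hv
  obtain ⟨hf1, hf2, hf3⟩ := norm_diff_map_inverse_le hB hB1 hκ hC hw hq hs hε hε1 hQ hW₀ hT₀ hD hDB x
  obtain ⟨hg1, hg2, hg3⟩ := norm_diff_map_inverse_le hB hB1 hκ hC hw hq hs hε hε1 hQ hW hT hD hDB v
  rw [← hP₀, ← hc, ← hl] at *
  rw [← hP] at hg1 hg2 hg3
  set f := Ring.inverse (energyOp κ B s - P₀) (B x) with hf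
  set g := Ring.inverse (energyOp κ B s - P) (B v) with hg
  -- Testing with `v` itself and moving the self-adjoint left factor to it replaces the operator
  -- norm by two solutions `f` and `g`. The terms with `Q` cancel, and the rest telescopes, changing
  -- `W`, then the left trace, then the right trace.
  have hvv : inner ℂ v v = inner ℂ (T g) ((W - W₀) (T f)) + inner ℂ ((T - T₀) g) (W₀ (T f))
      + inner ℂ (T₀ g) (W₀ ((T - T₀) f)) := by
    have h1 : inner ℂ v v = inner ℂ g ((P - P₀) f) := by
      have hvx : v = B (Ring.inverse (energyOp κ B s - P) ((P - P₀) f)) := by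
        rw [hv, hdiff]
        rfl
      rw [congrArg (inner ℂ v) hvx, ← inner_map_of_isSelfAdjoint hB,
        ← inner_map_of_isSelfAdjoint hZs]
    rw [h1, sub_apply, inner_sub_right, hP, hP₀, inner_formPert hB, inner_formPert hB]
    simp only [sub_apply, inner_sub_right, inner_sub_left, map_sub]
    ring
  have hTf : ‖T f‖ ≤ √C * (2 * ‖x‖) := by
    have h1 : ‖T f‖ ≤ √C * ‖f‖ := by
      refine abs_le_of_sq_le_sq' ?_ (by positivity) |>.2
      rw [mul_pow, Real.sq_sqrt hC, sq ‖f‖]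
      exact (hT f).trans (by gcongr; exact hB1 f)
    exact h1.trans (by gcongr)
  have hT₀g : ‖T₀ g‖ ≤ √C * (2 * ‖v‖) := by
    have h1 : ‖T₀ g‖ ≤ √C * ‖g‖ := by
      refine abs_le_of_sq_le_sq' ?_ (by positivity) |>.2
      rw [mul_pow, Real.sq_sqrt hC, sq ‖g‖]
      exact (hT₀ g).trans (by gcongr; exact hB1 g)
    exact h1.trans (by gcongr)
  have h1 : ‖inner ℂ (T g) ((W - W₀) (T f))‖ ≤ (√C * (2 * ‖v‖)) * (w * l * (√C * (2 * ‖x‖))) := by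
    refine (norm_inner_le_norm _ _).trans (mul_le_mul hg2 ?_ (norm_nonneg _) (by positivity))
    refine ((W - W₀).le_of_opNorm_le hWW _).trans ?_
    gcongr
  have h2 : ‖inner ℂ ((T - T₀) g) (W₀ (T f))‖ ≤ (c * l * ‖v‖) * (w * (√C * (2 * ‖x‖))) := by
    refine (norm_inner_le_norm _ _).trans (mul_le_mul hg3 ?_ (norm_nonneg _) (by positivity))
    exact (W₀.le_of_opNorm_le hW₀ _).trans (by gcongr)
  have h3 : ‖inner ℂ (T₀ g) (W₀ ((T - T₀) f))‖ ≤ (√C * (2 * ‖v‖)) * (w * (c * l * ‖x‖)) := by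
    refine (norm_inner_le_norm _ _).trans (mul_le_mul hT₀g ?_ (norm_nonneg _) (by positivity))
    exact (W₀.le_of_opNorm_le hW₀ _).trans (by gcongr)
  have h4 : ‖v‖ ^ 2 ≤ (4 * w * C + c * w * (√C * 2) + (√C * 2) * w * c) * l * ‖x‖ * ‖v‖ := by
    have h5 : ‖v‖ ^ 2 = ‖inner ℂ v v‖ := by rw [inner_self_eq_norm_sq_to_K]; simp
    have h6 : √C * √C = C := Real.mul_self_sqrt hC
    rw [h5, hvv]
    refine (norm_add₃_le).trans ((add_le_add_three h1 h2 h3).trans (le_of_eq ?_))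
    linear_combination (4 * w * l * ‖x‖ * ‖v‖) * h6
  have h7 : ‖v‖ ≤ (4 * w * C + c * w * (√C * 2) + (√C * 2) * w * c) * l * ‖x‖ := by
    rcases eq_or_lt_of_le (norm_nonneg v) with h0 | h0
    · rw [← h0]; positivity
    · nlinarith
  refine h7.trans ?_
  rw [mul_assoc _ ε, ← hl]
  exact mul_le_mul_of_nonneg_right (mul_le_mul_of_nonneg_right (by linarith) hl0.le)
    (norm_nonneg _)

end FormPerturbation

/-! ### Multiplication operators on `L²` -/

section LpMul

variable {X : Type*} [MeasurableSpace X] {μ : Measure X}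

/-- Multiplication by a bounded function on `L²(μ)`. -/
noncomputable def lpMul {w : X → ℂ} (hw : MemLp w ∞ μ) : Lp ℂ 2 μ →L[ℂ] Lp ℂ 2 μ :=
  (ContinuousLinearMap.mul ℂ ℂ).holderL μ ∞ 2 2 (hw.toLp w)

theorem coeFn_lpMul {w : X → ℂ} (hw : MemLp w ∞ μ) (f : Lp ℂ 2 μ) :
    lpMul hw f =ᵐ[μ] fun x => w x * f x := by
  have h1 := ContinuousLinearMap.coeFn_holder (r := 2) (ContinuousLinearMap.mul ℂ ℂ) (hw.toLp w) f
  filter_upwards [h1, hw.coeFn_toLp] with x hx hx'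
  change ((ContinuousLinearMap.mul ℂ ℂ).holder 2 (hw.toLp w) f) x = _
  rw [hx, hx', ContinuousLinearMap.mul_apply']

theorem norm_lpMul_apply_le {w : X → ℂ} (hw : MemLp w ∞ μ) {c : ℝ} (hc : ∀ᵐ x ∂μ, ‖w x‖ ≤ c)
    (f : Lp ℂ 2 μ) : ‖lpMul hw f‖ ≤ c * ‖f‖ := by
  refine Lp.norm_le_mul_norm_of_ae_le_mul ?_
  filter_upwards [coeFn_lpMul hw f, hc] with x hx hcx
  rw [hx, norm_mul]
  gcongr

theorem norm_lpMul_le {w : X → ℂ} (hw : MemLp w ∞ μ) {c : ℝ} (hc0 : 0 ≤ c)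
    (hc : ∀ᵐ x ∂μ, ‖w x‖ ≤ c) : ‖lpMul hw‖ ≤ c :=
  ContinuousLinearMap.opNorm_le_bound _ hc0 (norm_lpMul_apply_le hw hc)

theorem inner_lpMul {w : X → ℂ} (hw : MemLp w ∞ μ) (f g : Lp ℂ 2 μ) :
    inner ℂ g (lpMul hw f) = ∫ x, w x * f x * (starRingEnd ℂ) (g x) ∂μ := by
  rw [L2.inner_def]
  refine integral_congr_ae ?_
  filter_upwards [coeFn_lpMul hw f] with x hx
  rw [hx]
  simp

theorem isSelfAdjoint_lpMul {w : X → ℝ} (hw : MemLp (fun x => (w x : ℂ)) ∞ μ) :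
    IsSelfAdjoint (lpMul hw) := by
  rw [ContinuousLinearMap.isSelfAdjoint_iff_isSymmetric]
  intro f g
  change inner ℂ (lpMul hw f) g = inner ℂ f (lpMul hw g)
  rw [inner_lpMul, ← inner_conj_symm, inner_lpMul, ← integral_conj]
  refine integral_congr_ae (ae_of_all _ fun x => ?_)
  simp
  ring

theorem integrable_lpMul {w : X → ℂ} (hw : MemLp w ∞ μ) (f g : Lp ℂ 2 μ) :
    Integrable (fun x => w x * f x * (starRingEnd ℂ) (g x)) μ := by
  refine (L2.integrable_inner (𝕜 := ℂ) g (lpMul hw f)).congr ?_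
  filter_upwards [coeFn_lpMul hw f] with x hx
  rw [hx]
  simp

end LpMul

/-! ### Bessel potentials on `L²(ℝᵈ)` -/

section Bessel

open FourierTransform Real

variable {d : ℕ}

theorem coe_dist_injective {f g : L2Sp d} (h : (f : 𝓢'(EucSp d, ℂ)) = g) : f = g := by
  have hk := Lp.ker_toTemperedDistributionCLM_eq_bot (E := EucSp d) (F := ℂ) (p := 2)
    (μ := (volume : Measure (EucSp d)))
  exact LinearMap.ker_eq_bot.1 hk h

/-- The Fourier multiplier on `L²(ℝᵈ)` with a bounded symbol. -/
noncomputable def fourierMul {m : EucSp d → ℂ} (hm : MemLp m ∞ volume) : L2Sp d →L[ℂ] L2Sp d :=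
  (Lp.fourierTransformₗᵢ (EucSp d) ℂ).symm.toContinuousLinearEquiv.toContinuousLinearMap ∘L
    lpMul hm ∘L (Lp.fourierTransformₗᵢ (EucSp d) ℂ).toContinuousLinearEquiv.toContinuousLinearMap

theorem fourierMul_apply {m : EucSp d → ℂ} (hm : MemLp m ∞ volume) (f : L2Sp d) :
    fourierMul hm f = 𝓕⁻ (lpMul hm (𝓕 f)) := rfl

theorem fourier_fourierMul {m : EucSp d → ℂ} (hm : MemLp m ∞ volume) (f : L2Sp d) :
    𝓕 (fourierMul hm f) = lpMul hm (𝓕 f) := by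
  rw [fourierMul_apply, fourier_fourierInv_eq]

theorem coe_lpMul_dist {m : EucSp d → ℂ} (hm : MemLp m ∞ volume) (ht : m.HasTemperateGrowth)
    (f : L2Sp d) : (lpMul hm f : 𝓢'(EucSp d, ℂ)) = smulLeftCLM ℂ m (f : 𝓢'(EucSp d, ℂ)) := by
  rw [← Lp.toTemperedDistribution_smul_eq (r := 2) ht hm]
  congr 1

theorem coe_fourierMul_dist {m : EucSp d → ℂ} (hm : MemLp m ∞ volume) (ht : m.HasTemperateGrowth)
    (f : L2Sp d) : (fourierMul hm f : 𝓢'(EucSp d, ℂ)) =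
      TemperedDistribution.fourierMultiplierCLM ℂ m (f : 𝓢'(EucSp d, ℂ)) := by
  rw [fourierMul_apply, ← Lp.fourierInv_toTemperedDistribution_eq, coe_lpMul_dist hm ht,
    ← Lp.fourier_toTemperedDistribution_eq, TemperedDistribution.fourierMultiplierCLM_apply]

theorem norm_fourierMul_apply_le {m : EucSp d → ℂ} (hm : MemLp m ∞ volume) {c : ℝ}
    (hc : ∀ x, ‖m x‖ ≤ c) (f : L2Sp d) : ‖fourierMul hm f‖ ≤ c * ‖f‖ := by
  rw [← Lp.norm_fourier_eq, fourier_fourierMul, ← Lp.norm_fourier_eq f]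
  exact norm_lpMul_apply_le hm (ae_of_all _ hc) _

/-- The symbol `(1 + |ξ|²)^{-1/2}`. -/
noncomputable def besselSymbol (ξ : EucSp d) : ℝ := (1 + ‖ξ‖ ^ 2) ^ ((-1 : ℝ) / 2)

theorem besselSymbol_pos (ξ : EucSp d) : 0 < besselSymbol ξ := by
  unfold besselSymbol; positivity

theorem besselSymbol_le_one (ξ : EucSp d) : besselSymbol ξ ≤ 1 :=
  Real.rpow_le_one_of_one_le_of_nonpos (by simp) (by norm_num)

theorem besselSymbol_sq (ξ : EucSp d) : besselSymbol ξ ^ 2 = (1 + ‖ξ‖ ^ 2)⁻¹ := by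
  rw [besselSymbol, ← Real.rpow_natCast, ← Real.rpow_mul (by positivity),
    ← Real.rpow_neg_one]
  norm_num

theorem hasTemperateGrowth_besselSymbol :
    (fun ξ : EucSp d => (besselSymbol ξ : ℂ)).HasTemperateGrowth := by
  unfold besselSymbol; fun_prop

theorem memLp_top_of_bounded_temperate {m : EucSp d → ℂ} (ht : m.HasTemperateGrowth) {c : ℝ}
    (hc : ∀ x, ‖m x‖ ≤ c) : MemLp m ∞ volume :=
  memLp_top_of_bound ht.1.continuous.aestronglyMeasurable c (ae_of_all _ hc)

theorem memLp_besselSymbol : MemLp (fun ξ : EucSp d => (besselSymbol ξ : ℂ)) ∞ volume :=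
  memLp_top_of_bounded_temperate hasTemperateGrowth_besselSymbol (c := 1) fun ξ => by
    rw [Complex.norm_real, Real.norm_of_nonneg (besselSymbol_pos ξ).le]
    exact besselSymbol_le_one ξ

variable (d) in
/-- The operator `B = (1 - (2π)⁻² Δ)^{-1/2}` on `L²(ℝᵈ)`. -/
noncomputable def besselOp : L2Sp d →L[ℂ] L2Sp d := fourierMul memLp_besselSymbol

theorem coe_besselOp (f : L2Sp d) : (besselOp d f : 𝓢'(EucSp d, ℂ)) =
    besselPotential (EucSp d) ℂ (-1) (f : 𝓢'(EucSp d, ℂ)) :=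
  coe_fourierMul_dist memLp_besselSymbol hasTemperateGrowth_besselSymbol f

theorem norm_besselOp_apply_le (f : L2Sp d) : ‖besselOp d f‖ ≤ ‖f‖ := by
  have h := norm_fourierMul_apply_le memLp_besselSymbol (c := 1) (fun ξ => by
    rw [Complex.norm_real, Real.norm_of_nonneg (besselSymbol_pos ξ).le]
    exact besselSymbol_le_one ξ) f
  rwa [one_mul] at h

theorem isSelfAdjoint_besselOp : IsSelfAdjoint (besselOp d) := by
  rw [ContinuousLinearMap.isSelfAdjoint_iff_isSymmetric]
  intro f g
  change inner ℂ (besselOp d f) g = inner ℂ f (besselOp d g)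
  rw [← Lp.inner_fourier_eq, ← Lp.inner_fourier_eq f, besselOp, fourier_fourierMul,
    fourier_fourierMul]
  exact inner_map_of_isSelfAdjoint (isSelfAdjoint_lpMul memLp_besselSymbol) _ _

theorem besselOp_eq_iff {f x : L2Sp d} : besselOp d x = f ↔
    besselPotential (EucSp d) ℂ 1 (f : 𝓢'(EucSp d, ℂ)) = x := by
  rw [← besselPotential_neg_apply_eq_iff, ← coe_besselOp]
  exact ⟨fun h => by rw [h], coe_dist_injective⟩

theorem besselOp_injective : Function.Injective (besselOp d) := fun x y h => by
  have h1 := besselOp_eq_iff.1 h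
  rw [besselOp_eq_iff.1 rfl] at h1
  exact (coe_dist_injective h1).symm

theorem memSobolev_one_iff {f : L2Sp d} :
    MemSobolev 1 2 (f : 𝓢'(EucSp d, ℂ)) ↔ ∃ x, besselOp d x = f := by
  simp only [MemSobolev, besselOp_eq_iff]

theorem memSobolev_two_iff {f : L2Sp d} :
    MemSobolev 2 2 (f : 𝓢'(EucSp d, ℂ)) ↔ ∃ x, besselOp d (besselOp d x) = f := by
  have key : ∀ x : L2Sp d, besselPotential (EucSp d) ℂ 2 (f : 𝓢'(EucSp d, ℂ)) = x ↔
      besselOp d (besselOp d x) = f := by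
    intro x
    rw [← besselPotential_neg_apply_eq_iff]
    have h : besselPotential (EucSp d) ℂ (-2) (x : 𝓢'(EucSp d, ℂ)) =
        besselOp d (besselOp d x) := by
      rw [coe_besselOp, coe_besselOp, besselPotential_besselPotential_apply]
      norm_num
    rw [h]
    exact ⟨coe_dist_injective, fun h => by rw [h]⟩
  simp only [MemSobolev, key]

/-- The symbol `2πi ξⱼ (1 + |ξ|²)^{-1/2}`. -/
noncomputable def derivSymbol (j : Fin d) (ξ : EucSp d) : ℂ :=
  (2 * π * Complex.I) * ((ξ j * besselSymbol ξ : ℝ) : ℂ)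

theorem hasTemperateGrowth_coord (j : Fin d) :
    (fun ξ : EucSp d => (ξ j : ℝ)).HasTemperateGrowth := by
  have h : (fun ξ : EucSp d => (ξ j : ℝ)) =
      fun ξ => inner ℝ ξ (EuclideanSpace.single j 1 : EucSp d) := by
    ext ξ; simp [EuclideanSpace.inner_single_right]
  rw [h]; fun_prop

theorem hasTemperateGrowth_derivSymbol (j : Fin d) :
    (derivSymbol j).HasTemperateGrowth := by
  unfold derivSymbol besselSymbol
  have := hasTemperateGrowth_coord j
  fun_prop

theorem norm_derivSymbol_le (j : Fin d) (ξ : EucSp d) : ‖derivSymbol j ξ‖ ≤ 2 * π := by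
  have h1 : |ξ j| * besselSymbol ξ ≤ 1 := by
    refine abs_le_of_sq_le_sq' ?_ zero_le_one |>.2
    rw [mul_pow, besselSymbol_sq, sq_abs, one_pow, mul_inv_le_iff₀ (by positivity)]
    have h2 : ‖ξ j‖ ≤ ‖ξ‖ := PiLp.norm_apply_le ξ j
    have h3 : ‖ξ j‖ ^ 2 ≤ ‖ξ‖ ^ 2 := by gcongr
    rw [Real.norm_eq_abs, sq_abs] at h3
    linarith
  rw [derivSymbol, norm_mul, Complex.norm_real, Real.norm_eq_abs, abs_mul,
    abs_of_pos (besselSymbol_pos ξ)]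
  have h4 : ‖(2 * π * Complex.I : ℂ)‖ = 2 * π := by simp [abs_of_pos pi_pos]
  rw [h4]
  exact mul_le_of_le_one_right (by positivity) h1

theorem memLp_derivSymbol (j : Fin d) : MemLp (derivSymbol j) ∞ volume :=
  memLp_top_of_bounded_temperate (hasTemperateGrowth_derivSymbol j) (norm_derivSymbol_le j)

/-- The operator `∂ⱼ B` on `L²(ℝᵈ)`. -/
noncomputable def derivOp (j : Fin d) : L2Sp d →L[ℂ] L2Sp d := fourierMul (memLp_derivSymbol j)

theorem norm_derivOp_apply_le (j : Fin d) (f : L2Sp d) : ‖derivOp j f‖ ≤ 2 * π * ‖f‖ :=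
  norm_fourierMul_apply_le _ (norm_derivSymbol_le j) f

theorem isWeakGradient_besselOp (x : L2Sp d) :
    IsWeakGradient (besselOp d x) fun j => derivOp j x := by
  intro j
  beta_reduce
  rw [derivOp, coe_fourierMul_dist _ (hasTemperateGrowth_derivSymbol j), besselOp,
    coe_fourierMul_dist _ hasTemperateGrowth_besselSymbol,
    TemperedDistribution.lineDeriv_eq_fourierMultiplierCLM,
    TemperedDistribution.fourierMultiplierCLM_fourierMultiplierCLM_apply
      hasTemperateGrowth_besselSymbol (by fun_prop)]
  have h := TemperedDistribution.fourierMultiplierCLM_smul (F := ℂ) (E := EucSp d)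
    (g := (fun ξ => (besselSymbol ξ : ℂ)) * fun ξ => ((inner ℝ ξ
      (EuclideanSpace.single j 1 : EucSp d) : ℝ) : ℂ))
    (hasTemperateGrowth_besselSymbol.mul (by fun_prop)) (2 * π * Complex.I)
  rw [← smul_apply, ← h]
  congr 2
  ext ξ
  simp [derivSymbol, EuclideanSpace.inner_single_right]
  ring

theorem IsWeakGradient.unique {f : L2Sp d} {G K : Fin d → L2Sp d} (hG : IsWeakGradient f G)
    (hK : IsWeakGradient f K) : G = K :=
  funext fun j => coe_dist_injective ((hG j).symm.trans (hK j))

/-- The identity `4π² |ξ|² / (1 + |ξ|²) = 4π² (1 - 1 / (1 + |ξ|²))`; with the Fourier transform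
normalized by `e^{-2πi x·ξ}`, this is the origin of `κ = (2π)²`. -/
theorem sum_normSq_derivSymbol (ξ : EucSp d) :
    ∑ j, (starRingEnd ℂ) (derivSymbol j ξ) * derivSymbol j ξ =
      ((2 * π) ^ 2 : ℝ) * (1 - (besselSymbol ξ : ℂ) * besselSymbol ξ) := by
  have h1 : ∀ j, (starRingEnd ℂ) (derivSymbol j ξ) * derivSymbol j ξ =
      (((2 * π) ^ 2 * besselSymbol ξ ^ 2 * (ξ j) ^ 2 : ℝ) : ℂ) := by
    intro j
    rw [Complex.conj_mul', derivSymbol, norm_mul, Complex.norm_real, Real.norm_eq_abs]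
    have h4 : ‖(2 * π * Complex.I : ℂ)‖ = 2 * π := by simp [abs_of_pos pi_pos]
    rw [h4, ← Complex.ofReal_pow]
    congr 1
    rw [mul_pow, sq_abs]
    ring
  simp only [h1]
  rw [← Complex.ofReal_sum, ← Finset.mul_sum]
  have h2 : ∑ j, (ξ j) ^ 2 = ‖ξ‖ ^ 2 := by
    rw [EuclideanSpace.norm_sq_eq]; simp
  rw [h2, ← Complex.ofReal_mul, ← sq, ← Complex.ofReal_one, ← Complex.ofReal_sub,
    ← Complex.ofReal_mul, besselSymbol_sq]
  congr 1
  field_simp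
  ring

/-- Plancherel's theorem turns the Dirichlet form of `B x` and `B y` into the form of `κ (1 - B²)`.
-/
theorem sum_inner_derivOp (x y : L2Sp d) : ∑ j, inner ℂ (derivOp j y) (derivOp j x) =
    ((2 * π) ^ 2 : ℝ) * (inner ℂ y x - inner ℂ (besselOp d y) (besselOp d x)) := by
  have hint : ∀ {m m' : EucSp d → ℂ} (hm : MemLp m ∞ volume) (hm' : MemLp m' ∞ volume),
      inner ℂ (fourierMul hm y) (fourierMul hm' x) =
        ∫ ξ, (starRingEnd ℂ) (m ξ) * m' ξ * ((𝓕 x : L2Sp d) ξ *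
          (starRingEnd ℂ) ((𝓕 y : L2Sp d) ξ)) ∧
      Integrable fun ξ => (starRingEnd ℂ) (m ξ) * m' ξ * ((𝓕 x : L2Sp d) ξ *
          (starRingEnd ℂ) ((𝓕 y : L2Sp d) ξ)) := by
    intro m m' hm hm'
    have hae : (fun ξ => m' ξ * (𝓕 x : L2Sp d) ξ * (starRingEnd ℂ) (lpMul hm (𝓕 y) ξ)) =ᵐ[volume]
        fun ξ => (starRingEnd ℂ) (m ξ) * m' ξ * ((𝓕 x : L2Sp d) ξ *
          (starRingEnd ℂ) ((𝓕 y : L2Sp d) ξ)) := by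
      filter_upwards [coeFn_lpMul hm (𝓕 y)] with ξ hξ
      rw [hξ, map_mul]
      ring
    rw [← Lp.inner_fourier_eq, fourier_fourierMul, fourier_fourierMul, inner_lpMul]
    exact ⟨integral_congr_ae hae, (integrable_lpMul hm' _ _).congr hae⟩
  have h1 : MemLp (fun _ : EucSp d => (1 : ℂ)) ∞ volume := memLp_top_const 1
  have hid : ∀ z : L2Sp d, fourierMul h1 z = z := by
    intro z
    have : lpMul h1 (𝓕 z) = 𝓕 z := by
      refine Lp.ext ?_
      filter_upwards [coeFn_lpMul h1 (𝓕 z)] with ξ hξ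
      rw [hξ, one_mul]
    rw [fourierMul_apply, this, fourierInv_fourier_eq]
  have hyx := hint h1 h1
  rw [hid, hid] at hyx
  simp only [derivOp, besselOp]
  rw [Finset.sum_congr rfl fun j _ => (hint (memLp_derivSymbol j) (memLp_derivSymbol j)).1,
    hyx.1, (hint memLp_besselSymbol memLp_besselSymbol).1,
    ← integral_finsetSum _ fun j _ => (hint (memLp_derivSymbol j) (memLp_derivSymbol j)).2,
    ← integral_sub hyx.2 (hint memLp_besselSymbol memLp_besselSymbol).2, ← integral_const_mul]
  refine integral_congr_ae (ae_of_all _ fun ξ => ?_)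
  simp only [← Finset.sum_mul, sum_normSq_derivSymbol]
  simp
  ring

theorem neg_laplacian_besselOp (x : L2Sp d) :
    -Δ (besselOp d (besselOp d x) : 𝓢'(EucSp d, ℂ)) =
      ((((2 * π) ^ 2 : ℝ) : ℂ) • (x - besselOp d (besselOp d x)) : L2Sp d) := by
  have hb := hasTemperateGrowth_besselSymbol (d := d)
  have hx : (x : 𝓢'(EucSp d, ℂ)) = TemperedDistribution.fourierMultiplierCLM ℂ
      (fun _ => (1 : ℂ)) (x : 𝓢'(EucSp d, ℂ)) := by simp
  have hsub : ((x - besselOp d (besselOp d x) : L2Sp d) : 𝓢'(EucSp d, ℂ)) =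
      (x : 𝓢'(EucSp d, ℂ)) - (besselOp d (besselOp d x) : 𝓢'(EucSp d, ℂ)) :=
    map_sub (Lp.toTemperedDistributionCLM ℂ (volume : Measure (EucSp d)) 2) _ _
  have hBB : (besselOp d (besselOp d x) : 𝓢'(EucSp d, ℂ)) =
      TemperedDistribution.fourierMultiplierCLM ℂ
        ((fun ξ => (besselSymbol ξ : ℂ)) * fun ξ => (besselSymbol ξ : ℂ)) (x : 𝓢'(EucSp d, ℂ)) := by
    rw [besselOp, coe_fourierMul_dist _ hb, coe_fourierMul_dist _ hb,
      TemperedDistribution.fourierMultiplierCLM_fourierMultiplierCLM_apply hb hb]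
  rw [coe_dist_smul, hsub, TemperedDistribution.laplacian_eq_fourierMultiplierCLM, hBB,
    TemperedDistribution.fourierMultiplierCLM_fourierMultiplierCLM_apply (hb.mul hb) (by fun_prop)]
  -- With `b` the Bessel symbol, `1 = b² |ξ|² + b²`.
  have hadd : (x : 𝓢'(EucSp d, ℂ)) = TemperedDistribution.fourierMultiplierCLM ℂ
        ((fun ξ => (besselSymbol ξ : ℂ)) * (fun ξ => (besselSymbol ξ : ℂ)) *
          fun ξ => ((‖ξ‖ ^ 2 : ℝ) : ℂ)) (x : 𝓢'(EucSp d, ℂ)) +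
      TemperedDistribution.fourierMultiplierCLM ℂ
        ((fun ξ => (besselSymbol ξ : ℂ)) * fun ξ => (besselSymbol ξ : ℂ)) (x : 𝓢'(EucSp d, ℂ)) := by
    have h1 : ∀ m : EucSp d → ℂ, TemperedDistribution.fourierMultiplierCLM ℂ m
        (x : 𝓢'(EucSp d, ℂ)) = 𝓕⁻ (smulLeftCLM ℂ m (𝓕 (x : 𝓢'(EucSp d, ℂ)))) := fun m => rfl
    rw [h1, h1, ← FourierTransform.fourierInv_add, ← add_apply,
      ← smulLeftCLM_add ((hb.mul hb).mul (by fun_prop)) (hb.mul hb)]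
    rw [← h1]
    conv_lhs => rw [hx]
    congr 2
    ext ξ
    simp only [Pi.add_apply, Pi.mul_apply]
    rw [← Complex.ofReal_mul, ← Complex.ofReal_mul, ← Complex.ofReal_add, ← sq, besselSymbol_sq,
      ← Complex.ofReal_one]
    congr 1
    field_simp
    ring
  nth_rewrite 2 [hadd]
  rw [add_sub_cancel_right, Complex.coe_smul, neg_smul, neg_neg]

/-- The Bessel potential on Schwartz functions. -/
noncomputable def besselSchwartz : 𝓢(EucSp d, ℂ) →L[ℂ] 𝓢(EucSp d, ℂ) :=
  SchwartzMap.fourierMultiplierCLM ℂ fun ξ => (besselSymbol ξ : ℂ)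

theorem besselOp_toLp (ψ : 𝓢(EucSp d, ℂ)) :
    besselOp d (ψ.toLp 2 volume) = (besselSchwartz ψ).toLp 2 volume := by
  apply coe_dist_injective
  rw [besselOp, coe_fourierMul_dist _ hasTemperateGrowth_besselSymbol,
    Lp.toTemperedDistribution_toLp_eq, Lp.toTemperedDistribution_toLp_eq,
    fourierMultiplierCLM_toTemperedDistributionCLM_eq hasTemperateGrowth_besselSymbol]
  rfl

/-- The symbol `(1 + |ξ|²)^{1/2}` has temperate growth too, so its multiplier inverts `B` on
Schwartz functions. Hence Schwartz approximations in `H¹` are exactly the images under `B` of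
Schwartz approximations in `L²`. -/
theorem besselSchwartz_surjective : Function.Surjective (besselSchwartz (d := d)) := by
  intro φ
  have ht : (fun ξ : EucSp d => (((1 + ‖ξ‖ ^ 2) ^ ((1 : ℝ) / 2) : ℝ) : ℂ)).HasTemperateGrowth := by
    fun_prop
  refine ⟨SchwartzMap.fourierMultiplierCLM ℂ
    (fun ξ : EucSp d => (((1 + ‖ξ‖ ^ 2) ^ ((1 : ℝ) / 2) : ℝ) : ℂ)) φ, ?_⟩
  rw [besselSchwartz, SchwartzMap.fourierMultiplierCLM_fourierMultiplierCLM_apply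
    hasTemperateGrowth_besselSymbol ht]
  have h1 : ((fun ξ : EucSp d => (besselSymbol ξ : ℂ)) *
      fun ξ : EucSp d => (((1 + ‖ξ‖ ^ 2) ^ ((1 : ℝ) / 2) : ℝ) : ℂ)) = fun _ => (1 : ℂ) := by
    ext ξ
    rw [Pi.mul_apply, besselSymbol, ← Complex.ofReal_mul, ← Real.rpow_add (by positivity)]
    norm_num
  rw [h1, SchwartzMap.fourierMultiplierCLM_const]
  simp

theorem derivOp_toLp (j : Fin d) (ψ : 𝓢(EucSp d, ℂ)) : derivOp j (ψ.toLp 2 volume) =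
    (∂_{(EuclideanSpace.single j 1 : EucSp d)} (besselSchwartz ψ)).toLp 2 volume := by
  apply coe_dist_injective
  have h := isWeakGradient_besselOp (ψ.toLp 2 volume) j
  rw [← h, besselOp_toLp, Lp.toTemperedDistribution_toLp_eq, Lp.toTemperedDistribution_toLp_eq,
    lineDerivOp_toTemperedDistributionCLM_eq]

theorem denseRange_schwartz_toLp :
    DenseRange fun ψ : 𝓢(EucSp d, ℂ) => ψ.toLp 2 (volume : Measure (EucSp d)) :=
  SchwartzMap.denseRange_toLpCLM ENNReal.ofNat_ne_top

theorem besselSchwartz_lineDeriv (m : EucSp d) (ψ : 𝓢(EucSp d, ℂ)) :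
    ∂_{m} (besselSchwartz ψ) = besselSchwartz (∂_{m} ψ) := by
  have ht : (fun ξ : EucSp d => ((inner ℝ ξ m : ℝ) : ℂ)).HasTemperateGrowth := by fun_prop
  have hr : ∀ f : 𝓢(EucSp d, ℂ), SchwartzMap.fourierMultiplierCLM ℂ (fun ξ => inner ℝ ξ m) f =
      SchwartzMap.fourierMultiplierCLM ℂ (fun ξ : EucSp d => ((inner ℝ ξ m : ℝ) : ℂ)) f := fun f =>
    (SchwartzMap.fourierMultiplierCLM_ofReal ℂ (g := fun ξ => inner ℝ ξ m) (by fun_prop) f).symm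
  rw [SchwartzMap.lineDeriv_eq_fourierMultiplierCLM, SchwartzMap.lineDeriv_eq_fourierMultiplierCLM,
    map_smul, hr, hr, besselSchwartz,
    SchwartzMap.fourierMultiplierCLM_fourierMultiplierCLM_apply ht hasTemperateGrowth_besselSymbol,
    SchwartzMap.fourierMultiplierCLM_fourierMultiplierCLM_apply hasTemperateGrowth_besselSymbol ht,
    mul_comm (fun ξ : EucSp d => (besselSymbol ξ : ℂ))]

end Bessel

/-! ### Trace operators -/

section TraceOp

variable {d : ℕ} {X : Type*} [MeasurableSpace X]

/-- The partial derivative of a Schwartz function in the direction of a coordinate. -/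
noncomputable def partialS (j : Fin d) (φ : 𝓢(EucSp d, ℂ)) : 𝓢(EucSp d, ℂ) :=
  ∂_{(EuclideanSpace.single j 1 : EucSp d)} φ

/-- The size `‖φ‖ (‖φ‖ + ∑ⱼ ‖∂ⱼφ‖)`, with norms in `L²(ℝᵈ)`, which bounds traces. -/
noncomputable def traceSize (φ : 𝓢(EucSp d, ℂ)) : ℝ :=
  ‖φ.toLp 2 (volume : Measure (EucSp d))‖ * (‖φ.toLp 2 (volume : Measure (EucSp d))‖ +
    ∑ j, ‖(partialS j φ).toLp 2 (volume : Measure (EucSp d))‖)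

/-- Composition with `g` satisfies a trace inequality on Schwartz functions. -/
structure IsTraceMap (μ : Measure X) (g : X → EucSp d) (C : ℝ) : Prop where
  measurable : Measurable g
  nonneg : 0 ≤ C
  bound : ∀ φ : 𝓢(EucSp d, ℂ), ∫⁻ x, ‖φ (g x)‖ₑ ^ 2 ∂μ ≤ ENNReal.ofReal (C * traceSize φ)

variable {μ : Measure X} {g : X → EucSp d} {C : ℝ}

/-- Each `∂ⱼ B` is bounded by `2π`, which converts `‖f‖ ‖f‖_{H¹}` for `f = B ψ` into the product `‖B
ψ‖ ‖ψ‖` of the abstract estimates. -/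
theorem traceSize_besselSchwartz_le (ψ : 𝓢(EucSp d, ℂ)) : traceSize (besselSchwartz ψ) ≤
    (1 + 2 * Real.pi * d) * (‖besselOp d (ψ.toLp 2 volume)‖ * ‖ψ.toLp 2 volume‖) := by
  rw [traceSize, ← besselOp_toLp]
  have h1 : ∑ j, ‖(partialS j (besselSchwartz ψ)).toLp 2 (volume : Measure (EucSp d))‖ ≤
      2 * Real.pi * d * ‖ψ.toLp 2 (volume : Measure (EucSp d))‖ := by
    calc _ ≤ ∑ j : Fin d, 2 * Real.pi * ‖ψ.toLp 2 (volume : Measure (EucSp d))‖ := by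
          refine Finset.sum_le_sum fun j _ => ?_
          rw [partialS, ← derivOp_toLp]
          exact norm_derivOp_apply_le j _
      _ = _ := by simp; ring
  have h2 := norm_besselOp_apply_le (ψ.toLp 2 (volume : Measure (EucSp d)))
  have h3 := norm_nonneg (besselOp d (ψ.toLp 2 volume))
  nlinarith

theorem IsTraceMap.memLp (h : IsTraceMap μ g C) (φ : 𝓢(EucSp d, ℂ)) :
    MemLp (fun x => φ (g x)) 2 μ := by
  refine ⟨(φ.continuous.measurable.comp h.measurable).aestronglyMeasurable, ?_⟩
  rw [eLpNorm_lt_top_iff_lintegral_rpow_enorm_lt_top (by norm_num) (by norm_num)]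
  simpa using (h.bound φ).trans_lt ENNReal.ofReal_lt_top

theorem norm_toLp_sq {f : X → ℂ} (hf : MemLp f 2 μ) :
    ENNReal.ofReal (‖hf.toLp f‖ ^ 2) = ∫⁻ x, ‖f x‖ₑ ^ 2 ∂μ := by
  rw [Lp.norm_toLp, ENNReal.ofReal_pow ENNReal.toReal_nonneg, ENNReal.ofReal_toReal hf.2.ne,
    eLpNorm_eq_lintegral_rpow_enorm_toReal (by norm_num) (by norm_num), ← ENNReal.rpow_natCast,
    ← ENNReal.rpow_mul]
  simp

/-- Composition with `g` after the Bessel potential, on Schwartz functions. -/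
noncomputable def traceLin (h : IsTraceMap μ g C) : 𝓢(EucSp d, ℂ) →ₗ[ℂ] Lp ℂ 2 μ where
  toFun ψ := (h.memLp (besselSchwartz ψ)).toLp _
  map_add' ψ χ := by
    rw [← MemLp.toLp_add]
    exact MemLp.toLp_congr _ _ (ae_of_all _ fun x => by simp [map_add])
  map_smul' c ψ := by
    rw [RingHom.id_apply, ← MemLp.toLp_const_smul]
    exact MemLp.toLp_congr _ _ (ae_of_all _ fun x => by simp [map_smul])

theorem norm_traceLin_sq_le (h : IsTraceMap μ g C) (ψ : 𝓢(EucSp d, ℂ)) :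
    ‖traceLin h ψ‖ ^ 2 ≤ C * (1 + 2 * Real.pi * d) *
      (‖besselOp d (ψ.toLp 2 volume)‖ * ‖ψ.toLp 2 volume‖) := by
  have h1 : ENNReal.ofReal (‖traceLin h ψ‖ ^ 2) ≤
      ENNReal.ofReal (C * traceSize (besselSchwartz ψ)) :=
    (norm_toLp_sq (h.memLp (besselSchwartz ψ))).trans_le (h.bound _)
  have h0 : 0 ≤ traceSize (besselSchwartz ψ) := by unfold traceSize; positivity
  rw [ENNReal.ofReal_le_ofReal_iff (mul_nonneg h.nonneg h0)] at h1
  refine h1.trans ?_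
  rw [mul_assoc]
  exact mul_le_mul_of_nonneg_left (traceSize_besselSchwartz_le ψ) h.nonneg

theorem norm_traceLin_le (h : IsTraceMap μ g C) (ψ : 𝓢(EucSp d, ℂ)) :
    ‖traceLin h ψ‖ ≤ √(C * (1 + 2 * Real.pi * d)) *
      ‖(SchwartzMap.toLpCLM ℂ ℂ 2 (volume : Measure (EucSp d))).toLinearMap ψ‖ := by
  have h0 : 0 ≤ C * (1 + 2 * Real.pi * d) := mul_nonneg h.nonneg (by positivity)
  refine abs_le_of_sq_le_sq' ?_ (by positivity) |>.2
  rw [mul_pow, Real.sq_sqrt h0, sq ‖(SchwartzMap.toLpCLM ℂ ℂ 2 volume).toLinearMap ψ‖]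
  refine (norm_traceLin_sq_le h ψ).trans (mul_le_mul_of_nonneg_left ?_ h0)
  exact mul_le_mul_of_nonneg_right (norm_besselOp_apply_le _) (norm_nonneg _)

/-- The trace operator `x ↦ (B x) ∘ g`. -/
noncomputable def traceOp (h : IsTraceMap μ g C) : L2Sp d →L[ℂ] Lp ℂ 2 μ :=
  (traceLin h).extendOfNorm (SchwartzMap.toLpCLM ℂ ℂ 2 (volume : Measure (EucSp d))).toLinearMap

theorem traceOp_toLp (h : IsTraceMap μ g C) (ψ : 𝓢(EucSp d, ℂ)) :
    traceOp h (ψ.toLp 2 volume) = (h.memLp (besselSchwartz ψ)).toLp _ :=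
  LinearMap.extendOfNorm_eq denseRange_schwartz_toLp ⟨_, norm_traceLin_le h⟩ ψ

theorem norm_traceOp_sq_le (h : IsTraceMap μ g C) (x : L2Sp d) :
    ‖traceOp h x‖ ^ 2 ≤ C * (1 + 2 * Real.pi * d) * (‖besselOp d x‖ * ‖x‖) := by
  refine denseRange_schwartz_toLp.induction_on (p := fun x => ‖traceOp h x‖ ^ 2 ≤
    C * (1 + 2 * Real.pi * d) * (‖besselOp d x‖ * ‖x‖)) x ?_ fun ψ => ?_
  · exact isClosed_le (by fun_prop) (by fun_prop)
  · rw [traceOp_toLp]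
    exact norm_traceLin_sq_le h ψ

/-- Two sesquilinear expressions agree on `H¹` if they agree on Schwartz functions. -/
theorem schwartz_induction₂ {F G : L2Sp d → L2Sp d → ℂ}
    (hF : Continuous (Function.uncurry F)) (hG : Continuous (Function.uncurry G))
    (h : ∀ ψ χ : 𝓢(EucSp d, ℂ), F (ψ.toLp 2 volume) (χ.toLp 2 volume) =
      G (ψ.toLp 2 volume) (χ.toLp 2 volume)) (x y : L2Sp d) : F x y = G x y := by
  refine (denseRange_schwartz_toLp.prodMap denseRange_schwartz_toLp).induction_on
    (p := fun q : L2Sp d × L2Sp d => F q.1 q.2 = G q.1 q.2) (x, y) ?_ fun q => h q.1 q.2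
  exact isClosed_eq hF hG

/-- An equivalent `H¹` norm of `B x` is a multiple of `‖x‖`, so convergence of `B xₙ` in `H¹`
amounts to convergence of `xₙ` in `L²`. -/
theorem sum_norm_derivOp_sq (x : L2Sp d) : (2 * Real.pi) ^ 2 * ‖x‖ ^ 2 =
    (∑ j, ‖derivOp j x‖ ^ 2) + (2 * Real.pi) ^ 2 * ‖besselOp d x‖ ^ 2 := by
  have h := sum_inner_derivOp x x
  simp only [inner_self_eq_norm_sq_to_K] at h
  have h2 : ((∑ j, ‖derivOp j x‖ ^ 2 : ℝ) : ℂ) =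
      (((2 * Real.pi) ^ 2 * (‖x‖ ^ 2 - ‖besselOp d x‖ ^ 2) : ℝ) : ℂ) := by
    push_cast at h ⊢
    exact h
  have h3 := Complex.ofReal_injective h2
  linarith

/-- The trace in the sense of `HasTrace` is given by the trace operator. -/
theorem hasTrace_iff {σ : Measure (EucSp d)} (h : IsTraceMap σ id C) {x : L2Sp d}
    {τ : Lp ℂ 2 σ} : HasTrace σ (besselOp d x) τ ↔ τ = traceOp h x := by
  constructor
  · rintro ⟨ψ, h1, ⟨G, hG, h2⟩, h3⟩
    choose χ hχ using fun n => besselSchwartz_surjective (ψ n)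
    have hGx := hG.unique (isWeakGradient_besselOp x)
    -- The functions `ψ n = B (χ n)` converge in `H¹`, so the preimages converge in `L²`, and
    -- continuity of `traceOp` identifies the limit of the restrictions.
    have hx : Tendsto (fun n => (χ n).toLp 2 (volume : Measure (EucSp d))) atTop (𝓝 x) := by
      rw [tendsto_iff_norm_sub_tendsto_zero]
      set δ := fun n => (χ n).toLp 2 (volume : Measure (EucSp d)) - x with hδ
      have hB : Tendsto (fun n => besselOp d (δ n)) atTop (𝓝 0) := by
        have : ∀ n, besselOp d (δ n) = (ψ n).toLp 2 volume - besselOp d x := fun n => by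
          rw [hδ]
          simp only [map_sub, besselOp_toLp, hχ]
        simp only [this]
        simpa using h1.sub_const (besselOp d x)
      have hD : ∀ j, Tendsto (fun n => derivOp j (δ n)) atTop (𝓝 0) := fun j => by
        have : ∀ n, derivOp j (δ n) =
            (∂_{(EuclideanSpace.single j 1 : EucSp d)} (ψ n)).toLp 2 volume - G j := fun n => by
          rw [hδ, hGx]
          simp only [map_sub, derivOp_toLp, hχ]
        simp only [this]
        simpa using (h2 j).sub_const (G j)
      have hsum : Tendsto (fun n => (∑ j, ‖derivOp j (δ n)‖ ^ 2) +
          (2 * Real.pi) ^ 2 * ‖besselOp d (δ n)‖ ^ 2) atTop (𝓝 0) := by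
        have := (tendsto_finsetSum Finset.univ fun j _ => ((hD j).norm.pow 2)).add
          ((hB.norm.pow 2).const_mul ((2 * Real.pi) ^ 2))
        simpa using this
      simp only [← sum_norm_derivOp_sq] at hsum
      have hsq : Tendsto (fun n => ‖δ n‖ ^ 2) atTop (𝓝 0) := by
        have := hsum.const_mul (((2 * Real.pi) ^ 2)⁻¹)
        rw [mul_zero] at this
        refine this.congr fun n => ?_
        rw [← mul_assoc, inv_mul_cancel₀ (by positivity), one_mul]
      have := hsq.sqrt
      simpa using this
    have hlim : Tendsto (fun n => traceOp h ((χ n).toLp 2 volume)) atTop (𝓝 (traceOp h x)) :=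
      ((traceOp h).continuous.tendsto x).comp hx
    have hlim' : Tendsto (fun n => traceOp h ((χ n).toLp 2 volume)) atTop (𝓝 τ) := by
      rw [Lp.tendsto_Lp_iff_tendsto_eLpNorm']
      refine h3.congr fun n => eLpNorm_congr_ae ?_
      rw [traceOp_toLp]
      filter_upwards [(h.memLp (besselSchwartz (χ n))).coeFn_toLp] with y hy
      rw [Pi.sub_apply, hy, hχ]
      rfl
    exact tendsto_nhds_unique hlim' hlim
  · rintro rfl
    obtain ⟨u, hu, hux⟩ := mem_closure_iff_seq_limit.1 (denseRange_schwartz_toLp x)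
    choose χ hχ using hu
    obtain rfl : (fun n => (χ n).toLp 2 (volume : Measure (EucSp d))) = u := funext hχ
    refine ⟨fun n => besselSchwartz (χ n), ?_, ⟨_, isWeakGradient_besselOp x, fun j => ?_⟩, ?_⟩
    · simp only [← besselOp_toLp]
      exact ((besselOp d).continuous.tendsto x).comp hux
    · simp only [← derivOp_toLp]
      exact ((derivOp j).continuous.tendsto x).comp hux
    · have hlim : Tendsto (fun n => traceOp h ((χ n).toLp 2 volume)) atTop (𝓝 (traceOp h x)) :=
        ((traceOp h).continuous.tendsto x).comp hux
      rw [Lp.tendsto_Lp_iff_tendsto_eLpNorm'] at hlim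
      refine hlim.congr fun n => eLpNorm_congr_ae ?_
      rw [traceOp_toLp]
      filter_upwards [(h.memLp (besselSchwartz (χ n))).coeFn_toLp] with y hy
      rw [Pi.sub_apply, hy]
      rfl

end TraceOp

/-! ### The trace inequality in a layer -/

section Layer

variable {d : ℕ} {Y : Type*} [MeasurableSpace Y]

/-- The map `(y, t) ↦ p(y) + t n(y)` distorts volumes by a bounded factor for `|t| < β`. -/
structure IsNormalLayer (ρ : Measure Y) (p n : Y → EucSp d) (β : ℝ) (c : ℝ≥0) : Prop where
  measurable_base : Measurable p
  measurable_normal : Measurable n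
  norm_le : ∀ y, ‖n y‖ ≤ 1
  pos : 0 < β
  lintegral_le : ∀ k : EucSp d → ℝ≥0∞, Measurable k →
    ∫⁻ y, (∫⁻ t in Ioo (-β) β, k (p y + t • n y)) ∂ρ ≤ c * ∫⁻ x, k x

/-- Integrating the derivative of `‖g‖²` from `r` to `t` and averaging over `r` in `(-β, β)`.
Keeping the product `‖g‖ ‖g'‖` leads to the multiplicative trace inequality. -/
theorem sq_norm_le_integral {β : ℝ} (hβ : 0 < β) {g g' : ℝ → ℂ} (hg : ∀ t, HasDerivAt g (g' t) t)
    (hg' : Continuous g') {t : ℝ} (ht : t ∈ Ioo (-β) β) :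
    ‖g t‖ ^ 2 ≤ ∫ r in (-β)..β, ((2 * β)⁻¹ * ‖g r‖ ^ 2 + 2 * (‖g r‖ * ‖g' r‖)) := by
  have hgc : Continuous g := continuous_iff_continuousAt.2 fun t => (hg t).continuousAt
  set J := ∫ r in (-β)..β, 2 * (‖g r‖ * ‖g' r‖) with hJ
  have hd : ∀ r, HasDerivAt (fun r => ‖g r‖ ^ 2) (2 * inner ℝ (g r) (g' r)) r := fun r => (hg r).norm_sq
  have hci : Continuous fun r => 2 * inner ℝ (g r) (g' r) := by fun_prop
  have hcj : Continuous fun r => 2 * (‖g r‖ * ‖g' r‖) := by fun_prop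
  have hpt : ∀ r ∈ Icc (-β) β, ‖g t‖ ^ 2 - J ≤ ‖g r‖ ^ 2 := by
    intro r hr
    have h1 : ∫ u in r..t, 2 * inner ℝ (g u) (g' u) = ‖g t‖ ^ 2 - ‖g r‖ ^ 2 :=
      intervalIntegral.integral_eq_sub_of_hasDerivAt (fun u _ => hd u) (hci.intervalIntegrable _ _)
    have h2 : ‖∫ u in r..t, 2 * inner ℝ (g u) (g' u)‖ ≤ |∫ u in r..t, 2 * (‖g u‖ * ‖g' u‖)| := by
      refine intervalIntegral.norm_integral_le_abs_of_norm_le (ae_of_all _ fun u => ?_)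
        (hcj.intervalIntegrable _ _)
      rw [norm_mul, Real.norm_ofNat]
      gcongr
      exact norm_inner_le_norm _ _
    have h3 : |∫ u in r..t, 2 * (‖g u‖ * ‖g' u‖)| ≤ J := by
      have h4 : uIoc r t ⊆ uIoc (-β) β := by
        rw [uIoc_of_le (by linarith : -β ≤ β)]
        intro u hu
        rw [mem_uIoc] at hu
        rcases hu with hu | hu
        · exact ⟨hr.1.trans_lt hu.1, hu.2.trans ht.2.le⟩
        · exact ⟨ht.1.trans hu.1, hu.2.trans hr.2⟩
      have h5 : 0 ≤ J := intervalIntegral.integral_nonneg (by linarith) fun u _ => by positivity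
      rw [← abs_of_nonneg h5]
      exact intervalIntegral.abs_integral_mono_interval h4 (ae_of_all _ fun u => by positivity)
        (hcj.intervalIntegrable _ _)
    have := Real.le_norm_self (∫ u in r..t, 2 * inner ℝ (g u) (g' u))
    linarith
  have h4 : ∫ _ in (-β)..β, (‖g t‖ ^ 2 - J) ≤ ∫ r in (-β)..β, ‖g r‖ ^ 2 :=
    intervalIntegral.integral_mono_on (by linarith) (by simp)
      ((by fun_prop : Continuous fun r => ‖g r‖ ^ 2).intervalIntegrable _ _) hpt
  rw [intervalIntegral.integral_const, smul_eq_mul] at h4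
  rw [intervalIntegral.integral_add ((by fun_prop : Continuous _).intervalIntegrable _ _)
    (hcj.intervalIntegrable _ _), intervalIntegral.integral_const_mul, ← hJ]
  have h5 : (2 * β)⁻¹ * ((β - -β) * (‖g t‖ ^ 2 - J)) ≤ (2 * β)⁻¹ * ∫ r in (-β)..β, ‖g r‖ ^ 2 := by
    gcongr
  have h6 : (2 * β)⁻¹ * ((β - -β) * (‖g t‖ ^ 2 - J)) = ‖g t‖ ^ 2 - J := by
    field_simp
    ring
  linarith

theorem norm_fderiv_apply_le (φ : 𝓢(EucSp d, ℂ)) (x v : EucSp d) :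
    ‖fderiv ℝ φ x v‖ ≤ ‖v‖ * ∑ j, ‖partialS j φ x‖ := by
  have hv : v = ∑ j, v j • (EuclideanSpace.single j 1 : EucSp d) := by
    ext i
    simp [Finset.sum_apply, Pi.single_apply]
  conv_lhs => rw [hv, map_sum]
  refine (norm_sum_le _ _).trans ?_
  rw [Finset.mul_sum]
  refine Finset.sum_le_sum fun j _ => ?_
  rw [map_smul, norm_smul, partialS, SchwartzMap.lineDerivOp_apply_eq_fderiv]
  gcongr
  exact PiLp.norm_apply_le v j

theorem hasDerivAt_schwartz_line (φ : 𝓢(EucSp d, ℂ)) (x v : EucSp d) (t : ℝ) :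
    HasDerivAt (fun r : ℝ => φ (x + r • v)) (fderiv ℝ φ (x + t • v) v) t := by
  have h1 : HasDerivAt (fun r : ℝ => x + r • v) v t := by
    simpa using ((hasDerivAt_id t).smul_const v).const_add x
  exact (φ.differentiableAt.hasFDerivAt).comp_hasDerivAt t h1

theorem continuous_fderiv_schwartz_line (φ : 𝓢(EucSp d, ℂ)) (x v : EucSp d) :
    Continuous fun t : ℝ => fderiv ℝ φ (x + t • v) v := by
  have h : Continuous (fderiv ℝ φ) := (φ.smooth 1).continuous_fderiv (by norm_num)
  exact (h.comp (by fun_prop)).clm_apply continuous_const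

theorem lintegral_enorm_mul_le (φ χ : 𝓢(EucSp d, ℂ)) : ∫⁻ x, ‖φ x‖ₑ * ‖χ x‖ₑ ≤
    ENNReal.ofReal (‖φ.toLp 2 (volume : Measure (EucSp d))‖ *
      ‖χ.toLp 2 (volume : Measure (EucSp d))‖) := by
  have h := ENNReal.lintegral_mul_le_Lp_mul_Lq (volume : Measure (EucSp d))
    Real.HolderConjugate.two_two (f := fun x => ‖φ x‖ₑ) (g := fun x => ‖χ x‖ₑ)
    (by have := φ.continuous; fun_prop) (by have := χ.continuous; fun_prop)
  refine h.trans (le_of_eq ?_)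
  have h1 : ∀ φ : 𝓢(EucSp d, ℂ), (∫⁻ x, ‖φ x‖ₑ ^ (2 : ℝ)) ^ (1 / 2 : ℝ) =
      ENNReal.ofReal ‖φ.toLp 2 (volume : Measure (EucSp d))‖ := by
    intro φ
    have h2 : ‖φ.toLp 2 (volume : Measure (EucSp d))‖ =
        (eLpNorm φ 2 (volume : Measure (EucSp d))).toReal := Lp.norm_toLp _ _
    rw [h2, ENNReal.ofReal_toReal (φ.memLp 2 volume).2.ne,
      eLpNorm_eq_lintegral_rpow_enorm_toReal (by norm_num) (by norm_num)]
    norm_num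
  rw [h1, h1, ENNReal.ofReal_mul (norm_nonneg _)]

theorem lintegral_enorm_sq (φ : 𝓢(EucSp d, ℂ)) : ∫⁻ x, ‖φ x‖ₑ ^ 2 =
    ENNReal.ofReal (‖φ.toLp 2 (volume : Measure (EucSp d))‖ ^ 2) :=
  (norm_toLp_sq (φ.memLp 2 volume)).symm

variable {ρ : Measure Y} {p n : Y → EucSp d} {β : ℝ} {c : ℝ≥0}

/-- The constant in the trace inequality. -/
noncomputable def layerConst (β : ℝ) (c : ℝ≥0) : ℝ := c * ((2 * β)⁻¹ + 2)

/-- The density in the trace inequality. -/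
noncomputable def traceDensity (β : ℝ) (φ : 𝓢(EucSp d, ℂ)) (x : EucSp d) : ℝ≥0∞ :=
  ENNReal.ofReal (2 * β)⁻¹ * ‖φ x‖ₑ ^ 2 + ∑ j, 2 * (‖φ x‖ₑ * ‖partialS j φ x‖ₑ)

theorem measurable_traceDensity_term (φ : 𝓢(EucSp d, ℂ)) (j : Fin d) :
    Measurable fun x => 2 * (‖φ x‖ₑ * ‖partialS j φ x‖ₑ) := by
  have h1 := φ.continuous.measurable
  have h2 : Measurable (partialS j φ) := (partialS j φ).continuous.measurable
  fun_prop

theorem measurable_traceDensity (β : ℝ) (φ : 𝓢(EucSp d, ℂ)) :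
    Measurable (traceDensity β φ) :=
  (by have h1 := φ.continuous.measurable; fun_prop :
    Measurable fun x => ENNReal.ofReal (2 * β)⁻¹ * ‖φ x‖ₑ ^ 2).add
    (Finset.measurable_fun_sum _ fun j _ => measurable_traceDensity_term φ j)

theorem lintegral_traceDensity_le {β : ℝ} (hβ : 0 < β) (φ : 𝓢(EucSp d, ℂ)) :
    ∫⁻ x, traceDensity β φ x ≤ ENNReal.ofReal (((2 * β)⁻¹ + 2) * traceSize φ) := by
  have h4 : ∀ j, ∫⁻ x, 2 * (‖φ x‖ₑ * ‖partialS j φ x‖ₑ) ≤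
      ENNReal.ofReal (2 * (‖φ.toLp 2 (volume : Measure (EucSp d))‖ *
        ‖(partialS j φ).toLp 2 (volume : Measure (EucSp d))‖)) := fun j => by
    rw [lintegral_const_mul' _ _ (by norm_num), ENNReal.ofReal_mul (by norm_num),
      ENNReal.ofReal_ofNat]
    gcongr
    exact lintegral_enorm_mul_le φ (partialS j φ)
  unfold traceDensity
  rw [lintegral_add_right _ (Finset.measurable_fun_sum _ fun j _ =>
      measurable_traceDensity_term φ j),
    lintegral_const_mul _ (by have := φ.continuous.measurable; fun_prop),
    lintegral_finsetSum _ fun j _ => measurable_traceDensity_term φ j, lintegral_enorm_sq,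
    ← ENNReal.ofReal_mul (by positivity)]
  refine (add_le_add le_rfl (Finset.sum_le_sum fun j _ => h4 j)).trans ?_
  rw [← ENNReal.ofReal_sum_of_nonneg fun j _ => by positivity, ← ENNReal.ofReal_add
    (by positivity) (Finset.sum_nonneg fun j _ => by positivity)]
  refine ENNReal.ofReal_le_ofReal ?_
  rw [traceSize, ← Finset.mul_sum, ← Finset.mul_sum]
  have ha : 0 ≤ ‖φ.toLp 2 (volume : Measure (EucSp d))‖ := norm_nonneg _
  have hb : 0 ≤ ∑ j, ‖(partialS j φ).toLp 2 (volume : Measure (EucSp d))‖ :=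
    Finset.sum_nonneg fun j _ => norm_nonneg _
  generalize ‖φ.toLp 2 (volume : Measure (EucSp d))‖ = a at *
  generalize ∑ j, ‖(partialS j φ).toLp 2 (volume : Measure (EucSp d))‖ = b at *
  have h5 : 0 ≤ (2 * β)⁻¹ * (a * b) := by positivity
  have h6 : 0 ≤ a * a := by positivity
  linarith [show ((2 * β)⁻¹ + 2) * (a * (a + b)) - ((2 * β)⁻¹ * a ^ 2 + 2 * (a * b)) =
    (2 * β)⁻¹ * (a * b) + 2 * (a * a) by ring]

theorem enorm_sq_le_lintegral_traceDensity {β : ℝ} (hβ : 0 < β) {t : ℝ} (ht : t ∈ Ioo (-β) β)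
    (φ : 𝓢(EucSp d, ℂ)) (x v : EucSp d) (hv : ‖v‖ ≤ 1) :
    ‖φ (x + t • v)‖ₑ ^ 2 ≤ ∫⁻ r in Ioo (-β) β, traceDensity β φ (x + r • v) := by
  have h1 := sq_norm_le_integral hβ (hasDerivAt_schwartz_line φ x v)
    (continuous_fderiv_schwartz_line φ x v) ht
  have hcont : Continuous fun r : ℝ => ((2 * β)⁻¹ * ‖φ (x + r • v)‖ ^ 2 +
      2 * (‖φ (x + r • v)‖ * ‖fderiv ℝ φ (x + r • v) v‖)) := by
    have := continuous_fderiv_schwartz_line φ x v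
    have := φ.continuous
    fun_prop
  have h2 : ‖φ (x + t • v)‖ₑ ^ 2 = ENNReal.ofReal (‖φ (x + t • v)‖ ^ 2) := by
    rw [ENNReal.ofReal_pow (norm_nonneg _), ofReal_norm]
  rw [h2]
  refine (ENNReal.ofReal_le_ofReal h1).trans ?_
  rw [intervalIntegral.integral_of_le (by linarith), ofReal_integral_eq_lintegral_ofReal
    (hcont.integrableOn_Icc.mono_set Ioc_subset_Icc_self) (ae_of_all _ fun r => by positivity),
    restrict_Ioo_eq_restrict_Ioc]
  refine lintegral_mono fun r => ?_
  rw [traceDensity, ENNReal.ofReal_add (by positivity) (by positivity),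
    ENNReal.ofReal_mul (by positivity), ENNReal.ofReal_pow (norm_nonneg _), ofReal_norm]
  refine add_le_add le_rfl ?_
  have h3 : ‖fderiv ℝ φ (x + r • v) v‖ ≤ ∑ j, ‖partialS j φ (x + r • v)‖ :=
    (norm_fderiv_apply_le φ _ _).trans
      (mul_le_of_le_one_left (Finset.sum_nonneg fun j _ => norm_nonneg _) hv)
  rw [← Finset.mul_sum, ← Finset.mul_sum, ENNReal.ofReal_mul (by norm_num), ENNReal.ofReal_mul
    (norm_nonneg _), ofReal_norm, ENNReal.ofReal_ofNat]
  refine mul_le_mul_right (mul_le_mul_right ?_ _) _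
  refine (ENNReal.ofReal_le_ofReal h3).trans (le_of_eq ?_)
  rw [ENNReal.ofReal_sum_of_nonneg fun j _ => norm_nonneg _]
  exact Finset.sum_congr rfl fun j _ => ofReal_norm _

/-- The one-dimensional bound on each normal segment, integrated over the base. The constant is the
same for all parallel slices `|t| < β`, which makes the trace operators uniformly bounded as the
layer shrinks. -/
theorem IsNormalLayer.lintegral_slice_le (h : IsNormalLayer ρ p n β c) {t : ℝ}
    (ht : t ∈ Ioo (-β) β) (φ : 𝓢(EucSp d, ℂ)) :
    ∫⁻ y, ‖φ (p y + t • n y)‖ₑ ^ 2 ∂ρ ≤ ENNReal.ofReal (layerConst β c * traceSize φ) := by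
  calc _ ≤ ∫⁻ y, (∫⁻ r in Ioo (-β) β, traceDensity β φ (p y + r • n y)) ∂ρ :=
        lintegral_mono fun y => enorm_sq_le_lintegral_traceDensity h.pos ht φ _ _ (h.norm_le y)
    _ ≤ c * ∫⁻ x, traceDensity β φ x := h.lintegral_le _ (measurable_traceDensity β φ)
    _ ≤ c * ENNReal.ofReal (((2 * β)⁻¹ + 2) * traceSize φ) :=
        mul_le_mul_right (lintegral_traceDensity_le h.pos φ) _
    _ = _ := by
        rw [← ENNReal.ofReal_coe_nnreal, ← ENNReal.ofReal_mul (by positivity), layerConst, mul_assoc]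

/-- The product of `ρ` with Lebesgue measure on `(-β, β)`. -/
noncomputable def layerMeasure (ρ : Measure Y) (β : ℝ) : Measure (Y × ℝ) :=
  ρ.prod (volume.restrict (Ioo (-β) β))

/-- The map `(y, s) ↦ p(y) + a s n(y)`. -/
def layerMap (p n : Y → EucSp d) (a : ℝ) (q : Y × ℝ) : EucSp d := p q.1 + (a * q.2) • n q.1

theorem IsNormalLayer.measurable_layerMap (h : IsNormalLayer ρ p n β c) (a : ℝ) :
    Measurable (layerMap p n a) := by
  have h1 := h.measurable_base
  have h2 := h.measurable_normal
  unfold layerMap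
  fun_prop

theorem IsNormalLayer.layerConst_nonneg (h : IsNormalLayer ρ p n β c) : 0 ≤ layerConst β c := by
  have := h.pos
  unfold layerConst
  positivity

theorem traceSize_nonneg (φ : 𝓢(EucSp d, ℂ)) : 0 ≤ traceSize φ := by
  unfold traceSize
  positivity

theorem mul_mem_Ioo_of_abs_le_one {a s : ℝ} (ha : |a| ≤ 1) (hs : s ∈ Ioo (-β) β) :
    a * s ∈ Ioo (-β) β := by
  rw [mem_Ioo, ← abs_lt] at hs ⊢
  rw [abs_mul]
  exact (mul_le_of_le_one_left (abs_nonneg s) ha).trans_lt hs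

theorem IsNormalLayer.isTraceMap [SFinite ρ] (h : IsNormalLayer ρ p n β c) {a : ℝ} (ha : |a| ≤ 1) :
    IsTraceMap (layerMeasure ρ β) (layerMap p n a) (2 * β * layerConst β c) where
  measurable := h.measurable_layerMap a
  nonneg := mul_nonneg (by have := h.pos; positivity) h.layerConst_nonneg
  bound φ := by
    have hm : Measurable fun q => ‖φ (layerMap p n a q)‖ₑ ^ 2 :=
      ((φ.continuous.measurable.comp (h.measurable_layerMap a)).enorm).pow_const 2
    rw [layerMeasure, lintegral_prod_symm _ hm.aemeasurable]
    calc _ ≤ ∫⁻ _ in Ioo (-β) β, ENNReal.ofReal (layerConst β c * traceSize φ) :=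
          setLIntegral_mono' measurableSet_Ioo fun s hs =>
            h.lintegral_slice_le (mul_mem_Ioo_of_abs_le_one ha hs) φ
      _ = _ := by
        rw [setLIntegral_const, Real.volume_Ioo, ← ENNReal.ofReal_mul
          (mul_nonneg h.layerConst_nonneg (traceSize_nonneg φ))]
        congr 1
        ring

theorem IsNormalLayer.isTraceMap_base (h : IsNormalLayer ρ p n β c) :
    IsTraceMap (ρ.map p) (id : EucSp d → EucSp d) (layerConst β c) where
  measurable := measurable_id
  nonneg := h.layerConst_nonneg
  bound φ := by
    have hm : Measurable fun x : EucSp d => ‖φ x‖ₑ ^ 2 := by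
      have := φ.continuous.measurable
      fun_prop
    simp only [id]
    rw [lintegral_map hm h.measurable_base]
    have h0 : (0 : ℝ) ∈ Ioo (-β) β := ⟨by linarith [h.pos], h.pos⟩
    simpa using h.lintegral_slice_le h0 φ

/-- The fundamental theorem of calculus along the segment and Cauchy–Schwarz in `θ`; a second
Cauchy–Schwarz over the partial derivatives produces the factor `d`. -/
theorem enorm_sub_sq_le (φ : 𝓢(EucSp d, ℂ)) (x v : EucSp d) {r : ℝ} (hv : ‖v‖ ≤ r) :
    ‖φ (x + v) - φ x‖ₑ ^ 2 ≤ ENNReal.ofReal (r ^ 2 * d) *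
      ∫⁻ θ in Ioo (0 : ℝ) 1, ∑ j, ‖partialS j φ (x + θ • v)‖ₑ ^ 2 := by
  have hc := continuous_fderiv_schwartz_line φ x v
  have h1 : ∫ θ in (0 : ℝ)..1, fderiv ℝ φ (x + θ • v) v = φ (x + v) - φ x := by
    have := intervalIntegral.integral_eq_sub_of_hasDerivAt
      (fun θ _ => hasDerivAt_schwartz_line φ x v θ) (hc.intervalIntegrable 0 1)
    simpa using this
  rw [← h1, intervalIntegral.integral_of_le zero_le_one, ← restrict_Ioo_eq_restrict_Ioc]
  have h2 : ‖∫ θ in Ioo (0 : ℝ) 1, fderiv ℝ φ (x + θ • v) v‖ₑ ^ 2 ≤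
      ∫⁻ θ in Ioo (0 : ℝ) 1, ‖fderiv ℝ φ (x + θ • v) v‖ₑ ^ 2 := by
    have h3 := enorm_integral_le_lintegral_enorm (μ := volume.restrict (Ioo (0 : ℝ) 1))
      (fun θ => fderiv ℝ φ (x + θ • v) v)
    have h4 := ENNReal.lintegral_mul_le_Lp_mul_Lq (volume.restrict (Ioo (0 : ℝ) 1))
      Real.HolderConjugate.two_two (f := fun θ => ‖fderiv ℝ φ (x + θ • v) v‖ₑ) (g := fun _ => 1)
      hc.measurable.enorm.aemeasurable aemeasurable_const
    simp only [one_pow, ENNReal.one_rpow, lintegral_const, Measure.restrict_apply_univ, Real.volume_Ioo,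
      sub_zero, ENNReal.ofReal_one, mul_one, Pi.mul_apply, ENNReal.rpow_ofNat] at h4
    calc _ ≤ ((∫⁻ θ in Ioo (0 : ℝ) 1, ‖fderiv ℝ φ (x + θ • v) v‖ₑ ^ 2) ^ (1 / 2 : ℝ)) ^ 2 := by
          gcongr
          exact h3.trans h4
      _ = _ := by
        rw [← ENNReal.rpow_natCast, ← ENNReal.rpow_mul]
        norm_num
  refine h2.trans ?_
  rw [← lintegral_const_mul' _ _ ENNReal.ofReal_ne_top]
  refine lintegral_mono fun θ => ?_
  have h5 : ‖fderiv ℝ φ (x + θ • v) v‖ ^ 2 ≤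
      r ^ 2 * d * ∑ j, ‖partialS j φ (x + θ • v)‖ ^ 2 := by
    have h6 := norm_fderiv_apply_le φ (x + θ • v) v
    have h7 : (∑ j, ‖partialS j φ (x + θ • v)‖) ^ 2 ≤
        d * ∑ j, ‖partialS j φ (x + θ • v)‖ ^ 2 := by
      simpa using sq_sum_le_card_mul_sum_sq (s := Finset.univ)
        (f := fun j : Fin d => ‖partialS j φ (x + θ • v)‖)
    calc _ ≤ (‖v‖ * ∑ j, ‖partialS j φ (x + θ • v)‖) ^ 2 := by gcongr
      _ = ‖v‖ ^ 2 * (∑ j, ‖partialS j φ (x + θ • v)‖) ^ 2 := by ring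
      _ ≤ r ^ 2 * (d * ∑ j, ‖partialS j φ (x + θ • v)‖ ^ 2) := by gcongr
      _ = _ := by ring
  have h8 := ENNReal.ofReal_le_ofReal h5
  rw [ENNReal.ofReal_mul (by positivity), ENNReal.ofReal_pow (norm_nonneg _), ofReal_norm,
    ENNReal.ofReal_sum_of_nonneg fun j _ => by positivity] at h8
  refine h8.trans (le_of_eq ?_)
  congr 1
  refine Finset.sum_congr rfl fun j _ => ?_
  rw [ENNReal.ofReal_pow (norm_nonneg _), ofReal_norm]

theorem lintegral_lintegral_finsetSum_swap {X Z ι : Type*} [Fintype ι] [MeasurableSpace X]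
    [MeasurableSpace Z] {μ : Measure X} {ν : Measure Z} [SFinite μ] [SFinite ν]
    {F : ι → X × Z → ℝ≥0∞} (hF : ∀ j, Measurable (F j)) :
    ∫⁻ x, (∫⁻ z, ∑ j, F j (x, z) ∂ν) ∂μ = ∑ j, ∫⁻ z, (∫⁻ x, F j (x, z) ∂μ) ∂ν := by
  have h1 : ∀ x, ∫⁻ z, ∑ j, F j (x, z) ∂ν = ∑ j, ∫⁻ z, F j (x, z) ∂ν := fun x =>
    lintegral_finsetSum _ fun j _ => (hF j).comp measurable_prodMk_left
  simp only [h1]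
  rw [lintegral_finsetSum _ fun j _ => (hF j).lintegral_prod_right']
  exact Finset.sum_congr rfl fun j _ => lintegral_lintegral_swap (hF j).aemeasurable

/-- The intermediate points of the segments lie on the slices with scale `θ a`, `0 < θ < 1`, where
the trace inequality applies to the partial derivatives. -/
theorem IsNormalLayer.lintegral_sub_sq_le [SFinite ρ] (h : IsNormalLayer ρ p n β c) {a : ℝ}
    (ha : |a| ≤ 1) (φ : 𝓢(EucSp d, ℂ)) :
    ∫⁻ q, ‖φ (layerMap p n a q) - φ (layerMap p n 0 q)‖ₑ ^ 2 ∂(layerMeasure ρ β) ≤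
      ENNReal.ofReal ((a * β) ^ 2 * d) *
        ∑ j, ENNReal.ofReal (2 * β * layerConst β c * traceSize (partialS j φ)) := by
  have hsupp : ∀ᵐ q ∂(layerMeasure ρ β), q.2 ∈ Ioo (-β) β := by
    have h1 : ∀ᵐ s ∂(volume.restrict (Ioo (-β) β)), s ∈ Ioo (-β) β :=
      ae_restrict_mem measurableSet_Ioo
    exact Measure.quasiMeasurePreserving_snd.ae h1
  have hm : ∀ j, Measurable fun z : (Y × ℝ) × ℝ =>
      ‖partialS j φ (layerMap p n (z.2 * a) z.1)‖ₑ ^ 2 := fun j => by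
    have h1 := h.measurable_base
    have h2 := h.measurable_normal
    have h3 := (partialS j φ).continuous.measurable
    unfold layerMap
    fun_prop
  calc _ ≤ ∫⁻ q, ENNReal.ofReal ((a * β) ^ 2 * d) *
        (∫⁻ θ in Ioo (0 : ℝ) 1, ∑ j, ‖partialS j φ (layerMap p n (θ * a) q)‖ₑ ^ 2)
          ∂(layerMeasure ρ β) := by
        refine lintegral_mono_ae ?_
        filter_upwards [hsupp] with q hq
        have hv : ‖(a * q.2) • n q.1‖ ≤ |a| * β := by
          rw [norm_smul, Real.norm_eq_abs, abs_mul]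
          have h1 : |q.2| ≤ β := (abs_lt.2 hq).le
          have hβ := h.pos
          calc _ ≤ |a| * β * 1 := mul_le_mul (mul_le_mul_of_nonneg_left h1 (abs_nonneg a))
                (h.norm_le _) (norm_nonneg _) (by positivity)
            _ = _ := mul_one _
        have h1 := enorm_sub_sq_le φ (p q.1) _ hv
        rw [mul_pow, sq_abs, ← mul_pow] at h1
        simpa [layerMap, smul_smul, mul_assoc] using h1
    _ = ENNReal.ofReal ((a * β) ^ 2 * d) * ∑ j, ∫⁻ θ in Ioo (0 : ℝ) 1,
          (∫⁻ q, ‖partialS j φ (layerMap p n (θ * a) q)‖ₑ ^ 2 ∂(layerMeasure ρ β)) := by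
        rw [lintegral_const_mul' _ _ ENNReal.ofReal_ne_top]
        congr 1
        have : SFinite (layerMeasure ρ β) := by unfold layerMeasure; infer_instance
        exact lintegral_lintegral_finsetSum_swap hm
    _ ≤ _ := by
        gcongr with j
        calc _ ≤ ∫⁻ _ in Ioo (0 : ℝ) 1,
              ENNReal.ofReal (2 * β * layerConst β c * traceSize (partialS j φ)) := by
              refine setLIntegral_mono' measurableSet_Ioo fun θ hθ => ?_
              have h1 : |θ * a| ≤ 1 := by
                rw [abs_mul, abs_of_pos hθ.1]
                exact mul_le_one₀ hθ.2.le (abs_nonneg a) ha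
              exact (h.isTraceMap h1).bound (partialS j φ)
          _ = _ := by simp

/-- The trace operators in the layer are Lipschitz in the transversal scale, on `H²`. -/
theorem IsNormalLayer.norm_traceOp_sub_sq_le [SFinite ρ] (h : IsNormalLayer ρ p n β c) {a : ℝ}
    (ha : |a| ≤ 1) (h0 : |(0 : ℝ)| ≤ 1) (x : L2Sp d) :
    ‖(traceOp (h.isTraceMap ha) - traceOp (h.isTraceMap h0)) (besselOp d x)‖ ^ 2 ≤
      (β ^ 2 * d * (d * (2 * β * layerConst β c * ((1 + 2 * Real.pi * d) * (2 * Real.pi) ^ 2)))) *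
        a ^ 2 * (‖besselOp d x‖ * ‖x‖) := by
  have hβ := h.pos
  have hL := h.layerConst_nonneg
  refine denseRange_schwartz_toLp.induction_on (p := fun x : L2Sp d =>
    ‖(traceOp (h.isTraceMap ha) - traceOp (h.isTraceMap h0)) (besselOp d x)‖ ^ 2 ≤
      (β ^ 2 * d * (d * (2 * β * layerConst β c * ((1 + 2 * Real.pi * d) * (2 * Real.pi) ^ 2)))) *
        a ^ 2 * (‖besselOp d x‖ * ‖x‖)) x ?_ fun ψ => ?_
  · exact isClosed_le (by fun_prop) (by fun_prop)
  · set X := ψ.toLp 2 (volume : Measure (EucSp d)) with hX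
    -- Of the two Bessel factors one absorbs the derivative `∂ⱼ`, the other one is used up by the
    -- trace inequality.
    have hts : ∀ j, traceSize (partialS j (besselSchwartz (besselSchwartz ψ))) ≤
        (1 + 2 * Real.pi * d) * (2 * Real.pi) ^ 2 * (‖besselOp d X‖ * ‖X‖) := by
      intro j
      have e1 : partialS j (besselSchwartz (besselSchwartz ψ)) =
          besselSchwartz (partialS j (besselSchwartz ψ)) := besselSchwartz_lineDeriv _ _
      have e2 : (partialS j (besselSchwartz ψ)).toLp 2 volume = derivOp j X :=
        (derivOp_toLp j ψ).symm
      have e3 : besselOp d (derivOp j X) = derivOp j (besselOp d X) := by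
        rw [← e2, besselOp_toLp, ← e1, hX, besselOp_toLp, derivOp_toLp]
        rfl
      have h1 := traceSize_besselSchwartz_le (partialS j (besselSchwartz ψ))
      rw [← e1, e2, e3] at h1
      have h2 := norm_derivOp_apply_le j X
      have h3 := norm_derivOp_apply_le j (besselOp d X)
      calc _ ≤ _ := h1
        _ ≤ (1 + 2 * Real.pi * d) * ((2 * Real.pi * ‖besselOp d X‖) * (2 * Real.pi * ‖X‖)) := by
          gcongr
        _ = _ := by ring
    have hT : ∀ {b : ℝ} (hb : |b| ≤ 1), traceOp (h.isTraceMap hb) (besselOp d X) =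
        ((h.isTraceMap hb).memLp (besselSchwartz (besselSchwartz ψ))).toLp _ := fun hb => by
      rw [hX, besselOp_toLp, traceOp_toLp]
    rw [sub_apply, hT ha, hT h0, ← MemLp.toLp_sub]
    have h1 := (norm_toLp_sq (((h.isTraceMap ha).memLp (besselSchwartz (besselSchwartz ψ))).sub
      ((h.isTraceMap h0).memLp (besselSchwartz (besselSchwartz ψ))))).trans_le
      (h.lintegral_sub_sq_le ha _)
    rw [← ENNReal.ofReal_sum_of_nonneg fun j _ => mul_nonneg (by positivity) (traceSize_nonneg _),
      ← ENNReal.ofReal_mul (by positivity), ENNReal.ofReal_le_ofReal_iff (mul_nonneg (by positivity)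
        (Finset.sum_nonneg fun j _ => mul_nonneg (by positivity) (traceSize_nonneg _)))] at h1
    refine h1.trans ?_
    have h2 : ∑ j, 2 * β * layerConst β c *
        traceSize (partialS j (besselSchwartz (besselSchwartz ψ))) ≤
        ∑ _j : Fin d, 2 * β * layerConst β c *
          ((1 + 2 * Real.pi * d) * (2 * Real.pi) ^ 2 * (‖besselOp d X‖ * ‖X‖)) :=
      Finset.sum_le_sum fun j _ => mul_le_mul_of_nonneg_left (hts j) (by positivity)
    refine (mul_le_mul_of_nonneg_left h2 (by positivity)).trans (le_of_eq ?_)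
    simp only [Finset.sum_const, Finset.card_univ, Fintype.card_fin, nsmul_eq_mul]
    ring

end Layer

/-! ### Operators given by forms -/

section FormGraph

variable {d : ℕ}

/-- `T` is the operator of the form `(∇f, ∇g) - (P x, y)`, where `f = B x`, `g = B y` range over
`H¹(ℝᵈ)`. -/
def HasFormGraph (T : L2Sp d →ₗ.[ℂ] L2Sp d) (P : L2Sp d →L[ℂ] L2Sp d) : Prop :=
  ∀ f h : L2Sp d, (∃ hf : f ∈ T.domain, T ⟨f, hf⟩ = h) ↔
    ∃ x, besselOp d x = f ∧
      (((2 * Real.pi) ^ 2 : ℝ) : ℂ) • (x - besselOp d (besselOp d x)) - P x = besselOp d h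

/-- Adding `s B² x = B (s f)` to the graph relation gives `(C_s - P) x = B (h + s f)`, which is
solved by inverting the bounded operator on the left. -/
theorem HasFormGraph.isResolventAt {T : L2Sp d →ₗ.[ℂ] L2Sp d} {P : L2Sp d →L[ℂ] L2Sp d}
    (hT : HasFormGraph T P) {s : ℝ}
    (hu : IsUnit (energyOp ((2 * Real.pi) ^ 2) (besselOp d) s - P)) :
    IsResolventAt T ((-s : ℝ) : ℂ) (formResolvent ((2 * Real.pi) ^ 2) (besselOp d) s P) := by
  set κ : ℝ := (2 * Real.pi) ^ 2
  set B := besselOp d with hB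
  set A := energyOp κ B s - P with hA
  have hAx : ∀ x, A x = ((κ : ℂ) • (x - B (B x)) - P x) + (s : ℂ) • B (B x) := by
    intro x
    simp only [hA, energyOp, sub_apply, add_apply, smul_apply, one_apply_eq_self,
      mul_apply_eq_comp]
    abel
  constructor
  · intro f
    set g := Ring.inverse A (B f) with hg
    have hAg : A g = B f := by
      simpa using congrArg (fun A : L2Sp d →L[ℂ] L2Sp d => A (B f)) (Ring.mul_inverse_cancel _ hu)
    have hR : formResolvent κ B s P f = B g := rfl
    have h1 : ∃ x, B x = B g ∧ (κ : ℂ) • (x - B (B x)) - P x = B (f - (s : ℂ) • B g) := by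
      refine ⟨g, rfl, ?_⟩
      rw [map_sub, map_smul, ← hAg, hAx, add_sub_cancel_right]
    obtain ⟨hf, hTf⟩ := (hT (B g) (f - (s : ℂ) • B g)).2 h1
    refine ⟨hf, ?_⟩
    change T ⟨B g, hf⟩ - ((-s : ℝ) : ℂ) • B g = f
    rw [hTf]
    push_cast
    rw [neg_smul]
    abel
  · rintro ⟨f, hf⟩
    obtain ⟨x, hx, hxe⟩ := (hT f (T ⟨f, hf⟩)).1 ⟨hf, rfl⟩
    have h1 : B (T ⟨f, hf⟩ - ((-s : ℝ) : ℂ) • f) = A x := by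
      rw [map_sub, map_smul, ← hxe, hAx, ← hx, Complex.ofReal_neg, neg_smul, sub_neg_eq_add]
    change B (Ring.inverse A (B (T ⟨f, hf⟩ - ((-s : ℝ) : ℂ) • f))) = f
    rw [h1]
    have h2 : Ring.inverse A (A x) = x := by
      simpa using congrArg (fun A : L2Sp d →L[ℂ] L2Sp d => A x) (Ring.inverse_mul_cancel _ hu)
    rw [h2, hx]

theorem memLp_ofReal_top {X : Type*} [MeasurableSpace X] {μ : Measure X} {w : X → ℝ}
    (hw : MemLp w ∞ μ) : MemLp (fun x => (w x : ℂ)) ∞ μ :=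
  hw.ofReal

theorem mulDomain_eq_top {W : EucSp d → ℝ} (hW : MemLp W ∞ volume) (f : L2Sp d) :
    f ∈ mulDomain W :=
  mem_mulDomain.2 ((Lp.memLp _).ae_eq (coeFn_lpMul (memLp_ofReal_top hW) f))

theorem mulOperator_apply {W : EucSp d → ℝ} (hW : MemLp W ∞ volume) (f : L2Sp d)
    (hf : f ∈ (mulOperator W).domain) :
    mulOperator W ⟨f, hf⟩ = lpMul (memLp_ofReal_top hW) f := by
  refine Lp.ext ?_
  have h1 : mulOperator W ⟨f, hf⟩ =ᵐ[volume] fun x => (W x : ℂ) * f x :=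
    MemLp.coeFn_toLp (mem_mulDomain.1 hf)
  exact h1.trans (coeFn_lpMul (memLp_ofReal_top hW) f).symm

theorem HasFormGraph.add_mulOperator {T : L2Sp d →ₗ.[ℂ] L2Sp d} {P : L2Sp d →L[ℂ] L2Sp d}
    (hT : HasFormGraph T P) {Q : EucSp d → ℝ} (hQ : MemLp Q ∞ volume) :
    HasFormGraph (T + mulOperator Q)
      (P - besselOp d * lpMul (memLp_ofReal_top hQ) * besselOp d) := by
  intro f h
  have h1 : (∃ hf : f ∈ (T + mulOperator Q).domain, (T + mulOperator Q) ⟨f, hf⟩ = h) ↔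
      ∃ hf : f ∈ T.domain, T ⟨f, hf⟩ = h - lpMul (memLp_ofReal_top hQ) f := by
    constructor
    · rintro ⟨hf, he⟩
      rw [LinearPMap.add_apply, mulOperator_apply hQ] at he
      exact ⟨hf.1, eq_sub_of_add_eq he⟩
    · rintro ⟨hf, he⟩
      refine ⟨⟨hf, mulDomain_eq_top hQ f⟩, ?_⟩
      rw [LinearPMap.add_apply, mulOperator_apply hQ]
      exact add_eq_of_eq_sub he
  rw [h1, hT]
  refine exists_congr fun x => and_congr_right fun hx => ?_
  rw [← hx, map_sub, sub_apply, mul_apply_eq_comp, mul_apply_eq_comp]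
  constructor <;> intro h2
  · rw [← sub_eq_zero] at h2 ⊢
    rw [← h2]
    abel
  · rw [← sub_eq_zero] at h2 ⊢
    rw [← h2]
    abel

theorem HasFormGraph.sub_mulOperator {T : L2Sp d →ₗ.[ℂ] L2Sp d} {P : L2Sp d →L[ℂ] L2Sp d}
    (hT : HasFormGraph T P) {Q : EucSp d → ℝ} (hQ : MemLp Q ∞ volume) :
    HasFormGraph (T - mulOperator Q)
      (P + besselOp d * lpMul (memLp_ofReal_top hQ) * besselOp d) := by
  intro f h
  have h1 : (∃ hf : f ∈ (T - mulOperator Q).domain, (T - mulOperator Q) ⟨f, hf⟩ = h) ↔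
      ∃ hf : f ∈ T.domain, T ⟨f, hf⟩ = h + lpMul (memLp_ofReal_top hQ) f := by
    constructor
    · rintro ⟨hf, he⟩
      rw [LinearPMap.sub_apply, mulOperator_apply hQ] at he
      exact ⟨hf.1, eq_add_of_sub_eq he⟩
    · rintro ⟨hf, he⟩
      refine ⟨⟨hf, mulDomain_eq_top hQ f⟩, ?_⟩
      rw [LinearPMap.sub_apply, mulOperator_apply hQ]
      exact sub_eq_of_eq_add he
  rw [h1, hT]
  refine exists_congr fun x => and_congr_right fun hx => ?_
  rw [← hx, map_add, add_apply, mul_apply_eq_comp, mul_apply_eq_comp]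
  constructor <;> intro h2
  · rw [← sub_eq_zero] at h2 ⊢
    rw [← h2]
    abel
  · rw [← sub_eq_zero] at h2 ⊢
    rw [← h2]
    abel

/-- The values of an operator given by its graph. -/
theorem exists_toLinearPMap_apply_iff {E F : Type*} [AddCommGroup E] [AddCommGroup F] [Module ℂ E]
    [Module ℂ F] {g : Submodule ℂ (E × F)}
    (hg : ∀ (x : E × F) (_hx : x ∈ g) (_hx' : x.fst = 0), x.snd = 0) (f : E) (h : F) :
    (∃ hf : f ∈ g.toLinearPMap.domain, g.toLinearPMap ⟨f, hf⟩ = h) ↔ (f, h) ∈ g := by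
  have hgr : (f, h) ∈ g ↔ (f, h) ∈ g.toLinearPMap.graph := by
    rw [Submodule.toLinearPMap_graph_eq g hg]
  rw [hgr, LinearPMap.mem_graph_iff]
  constructor
  · rintro ⟨hf, he⟩
    exact ⟨⟨f, hf⟩, rfl, he⟩
  · rintro ⟨y, hy, he⟩
    obtain ⟨y, hy'⟩ := y
    obtain rfl : y = f := hy
    exact ⟨hy', he⟩

theorem hasFormGraph_freeLaplacian : HasFormGraph (freeLaplacian d) 0 := by
  intro f h
  have hκ : (((2 * Real.pi) ^ 2 : ℝ) : ℂ) ≠ 0 := by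
    rw [Ne, Complex.ofReal_eq_zero]; positivity
  rw [freeLaplacian, exists_toLinearPMap_apply_iff]
  · change (MemSobolev 2 2 (f : 𝓢'(EucSp d, ℂ)) ∧
        (h : 𝓢'(EucSp d, ℂ)) = -Δ (f : 𝓢'(EucSp d, ℂ))) ↔ _
    rw [memSobolev_two_iff]
    constructor
    · rintro ⟨⟨x, rfl⟩, hx⟩
      rw [neg_laplacian_besselOp] at hx
      refine ⟨besselOp d x, rfl, ?_⟩
      rw [coe_dist_injective hx, map_smul, map_sub]
      simp
    · rintro ⟨x, rfl, hx⟩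
      rw [zero_apply, sub_zero] at hx
      -- Regularity: the equation `κ (x - B² x) = B h` exhibits `x` as an element of the range of
      -- `B`, so `f = B x` lies in the range of `B²`, which is `H²`.
      obtain ⟨z, rfl⟩ : ∃ z, besselOp d z = x := by
        refine ⟨(((2 * Real.pi) ^ 2 : ℝ) : ℂ)⁻¹ • h + besselOp d x, ?_⟩
        rw [map_add, map_smul, ← hx, inv_smul_smul₀ hκ]
        abel
      refine ⟨⟨z, rfl⟩, ?_⟩
      rw [neg_laplacian_besselOp]
      congr 1
      apply besselOp_injective
      rw [← hx, map_smul, map_sub]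
  · rintro ⟨f, h⟩ ⟨-, hx⟩ (rfl : f = 0)
    simp only [coe_dist_zero, laplacian_dist_zero, neg_zero] at hx
    exact coe_dist_injective (hx.trans coe_dist_zero.symm)

theorem hasFormGraph_schrodinger {W : EucSp d → ℝ} (hW : MemLp W ∞ volume) :
    HasFormGraph (schrodinger W) (besselOp d * lpMul (memLp_ofReal_top hW) * besselOp d) := by
  have h := (hasFormGraph_freeLaplacian (d := d)).sub_mulOperator hW
  rwa [zero_add] at h

/-- Substituting `f = B x` and `g = B y` makes gradients and traces bounded functions of `x` and
`y`, and the weak equation for all `y` becomes an equation in `L²`. -/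
theorem hasFormGraph_deltaOperator {σ : Measure (EucSp d)} {C : ℝ} (hσ : IsTraceMap σ id C)
    {α : EucSp d → ℝ} (hα : MemLp α ∞ σ) : HasFormGraph (deltaOperator σ α)
      (ContinuousLinearMap.adjoint (traceOp hσ) ∘L lpMul (memLp_ofReal_top hα) ∘L traceOp hσ) := by
  set P := ContinuousLinearMap.adjoint (traceOp hσ) ∘L lpMul (memLp_ofReal_top hα) ∘L
    traceOp hσ with hP
  have hform : ∀ x y : L2Sp d, deltaFormValue σ α (fun j => derivOp j x) (fun j => derivOp j y)
      (traceOp hσ x) (traceOp hσ y) =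
        inner ℂ y ((((2 * Real.pi) ^ 2 : ℝ) : ℂ) • (x - besselOp d (besselOp d x)) - P x) := by
    intro x y
    rw [deltaFormValue, sum_inner_derivOp, inner_sub_right, inner_smul_right, inner_sub_right,
      inner_map_of_isSelfAdjoint isSelfAdjoint_besselOp, hP, ContinuousLinearMap.comp_apply,
      ContinuousLinearMap.comp_apply, ContinuousLinearMap.adjoint_inner_right, inner_lpMul]
  have hmem : ∀ f h : L2Sp d, ((MemSobolev 1 2 (f : 𝓢'(EucSp d, ℂ)) ∧
        ∃ (G : Fin d → L2Sp d) (τ : Lp ℂ 2 σ), IsWeakGradient f G ∧ HasTrace σ f τ ∧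
          ∀ (g : L2Sp d) (K : Fin d → L2Sp d) (κ : Lp ℂ 2 σ),
            MemSobolev 1 2 (g : 𝓢'(EucSp d, ℂ)) → IsWeakGradient g K → HasTrace σ g κ →
            Integrable (fun x => (α x : ℂ) * τ x * (starRingEnd ℂ) (κ x)) σ ∧
            deltaFormValue σ α G K τ κ = inner ℂ g h)) ↔ ∃ x, besselOp d x = f ∧
      (((2 * Real.pi) ^ 2 : ℝ) : ℂ) • (x - besselOp d (besselOp d x)) - P x = besselOp d h := by
    intro f h
    constructor
    · rintro ⟨hf, G, τ, hG, hτ, hform'⟩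
      obtain ⟨x, rfl⟩ := memSobolev_one_iff.1 hf
      obtain rfl := hG.unique (isWeakGradient_besselOp x)
      obtain rfl := (hasTrace_iff hσ).1 hτ
      refine ⟨x, rfl, ext_inner_left ℂ fun y => ?_⟩
      rw [← hform, (hform' (besselOp d y) _ _ (memSobolev_one_iff.2 ⟨y, rfl⟩)
        (isWeakGradient_besselOp y) ((hasTrace_iff hσ).2 rfl)).2,
        inner_map_of_isSelfAdjoint isSelfAdjoint_besselOp]
    · rintro ⟨x, rfl, hx⟩
      refine ⟨memSobolev_one_iff.2 ⟨x, rfl⟩, _, _, isWeakGradient_besselOp x,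
        (hasTrace_iff hσ).2 rfl, fun g K κ hg hK hκ => ?_⟩
      obtain ⟨y, rfl⟩ := memSobolev_one_iff.1 hg
      obtain rfl := hK.unique (isWeakGradient_besselOp y)
      obtain rfl := (hasTrace_iff hσ).1 hκ
      refine ⟨integrable_lpMul (memLp_ofReal_top hα) _ _, ?_⟩
      rw [hform, hx, inner_map_of_isSelfAdjoint isSelfAdjoint_besselOp]
  intro f h
  rw [deltaOperator, exists_toLinearPMap_apply_iff]
  · exact hmem f h
  -- Single-valuedness of the graph: `f = 0` forces `x = 0`, so `B h = 0` and `h = 0` by injectivity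
  -- of `B`.
  · rintro ⟨f, h⟩ hx (rfl : f = 0)
    obtain ⟨x, hx0, hxe⟩ := (hmem 0 h).1 hx
    obtain rfl : x = 0 := besselOp_injective (hx0.trans (map_zero _).symm)
    refine besselOp_injective ?_
    rw [← hxe]
    simp

end FormGraph

/-! ### Potentials in a layer -/

section LayerModel

variable {d : ℕ} {ι Y : Type*} [MeasurableSpace Y]

/-- A parametrization of the layers around a hypersurface by `Y × (-β, β)`, with Jacobian `J`. -/
structure LayerModel (S : C2Hypersurface d ι) (ν : EucSp d → EucSp d) (β : ℝ) (ρ : Measure Y)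
    (p n : Y → EucSp d) (J : Y × ℝ → ℝ) (c : ℝ≥0) (b : ℝ) : Prop
    extends IsNormalLayer ρ p n β c where
  map_base : ρ.map p = S.surfaceMeasure
  ae_base : ∀ᵐ y ∂ρ, p y ∈ S.carrier ∧ n y = ν (p y)
  measurable_jac : Measurable J
  jac_nonneg : ∀ y, ∀ t ∈ Ioo (-β) β, 0 ≤ J (y, t)
  bound_nonneg : 0 ≤ b
  jac_sub_le : ∀ y, ∀ t ∈ Ioo (-β) β, |J (y, t) - 1| ≤ b * |t|
  measurableSet_carrier : MeasurableSet S.carrier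
  measurableSet_layer : ∀ ε ∈ Ioc 0 β, MeasurableSet (S.layer ν ε)
  lintegral_layer : ∀ ε ∈ Ioc 0 β, ∀ k : EucSp d → ℝ≥0∞, Measurable k →
    ∫⁻ x in S.layer ν ε, k x =
      ∫⁻ y, (∫⁻ t in Ioo (-ε) ε, k (p y + t • n y) * ENNReal.ofReal (J (y, t))) ∂ρ

theorem lintegral_Ioo_comp_mul {a β : ℝ} (ha : 0 < a) {g : ℝ → ℝ≥0∞} (hg : Measurable g) :
    ∫⁻ s in Ioo (-β) β, g (a * s) * ENNReal.ofReal a = ∫⁻ t in Ioo (-(a * β)) (a * β), g t := by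
  have hpre : (fun s => a * s) ⁻¹' Ioo (-(a * β)) (a * β) = Ioo (-β) β := by
    ext s
    simp only [mem_preimage, mem_Ioo]
    constructor
    · rintro ⟨h1, h2⟩
      exact ⟨by nlinarith, by nlinarith⟩
    · rintro ⟨h1, h2⟩
      exact ⟨by nlinarith, by nlinarith⟩
  have h1 : ∫⁻ t in Ioo (-(a * β)) (a * β), g t ∂(Measure.map (fun s => a * s) volume) =
      ∫⁻ s in Ioo (-β) β, g (a * s) := by
    rw [setLIntegral_map measurableSet_Ioo hg (measurable_const_mul a), hpre]
  rw [Real.map_volume_mul_left ha.ne', Measure.restrict_smul, lintegral_smul_measure] at h1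
  rw [lintegral_mul_const' _ _ ENNReal.ofReal_ne_top, ← h1, smul_eq_mul, mul_comm, ← mul_assoc,
    ← ENNReal.ofReal_mul ha.le, abs_of_pos (inv_pos.2 ha), mul_inv_cancel₀ ha.ne',
    ENNReal.ofReal_one, one_mul]

/-- Bounded distortion of volume makes the preimage of a null set null. Consequently the potential,
known only up to null sets, can be pulled back to the layer. -/
theorem IsNormalLayer.quasiMeasurePreserving {ρ : Measure Y}
    [SFinite ρ] {p n : Y → EucSp d} {β : ℝ} {c : ℝ≥0} (h : IsNormalLayer ρ p n β c) :
    Measure.QuasiMeasurePreserving (layerMap p n 1) (layerMeasure ρ β) volume := by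
  refine ⟨h.measurable_layerMap 1, Measure.AbsolutelyContinuous.mk fun N hN hN0 => ?_⟩
  have hm : Measurable (N.indicator (1 : EucSp d → ℝ≥0∞)) := measurable_one.indicator hN
  have h1 := h.lintegral_le _ hm
  rw [lintegral_indicator_one hN, hN0, mul_zero] at h1
  rw [← lintegral_indicator_one (μ := Measure.map _ _) hN]
  rw [lintegral_map hm (h.measurable_layerMap 1), layerMeasure,
    lintegral_prod (fun q => N.indicator (1 : EucSp d → ℝ≥0∞) (layerMap p n 1 q))
      (hm.comp (h.measurable_layerMap 1)).aemeasurable]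
  simpa [layerMap] using h1

variable {S : C2Hypersurface d ι} {ν : EucSp d → EucSp d} {β : ℝ} {ρ : Measure Y} [SFinite ρ]
  {p n : Y → EucSp d} {J : Y × ℝ → ℝ} {c : ℝ≥0} {b : ℝ}

/-- Change of variables in the thin layer, followed by the substitution `t = a s`, which contributes
the factor `a` to the density. -/
theorem LayerModel.map_withDensity (h : LayerModel S ν β ρ p n J c b) {a : ℝ} (ha : 0 < a)
    (ha1 : a ≤ 1) :
    Measure.map (layerMap p n a) ((layerMeasure ρ β).withDensity
      fun q => ENNReal.ofReal (a * J (q.1, a * q.2))) = volume.restrict (S.layer ν (a * β)) := by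
  have hβ := h.pos
  have hmL := h.measurable_layerMap a
  have hmJ : Measurable fun q : Y × ℝ => ENNReal.ofReal (a * J (q.1, a * q.2)) := by
    have := h.measurable_jac
    fun_prop
  refine Measure.ext fun N hN => ?_
  have hm : Measurable (N.indicator (1 : EucSp d → ℝ≥0∞)) := measurable_one.indicator hN
  have hl : ∀ μ : Measure (EucSp d), μ N = ∫⁻ x, N.indicator (1 : EucSp d → ℝ≥0∞) x ∂μ :=
    fun μ => (lintegral_indicator_one hN).symm
  have hmul : a * β ≤ β := mul_le_of_le_one_left hβ.le ha1
  have hmc : Measurable fun q => N.indicator (1 : EucSp d → ℝ≥0∞) (layerMap p n a q) := hm.comp hmL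
  rw [hl, hl, lintegral_map hm hmL, lintegral_withDensity_eq_lintegral_mul _ hmJ hmc,
    h.lintegral_layer (a * β) ⟨by positivity, hmul⟩ _ hm, layerMeasure,
    lintegral_prod _ (hmJ.mul hmc).aemeasurable]
  refine lintegral_congr fun y => ?_
  have hg : Measurable fun t => N.indicator (1 : EucSp d → ℝ≥0∞) (p y + t • n y) *
      ENNReal.ofReal (J (y, t)) := by
    have h1 : Measurable fun t : ℝ => p y + t • n y := by fun_prop
    have h2 := h.measurable_jac
    exact (hm.comp h1).mul (by fun_prop)
  rw [← lintegral_Ioo_comp_mul ha hg]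
  refine lintegral_congr fun s => ?_
  simp only [Pi.mul_apply, layerMap]
  rw [ENNReal.ofReal_mul ha.le]
  ring

theorem measurable_indicator_of_continuousOn {X Z : Type*} [TopologicalSpace X] [MeasurableSpace X]
    [BorelSpace X] [TopologicalSpace Z] [MeasurableSpace Z] [BorelSpace Z] [Zero Z] {s : Set X}
    (hs : MeasurableSet s) {f : X → Z} (hf : ContinuousOn f s) : Measurable (s.indicator f) := by
  classical
  rw [← piecewise_eq_indicator]
  exact hf.measurable_piecewise continuousOn_const hs

theorem LayerModel.ae_mem_carrier (h : LayerModel S ν β ρ p n J c b) :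
    ∀ᵐ x ∂S.surfaceMeasure, x ∈ S.carrier := by
  rw [← h.map_base]
  exact (ae_map_iff h.measurable_base.aemeasurable h.measurableSet_carrier).2
    (h.ae_base.mono fun y hy => hy.1)

/-- For a null set `N`, almost every normal segment meets `N` in a null set. -/
theorem LayerModel.ae_segment (h : LayerModel S ν β ρ p n J c b) (hν : S.IsUnitNormal ν)
    {N : Set (EucSp d)} (hN : MeasurableSet N) (hN0 : volume N = 0) :
    ∀ᵐ x ∂S.surfaceMeasure, x ∈ S.carrier ∧
      ∀ᵐ s ∂volume.restrict (Ioo (-β) β), x + s • ν x ∉ N := by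
  -- The field `ν` is meaningful only on `Σ`; extended by `0` it is Borel measurable on the whole
  -- space.
  set ν' := S.carrier.indicator ν with hν'
  have hνm : Measurable ν' :=
    measurable_indicator_of_continuousOn h.measurableSet_carrier hν.continuousOn
  set θ : EucSp d → ℝ≥0∞ := fun x =>
    ∫⁻ s in Ioo (-β) β, N.indicator (1 : EucSp d → ℝ≥0∞) (x + s • ν' x) with hθ
  have hm : Measurable fun z : EucSp d × ℝ => N.indicator (1 : EucSp d → ℝ≥0∞) (z.1 + z.2 • ν' z.1) :=
    (measurable_one.indicator hN).comp (by fun_prop)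
  have hθm : Measurable θ := hm.lintegral_prod_right'
  have hθ0 : ∀ᵐ x ∂S.surfaceMeasure, x ∈ θ ⁻¹' {0} := by
    rw [← h.map_base]
    refine (ae_map_iff h.measurable_base.aemeasurable (hθm (measurableSet_singleton 0))).2 ?_
    have h1 := h.lintegral_le _ (measurable_one.indicator hN)
    rw [lintegral_indicator_one hN, hN0, mul_zero] at h1
    have h2 : Measurable fun z : Y × ℝ => N.indicator (1 : EucSp d → ℝ≥0∞) (p z.1 + z.2 • n z.1) :=
      (measurable_one.indicator hN).comp
        (by have := h.measurable_base; have := h.measurable_normal; fun_prop)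
    rw [nonpos_iff_eq_zero, lintegral_eq_zero_iff h2.lintegral_prod_right'] at h1
    filter_upwards [h1, h.ae_base] with y hy hyb
    change θ (p y) = 0
    rw [hθ]
    simp only [hν', indicator_of_mem hyb.1, ← hyb.2]
    exact hy
  filter_upwards [h.ae_mem_carrier, hθ0] with x hx hx0
  refine ⟨hx, ?_⟩
  have h3 : Measurable fun s : ℝ => N.indicator (1 : EucSp d → ℝ≥0∞) (x + s • ν' x) :=
    hm.comp measurable_prodMk_left
  change θ x = 0 at hx0
  simp only [hθ] at hx0
  rw [lintegral_eq_zero_iff h3] at hx0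
  filter_upwards [hx0] with s hs hsN
  rw [hν', indicator_of_mem hx, indicator_of_mem hsN] at hs
  exact one_ne_zero hs

/-- A property which holds almost everywhere holds along almost every normal segment. -/
theorem LayerModel.ae_segment_of_ae (h : LayerModel S ν β ρ p n J c b) (hν : S.IsUnitNormal ν)
    {P : EucSp d → Prop} (hP : ∀ᵐ x, P x) :
    ∀ᵐ x ∂S.surfaceMeasure, x ∈ S.carrier ∧
      ∀ᵐ s ∂volume.restrict (Ioo (-β) β), P (x + s • ν x) := by
  have h0 : volume (toMeasurable volume {x | ¬ P x}) = 0 := by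
    rw [measure_toMeasurable]
    exact hP
  filter_upwards [h.ae_segment hν (measurableSet_toMeasurable _ _) h0] with x hx
  refine ⟨hx.1, hx.2.mono fun s hs => ?_⟩
  by_contra hc
  exact hs (subset_toMeasurable volume _ hc)

/-- Replacing `V` by a strongly measurable representative alters it, by Fubini, only on null subsets
of almost every normal segment. Hence the average agrees almost everywhere with a measurable one,
and it is bounded by `2β ‖V‖_∞`. -/
theorem LayerModel.memLp_transversalAverage (h : LayerModel S ν β ρ p n J c b)
    (hν : S.IsUnitNormal ν) {V : EucSp d → ℝ} (hV : MemLp V ∞ volume) :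
    MemLp (transversalAverage ν β V) ∞ S.surfaceMeasure := by
  have hβ := h.pos
  set ν' := S.carrier.indicator ν with hν'
  have hνm : Measurable ν' :=
    measurable_indicator_of_continuousOn h.measurableSet_carrier hν.continuousOn
  set V' := hV.1.mk V with hV'
  have hV'm : StronglyMeasurable V' := hV.1.stronglyMeasurable_mk
  have hm : StronglyMeasurable fun z : EucSp d × ℝ => V' (z.1 + z.2 • ν' z.1) :=
    hV'm.comp_measurable (by fun_prop)
  have hα' : StronglyMeasurable fun x => ∫ s in Ioo (-β) β, V' (x + s • ν' x) :=
    hm.integral_prod_right'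
  have hae := h.ae_segment_of_ae hν (hV.1.ae_eq_mk.and (ae_le_lpNorm_exponent_top hV))
  have hαe : ∀ x, transversalAverage ν β V x = ∫ s in Ioo (-β) β, V (x + s • ν x) := fun x => by
    rw [transversalAverage, intervalIntegral.integral_of_le (by linarith),
      restrict_Ioo_eq_restrict_Ioc]
  refine memLp_top_of_bound (C := lpNorm V ∞ volume * (2 * β)) ⟨_, hα', ?_⟩ ?_
  · filter_upwards [hae] with x hx
    rw [hαe]
    refine integral_congr_ae (hx.2.mono fun s hs => ?_)
    simp only [hν', indicator_of_mem hx.1]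
    exact hs.1
  · filter_upwards [hae] with x hx
    rw [hαe]
    refine (norm_integral_le_of_norm_le_const (hx.2.mono fun s hs => hs.2)).trans (le_of_eq ?_)
    rw [Measure.real, Measure.restrict_apply_univ, Real.volume_Ioo, ENNReal.toReal_ofReal (by linarith)]
    ring

/-! ### The scaled potential and its transport to the parameter domain. -/

open Classical in
/-- The scaling `y + t ν(y) ↦ y + (β/ε) t ν(y)` of the layer of width `ε` onto that of width `β`. -/
noncomputable def C2Hypersurface.layerScale (S : C2Hypersurface d ι) (ν : EucSp d → EucSp d)
    (β ε : ℝ) (x : EucSp d) : EucSp d :=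
  if h : ∃ p : EucSp d × ℝ, p.1 ∈ S.carrier ∧ p.2 ∈ Ioo (-ε) ε ∧ x = p.1 + p.2 • ν p.1 then
    h.choose.1 + (β / ε * h.choose.2) • ν h.choose.1
  else 0

/-- Injectivity of the normal map forces the chosen pair to be `(y, t)`. -/
theorem C2Hypersurface.LayerHypothesis.layerScale_apply (hβ : S.LayerHypothesis ν β) {ε : ℝ}
    (hε : ε ≤ β) {y : EucSp d} (hy : y ∈ S.carrier) {t : ℝ} (ht : t ∈ Ioo (-ε) ε) :
    S.layerScale ν β ε (y + t • ν y) = y + (β / ε * t) • ν y := by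
  have h : ∃ p : EucSp d × ℝ, p.1 ∈ S.carrier ∧ p.2 ∈ Ioo (-ε) ε ∧ y + t • ν y = p.1 + p.2 • ν p.1 :=
    ⟨(y, t), hy, ht, rfl⟩
  rw [layerScale, dif_pos h]
  obtain ⟨h1, h2, h3⟩ := h.choose_spec
  have hsub : ∀ r ∈ Ioo (-ε) ε, r ∈ Ioo (-β) β := fun r hr =>
    ⟨by linarith [hr.1], hr.2.trans_le hε⟩
  have h4 : h.choose = (y, t) := hβ.injOn ⟨h1, hsub _ h2⟩ ⟨hy, hsub _ ht⟩ h3.symm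
  rw [h4]

theorem C2Hypersurface.scaledPotential_eq_indicator (V : EucSp d → ℝ) (ε : ℝ) :
    S.scaledPotential ν β V ε =
      (S.layer ν ε).indicator fun x => β / ε * V (S.layerScale ν β ε x) := by
  funext x
  by_cases h : ∃ p : EucSp d × ℝ, p.1 ∈ S.carrier ∧ p.2 ∈ Ioo (-ε) ε ∧ x = p.1 + p.2 • ν p.1
  · have hx : x ∈ S.layer ν ε := by
      obtain ⟨p, h1, h2, h3⟩ := h
      exact ⟨p.1, h1, p.2, h2, h3⟩
    rw [indicator_of_mem hx, scaledPotential, layerScale, dif_pos h, dif_pos h]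
  · have hx : x ∉ S.layer ν ε := by
      rintro ⟨y, h1, t, h2, h3⟩
      exact h ⟨(y, t), h1, h2, h3⟩
    rw [indicator_of_notMem hx, scaledPotential, dif_neg h]

/-- By the Lusin–Souslin theorem the injective continuous normal map on a Borel set is a measurable
embedding; the scaling is the extension of a continuous map along it. -/
theorem LayerModel.measurable_layerScale (h : LayerModel S ν β ρ p n J c b)
    (hν : S.IsUnitNormal ν) (hβ : S.LayerHypothesis ν β) {ε : ℝ} (hε : ε ≤ β) :
    Measurable (S.layerScale ν β ε) := by
  set s := S.carrier ×ˢ Ioo (-ε) ε with hs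
  have hcs : ContinuousOn (fun z : EucSp d × ℝ => ν z.1) s :=
    hν.continuousOn.comp continuousOn_fst fun z hz => hz.1
  have hsub : s ⊆ S.carrier ×ˢ Ioo (-β) β :=
    prod_mono_right (Ioo_subset_Ioo (by linarith) hε)
  have hemb : MeasurableEmbedding (s.domRestrict fun z : EucSp d × ℝ => z.1 + z.2 • ν z.1) :=
    ContinuousOn.measurableEmbedding (h.measurableSet_carrier.prod measurableSet_Ioo)
      (continuousOn_fst.add (continuousOn_snd.smul hcs)) (hβ.injOn.mono hsub)
  have hg : Measurable (s.domRestrict fun z : EucSp d × ℝ => z.1 + (β / ε * z.2) • ν z.1) :=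
    (continuousOn_iff_continuous_domRestrict.1
      (continuousOn_fst.add ((continuousOn_const.mul continuousOn_snd).smul hcs))).measurable
  have heq : S.layerScale ν β ε = Function.extend
      (s.domRestrict fun z : EucSp d × ℝ => z.1 + z.2 • ν z.1)
      (s.domRestrict fun z : EucSp d × ℝ => z.1 + (β / ε * z.2) • ν z.1) 0 := by
    funext x
    by_cases hx : ∃ z : s, s.domRestrict (fun z : EucSp d × ℝ => z.1 + z.2 • ν z.1) z = x
    · obtain ⟨z, rfl⟩ := hx
      rw [hemb.injective.extend_apply]
      exact hβ.layerScale_apply hε z.2.1 z.2.2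
    · rw [Function.extend_apply' _ _ _ hx, C2Hypersurface.layerScale, dif_neg]
      · rfl
      · rintro ⟨z, h1, h2, h3⟩
        exact hx ⟨⟨z, h1, h2⟩, h3.symm⟩
  rw [heq]
  exact hemb.measurable_extend hg measurable_zero

theorem ae_layerMeasure_snd_mem : ∀ᵐ q ∂(layerMeasure ρ β), q.2 ∈ Ioo (-β) β := by
  have h1 : ∀ᵐ s ∂(volume.restrict (Ioo (-β) β)), s ∈ Ioo (-β) β :=
    ae_restrict_mem measurableSet_Ioo
  exact Measure.quasiMeasurePreserving_snd.ae h1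

theorem LayerModel.ae_base_layer (h : LayerModel S ν β ρ p n J c b) :
    ∀ᵐ q ∂(layerMeasure ρ β), p q.1 ∈ S.carrier ∧ n q.1 = ν (p q.1) :=
  Measure.quasiMeasurePreserving_fst.ae h.ae_base

theorem LayerModel.layerScale_layerMap (h : LayerModel S ν β ρ p n J c b)
    (hβ : S.LayerHypothesis ν β) {a : ℝ} (ha : 0 < a) (ha1 : a ≤ 1) :
    ∀ᵐ q ∂(layerMeasure ρ β), layerMap p n a q ∈ S.layer ν (a * β) ∧
      S.layerScale ν β (a * β) (layerMap p n a q) = layerMap p n 1 q := by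
  have hp := h.pos
  filter_upwards [h.ae_base_layer, ae_layerMeasure_snd_mem] with q hq hq2
  have ht : a * q.2 ∈ Ioo (-(a * β)) (a * β) := ⟨by nlinarith [hq2.1], by nlinarith [hq2.2]⟩
  simp only [layerMap]
  rw [hq.2]
  refine ⟨⟨_, hq.1, _, ht, rfl⟩, ?_⟩
  rw [hβ.layerScale_apply (mul_le_of_le_one_left hp.le ha1) hq.1 ht]
  congr 2
  field_simp

/-- In parameters the scaling composed with `layerMap p n a` is `layerMap p n 1`, which pulls null
sets back to null sets. Thus the scaled potential inherits measurability and its bound from `V`. -/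
theorem LayerModel.quasiMeasurePreserving_layerScale (h : LayerModel S ν β ρ p n J c b)
    (hν : S.IsUnitNormal ν) (hβ : S.LayerHypothesis ν β) {a : ℝ} (ha : 0 < a) (ha1 : a ≤ 1) :
    Measure.QuasiMeasurePreserving (S.layerScale ν β (a * β))
      (volume.restrict (S.layer ν (a * β))) volume := by
  have hm := h.measurable_layerScale hν hβ (mul_le_of_le_one_left h.pos.le ha1)
  refine ⟨hm, ?_⟩
  rw [← h.map_withDensity ha ha1, Measure.map_map hm (h.measurable_layerMap a)]
  have hac := withDensity_absolutelyContinuous (layerMeasure ρ β)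
    fun q => ENNReal.ofReal (a * J (q.1, a * q.2))
  have hae : S.layerScale ν β (a * β) ∘ layerMap p n a =ᵐ[layerMeasure ρ β] layerMap p n 1 :=
    (h.layerScale_layerMap hβ ha ha1).mono fun q hq => hq.2
  rw [Measure.map_congr (hac.ae_le hae)]
  exact (hac.map (h.measurable_layerMap 1)).trans
    h.toIsNormalLayer.quasiMeasurePreserving.absolutelyContinuous

theorem LayerModel.memLp_scaledPotential (h : LayerModel S ν β ρ p n J c b)
    (hν : S.IsUnitNormal ν) (hβ : S.LayerHypothesis ν β) {a : ℝ} (ha : 0 < a) (ha1 : a ≤ 1)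
    {V : EucSp d → ℝ} (hV : MemLp V ∞ volume) :
    MemLp (S.scaledPotential ν β V (a * β)) ∞ volume := by
  have hp := h.pos
  have hq := h.quasiMeasurePreserving_layerScale hν hβ ha ha1
  rw [C2Hypersurface.scaledPotential_eq_indicator, memLp_indicator_iff_restrict
    (h.measurableSet_layer _ ⟨by positivity, mul_le_of_le_one_left hp.le ha1⟩)]
  refine memLp_top_of_bound (C := |β / (a * β)| * lpNorm V ∞ volume)
    ((hV.1.comp_quasiMeasurePreserving hq).const_mul _) ?_
  filter_upwards [hq.ae (ae_le_lpNorm_exponent_top hV)] with x hx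
  rw [norm_mul, Real.norm_eq_abs (β / (a * β))]
  gcongr

/-- The potential transported to the parameter domain of the layer. -/
def layerPotential (V : EucSp d → ℝ) (p n : Y → EucSp d) (J : Y × ℝ → ℝ) (a : ℝ) (q : Y × ℝ) : ℝ :=
  V (layerMap p n 1 q) * J (q.1, a * q.2)

theorem LayerModel.abs_jac_le (h : LayerModel S ν β ρ p n J c b) (y : Y) {t : ℝ}
    (ht : t ∈ Ioo (-β) β) : |J (y, t)| ≤ 1 + b * β := by
  have h1 := h.jac_sub_le y t ht
  have h2 : |t| ≤ β := (abs_lt.2 ht).le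
  have h3 := h.bound_nonneg
  calc |J (y, t)| = |1 + (J (y, t) - 1)| := by ring_nf
    _ ≤ |1| + |J (y, t) - 1| := abs_add_le _ _
    _ ≤ 1 + b * β := by rw [abs_one]; gcongr; exact h1.trans (by gcongr)

theorem LayerModel.abs_layerPotential_le (h : LayerModel S ν β ρ p n J c b) {a : ℝ} (ha : |a| ≤ 1)
    {V : EucSp d → ℝ} (hV : MemLp V ∞ volume) : ∀ᵐ q ∂(layerMeasure ρ β),
      |layerPotential V p n J a q| ≤ lpNorm V ∞ volume * (1 + b * β) := by
  filter_upwards [ae_layerMeasure_snd_mem, h.toIsNormalLayer.quasiMeasurePreserving.ae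
    (ae_le_lpNorm_exponent_top hV)] with q hq hv
  rw [layerPotential, abs_mul]
  exact mul_le_mul hv (h.abs_jac_le q.1 (mul_mem_Ioo_of_abs_le_one ha hq)) (abs_nonneg _)
    lpNorm_nonneg

theorem LayerModel.abs_layerPotential_sub_le (h : LayerModel S ν β ρ p n J c b) {a : ℝ}
    (ha : |a| ≤ 1) {V : EucSp d → ℝ} (hV : MemLp V ∞ volume) : ∀ᵐ q ∂(layerMeasure ρ β),
      |layerPotential V p n J a q - layerPotential V p n J 0 q| ≤
        lpNorm V ∞ volume * b * (|a| * β) := by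
  have hb := h.bound_nonneg
  have hp := h.pos
  filter_upwards [ae_layerMeasure_snd_mem, h.toIsNormalLayer.quasiMeasurePreserving.ae
    (ae_le_lpNorm_exponent_top hV)] with q hq hv
  have h1 := h.jac_sub_le q.1 _ (mul_mem_Ioo_of_abs_le_one ha hq)
  have h0 := h.jac_sub_le q.1 0 ⟨by linarith, hp⟩
  have h2 : |q.2| ≤ β := (abs_lt.2 hq).le
  rw [abs_zero, mul_zero] at h0
  -- The Lipschitz bound at `t = 0` contains the normalization of the Jacobian.
  have h3 : J (q.1, 0) = 1 := sub_eq_zero.1 (abs_eq_zero.1 (le_antisymm h0 (abs_nonneg _)))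
  rw [layerPotential, layerPotential, zero_mul, h3, ← mul_sub, abs_mul, mul_assoc]
  refine mul_le_mul hv (h1.trans ?_) (abs_nonneg _) lpNorm_nonneg
  rw [abs_mul]
  gcongr

theorem LayerModel.memLp_layerPotential (h : LayerModel S ν β ρ p n J c b) {a : ℝ} (ha : |a| ≤ 1)
    {V : EucSp d → ℝ} (hV : MemLp V ∞ volume) :
    MemLp (layerPotential V p n J a) ∞ (layerMeasure ρ β) := by
  have hm : Measurable fun q : Y × ℝ => J (q.1, a * q.2) := by
    have := h.measurable_jac
    fun_prop
  exact memLp_top_of_bound ((hV.1.comp_quasiMeasurePreserving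
    h.toIsNormalLayer.quasiMeasurePreserving).mul hm.aestronglyMeasurable) _
    (h.abs_layerPotential_le ha hV)

end LayerModel

/-! ### The perturbations in terms of the layer -/

section LayerForm

variable {d : ℕ} {ι X Y : Type*} [MeasurableSpace X] [MeasurableSpace Y]

theorem coeFn_traceOp_toLp {μ : Measure X} {g : X → EucSp d} {C : ℝ} (h : IsTraceMap μ g C)
    (ψ : 𝓢(EucSp d, ℂ)) :
    traceOp h (ψ.toLp 2 volume) =ᵐ[μ] fun x => besselSchwartz ψ (g x) := by
  rw [traceOp_toLp]
  exact MemLp.coeFn_toLp _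

theorem traceOp_form_integrand {μ : Measure X} {g : X → EucSp d} {C : ℝ} (h : IsTraceMap μ g C)
    (w : X → ℂ) (ψ χ : 𝓢(EucSp d, ℂ)) :
    (fun x => w x * traceOp h (ψ.toLp 2 volume) x *
      (starRingEnd ℂ) (traceOp h (χ.toLp 2 volume) x)) =ᵐ[μ]
    fun x => w x * besselSchwartz ψ (g x) * (starRingEnd ℂ) (besselSchwartz χ (g x)) := by
  filter_upwards [coeFn_traceOp_toLp h ψ, coeFn_traceOp_toLp h χ] with x h1 h2
  rw [h1, h2]

theorem inner_traceOp_lpMul {μ : Measure X} {g : X → EucSp d} {C : ℝ} (h : IsTraceMap μ g C)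
    {w : X → ℂ} (hw : MemLp w ∞ μ) (ψ χ : 𝓢(EucSp d, ℂ)) :
    inner ℂ (traceOp h (χ.toLp 2 volume)) (lpMul hw (traceOp h (ψ.toLp 2 volume))) =
      ∫ x, w x * besselSchwartz ψ (g x) * (starRingEnd ℂ) (besselSchwartz χ (g x)) ∂μ := by
  rw [inner_lpMul]
  exact integral_congr_ae (traceOp_form_integrand h w ψ χ)

theorem integrable_traceOp_form {μ : Measure X} {g : X → EucSp d} {C : ℝ} (h : IsTraceMap μ g C)
    {w : X → ℂ} (hw : MemLp w ∞ μ) (ψ χ : 𝓢(EucSp d, ℂ)) : Integrable (fun x =>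
      w x * besselSchwartz ψ (g x) * (starRingEnd ℂ) (besselSchwartz χ (g x))) μ :=
  (integrable_lpMul hw _ _).congr (traceOp_form_integrand h w ψ χ)

theorem inner_besselOp_lpMul {w : EucSp d → ℂ} (hw : MemLp w ∞ volume) (ψ χ : 𝓢(EucSp d, ℂ)) :
    inner ℂ (besselOp d (χ.toLp 2 volume)) (lpMul hw (besselOp d (ψ.toLp 2 volume))) =
      ∫ x, w x * besselSchwartz ψ x * (starRingEnd ℂ) (besselSchwartz χ x) := by
  rw [inner_lpMul]
  refine integral_congr_ae ?_
  rw [besselOp_toLp, besselOp_toLp]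
  filter_upwards [SchwartzMap.coeFn_toLp (besselSchwartz ψ) 2 volume,
    SchwartzMap.coeFn_toLp (besselSchwartz χ) 2 volume] with x h1 h2
  rw [h1, h2]

/-- Operators on `L²(ℝᵈ)` agree if their matrix elements between Schwartz functions agree. -/
theorem ext_inner_schwartz {A A' : L2Sp d →L[ℂ] L2Sp d}
    (h : ∀ ψ χ : 𝓢(EucSp d, ℂ), inner ℂ (χ.toLp 2 (volume : Measure (EucSp d)))
      (A (ψ.toLp 2 volume)) = inner ℂ (χ.toLp 2 (volume : Measure (EucSp d)))
        (A' (ψ.toLp 2 volume))) : A = A' := by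
  refine ContinuousLinearMap.ext fun x => ext_inner_left ℂ fun y => ?_
  refine schwartz_induction₂ (F := fun x y => inner ℂ y (A x)) (G := fun x y => inner ℂ y (A' x))
    ?_ ?_ h x y
  · exact continuous_snd.inner (A.continuous.comp continuous_fst)
  · exact continuous_snd.inner (A'.continuous.comp continuous_fst)

variable {S : C2Hypersurface d ι} {ν : EucSp d → EucSp d} {β : ℝ} {ρ : Measure Y} [SFinite ρ]
  {p n : Y → EucSp d} {J : Y × ℝ → ℝ} {c : ℝ≥0} {b : ℝ}

/-- In parameters the density `a J(y, a s)` of the thin layer meets the factor `β/ε = 1/a` of the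
potential; what remains is `V` at scale one times `J(y, a s)`, with traces taken at scale `a`. -/
theorem LayerModel.besselOp_scaledPotential (h : LayerModel S ν β ρ p n J c b)
    (hν : S.IsUnitNormal ν) (hβ : S.LayerHypothesis ν β) {a : ℝ} (ha : 0 < a) (ha1 : a ≤ 1)
    (haa : |a| ≤ 1) {V : EucSp d → ℝ} (hV : MemLp V ∞ volume) :
    besselOp d * lpMul (memLp_ofReal_top (h.memLp_scaledPotential hν hβ ha ha1 hV)) * besselOp d =
      ContinuousLinearMap.adjoint (traceOp (h.toIsNormalLayer.isTraceMap haa)) ∘L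
        lpMul (memLp_ofReal_top (h.memLp_layerPotential haa hV)) ∘L
          traceOp (h.toIsNormalLayer.isTraceMap haa) := by
  have hp := h.pos
  refine ext_inner_schwartz fun ψ χ => ?_
  rw [mul_apply_eq_comp, mul_apply_eq_comp, ← inner_map_of_isSelfAdjoint isSelfAdjoint_besselOp,
    inner_besselOp_lpMul, ContinuousLinearMap.comp_apply, ContinuousLinearMap.comp_apply,
    ContinuousLinearMap.adjoint_inner_right, inner_traceOp_lpMul]
  set F : EucSp d → ℂ := fun x => besselSchwartz ψ x * (starRingEnd ℂ) (besselSchwartz χ x) with hF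
  have hFc : Continuous F :=
    (besselSchwartz ψ).continuous.mul (Complex.continuous_conj.comp (besselSchwartz χ).continuous)
  set W := S.scaledPotential ν β V (a * β) with hW
  have hmW : AEStronglyMeasurable (fun x => (W x : ℂ) * F x) volume :=
    (memLp_ofReal_top (h.memLp_scaledPotential hν hβ ha ha1 hV)).1.mul hFc.aestronglyMeasurable
  have hms := h.measurableSet_layer (a * β) ⟨by positivity, mul_le_of_le_one_left hp.le ha1⟩
  have h0 : ∀ x, x ∉ S.layer ν (a * β) → W x = 0 := fun x hx => by
    rw [hW, C2Hypersurface.scaledPotential_eq_indicator, indicator_of_notMem hx]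
  have h1 : ∫ x, (W x : ℂ) * besselSchwartz ψ x * (starRingEnd ℂ) (besselSchwartz χ x) =
      ∫ x in S.layer ν (a * β), (W x : ℂ) * F x := by
    rw [setIntegral_eq_integral_of_forall_compl_eq_zero fun x hx => by rw [h0 x hx]; simp]
    simp only [hF, mul_assoc]
  have hmJ : Measurable fun q : Y × ℝ => ENNReal.ofReal (a * J (q.1, a * q.2)) := by
    have := h.measurable_jac
    fun_prop
  rw [h1, ← h.map_withDensity ha ha1, integral_map (h.measurable_layerMap a).aemeasurable
    (by rw [h.map_withDensity ha ha1]; exact hmW.restrict),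
    integral_withDensity_eq_integral_toReal_smul hmJ (ae_of_all _ fun q => ENNReal.ofReal_lt_top)]
  refine integral_congr_ae ?_
  filter_upwards [h.layerScale_layerMap hβ ha ha1, ae_layerMeasure_snd_mem] with q hq hq2
  have hJ := h.jac_nonneg q.1 _ (mul_mem_Ioo_of_abs_le_one haa hq2)
  rw [ENNReal.toReal_ofReal (by positivity), hW, C2Hypersurface.scaledPotential_eq_indicator,
    indicator_of_mem hq.1, hq.2, layerPotential, hF, Complex.real_smul]
  push_cast
  have ha' : (a : ℂ) ≠ 0 := by exact_mod_cast ha.ne'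
  have hp' : (β : ℂ) ≠ 0 := by exact_mod_cast hp.ne'
  field_simp

theorem LayerModel.isTraceMap_surface (h : LayerModel S ν β ρ p n J c b) :
    IsTraceMap S.surfaceMeasure (id : EucSp d → EucSp d) (layerConst β c) :=
  h.map_base ▸ h.toIsNormalLayer.isTraceMap_base

/-- At scale `0` the Jacobian is `1` and the traces are constant along normals, so Fubini's theorem
lets the `s`-integral act on `V` alone. -/
theorem LayerModel.adjoint_transversalAverage (h : LayerModel S ν β ρ p n J c b)
    (hν : S.IsUnitNormal ν) (h0 : |(0 : ℝ)| ≤ 1) {V : EucSp d → ℝ} (hV : MemLp V ∞ volume) :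
    ContinuousLinearMap.adjoint (traceOp h.isTraceMap_surface) ∘L
        lpMul (memLp_ofReal_top (h.memLp_transversalAverage hν hV)) ∘L
          traceOp h.isTraceMap_surface =
      ContinuousLinearMap.adjoint (traceOp (h.toIsNormalLayer.isTraceMap h0)) ∘L
        lpMul (memLp_ofReal_top (h.memLp_layerPotential h0 hV)) ∘L
          traceOp (h.toIsNormalLayer.isTraceMap h0) := by
  have hp := h.pos
  refine ext_inner_schwartz fun ψ χ => ?_
  simp only [ContinuousLinearMap.comp_apply, ContinuousLinearMap.adjoint_inner_right,
    inner_traceOp_lpMul, id]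
  have hint := integrable_traceOp_form (h.toIsNormalLayer.isTraceMap h0)
    (memLp_ofReal_top (h.memLp_layerPotential h0 hV)) ψ χ
  set F : EucSp d → ℂ := fun x => besselSchwartz ψ x * (starRingEnd ℂ) (besselSchwartz χ x) with hF
  have hFc : Continuous F :=
    (besselSchwartz ψ).continuous.mul (Complex.continuous_conj.comp (besselSchwartz χ).continuous)
  have hmα : AEStronglyMeasurable (fun x => (transversalAverage ν β V x : ℂ) * F x)
      S.surfaceMeasure :=
    (memLp_ofReal_top (h.memLp_transversalAverage hν hV)).1.mul hFc.aestronglyMeasurable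
  simp only [mul_assoc]
  simp only [mul_assoc] at hint
  change ∫ x, (transversalAverage ν β V x : ℂ) * F x ∂S.surfaceMeasure =
    ∫ q, (layerPotential V p n J 0 q : ℂ) * F (layerMap p n 0 q) ∂(layerMeasure ρ β)
  change Integrable (fun q => (layerPotential V p n J 0 q : ℂ) * F (layerMap p n 0 q))
    (layerMeasure ρ β) at hint
  rw [← h.map_base] at hmα ⊢
  rw [integral_map h.measurable_base.aemeasurable hmα]
  rw [layerMeasure] at hint ⊢
  rw [integral_prod _ hint]
  refine integral_congr_ae ?_
  filter_upwards [h.ae_base] with y hy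
  have hJ : J (y, 0) = 1 := by
    have h1 := h.jac_sub_le y 0 ⟨by linarith, hp⟩
    rw [abs_zero, mul_zero] at h1
    exact sub_eq_zero.1 (abs_eq_zero.1 (le_antisymm h1 (abs_nonneg _)))
  simp only [layerPotential, layerMap, zero_mul, zero_smul, add_zero, hJ, mul_one, one_mul]
  rw [integral_mul_const, transversalAverage, intervalIntegral.integral_of_le (by linarith),
    ← restrict_Ioo_eq_restrict_Ioc, integral_complex_ofReal, hy.2]

/-- Resolvent estimate below a threshold which does not depend on `ε`. -/
theorem LayerModel.exists_resolvent_estimate (h : LayerModel S ν β ρ p n J c b)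
    (hν : S.IsUnitNormal ν) (hβ : S.LayerHypothesis ν β) {Q V : EucSp d → ℝ}
    (hQ : MemLp Q ∞ volume) (hV : MemLp V ∞ volume) :
    ∃ s₀ : ℝ, 0 < s₀ ∧ ∀ s, s₀ ≤ s → ∃ R₀ : L2Sp d →L[ℂ] L2Sp d,
      IsResolventAt (deltaOperator S.surfaceMeasure (transversalAverage ν β V) + mulOperator Q)
        ((-s : ℝ) : ℂ) R₀ ∧ IsSelfAdjoint R₀ ∧ ∃ L : ℝ, 0 < L ∧ ∀ ε ∈ Ioo 0 (min β 1),
          ∃ R : L2Sp d →L[ℂ] L2Sp d,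
            IsResolventAt (schrodinger (S.scaledPotential ν β V ε) + mulOperator Q)
              ((-s : ℝ) : ℂ) R ∧ IsSelfAdjoint R ∧ ‖R - R₀‖ ≤ L * ε * (1 + |Real.log ε|) := by
  have hp := h.pos
  have hb := h.bound_nonneg
  have hL := h.toIsNormalLayer.layerConst_nonneg
  have h0 : |(0 : ℝ)| ≤ 1 := by simp
  set κ : ℝ := (2 * Real.pi) ^ 2 with hκ
  have hκ1 : 1 ≤ κ := by nlinarith [Real.pi_gt_three]
  have hκ0 : 0 < κ := by linarith
  set B := besselOp d
  have hB : IsSelfAdjoint B := isSelfAdjoint_besselOp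
  set Qo := lpMul (memLp_ofReal_top hQ) with hQo
  have hQs : IsSelfAdjoint Qo := isSelfAdjoint_lpMul _
  set v := lpNorm V ∞ (volume : Measure (EucSp d))
  have hv : 0 ≤ v := lpNorm_nonneg
  set q := lpNorm Q ∞ (volume : Measure (EucSp d))
  have hq : 0 ≤ q := lpNorm_nonneg
  have hQq : ‖Qo‖ ≤ q := norm_lpMul_le _ hq ((ae_le_lpNorm_exponent_top hQ).mono fun x hx => by
    rwa [Complex.norm_real])
  -- One number for two purposes: the first summand bounds `‖W_a‖`, and `ε` times the second bounds
  -- `‖W_a - W_0‖`, as `|a| β = ε`.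
  set w := v * (1 + b * β) + v * b with hw
  have hw0 : 0 ≤ w := by positivity
  set C₁ := 2 * β * layerConst β c * (1 + 2 * Real.pi * d) with hC₁
  have hC₁0 : 0 ≤ C₁ := by positivity
  set C₂ := β ^ 2 * d * (d * (2 * β * layerConst β c * ((1 + 2 * Real.pi * d) * (2 * Real.pi) ^ 2)))
    with hC₂
  have hC₂0 : 0 ≤ C₂ := by positivity
  -- The term `4 C₁` covers `‖T_a x - T_0 x‖² ≤ 2 ‖T_a x‖² + 2 ‖T_0 x‖²`; the division by `β²` turns
  -- `a² = (ε/β)²` into `ε²`.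
  set C := 4 * C₁ + C₂ / β ^ 2 with hC
  have hC0 : 0 ≤ C := by positivity
  have hCC : C₁ ≤ C := by
    have : 0 ≤ C₂ / β ^ 2 := by positivity
    linarith
  set T : ∀ a : ℝ, |a| ≤ 1 → L2Sp d →L[ℂ] Lp ℂ 2 (layerMeasure ρ β) :=
    fun a ha => traceOp (h.toIsNormalLayer.isTraceMap ha) with hT
  set W : ∀ a : ℝ, |a| ≤ 1 → Lp ℂ 2 (layerMeasure ρ β) →L[ℂ] Lp ℂ 2 (layerMeasure ρ β) :=
    fun a ha => lpMul (memLp_ofReal_top (h.memLp_layerPotential ha hV)) with hW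
  have hTb₁ : ∀ a ha x, ‖T a ha x‖ ^ 2 ≤ C₁ * (‖B x‖ * ‖x‖) := fun a ha x =>
    norm_traceOp_sq_le _ x
  have hTb : ∀ a ha x, ‖T a ha x‖ ^ 2 ≤ C * (‖B x‖ * ‖x‖) := fun a ha x =>
    (hTb₁ a ha x).trans (by gcongr)
  have hTs : ∀ a ha x, ‖(T a ha - T 0 h0) x‖ ^ 2 ≤ C * (‖B x‖ * ‖x‖) := fun a ha x => by
    have h1 := norm_sub_le (T a ha x) (T 0 h0 x)
    have h2 := hTb₁ a ha x
    have h3 := hTb₁ 0 h0 x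
    have h4 : 0 ≤ C₂ / β ^ 2 * (‖B x‖ * ‖x‖) := by positivity
    rw [sub_apply]
    have h5 : ‖T a ha x - T 0 h0 x‖ ^ 2 ≤ (‖T a ha x‖ + ‖T 0 h0 x‖) ^ 2 := by gcongr
    rw [hC, add_mul]
    nlinarith [sq_nonneg (‖T a ha x‖ - ‖T 0 h0 x‖)]
  have hWs : ∀ a ha, IsSelfAdjoint (W a ha) := fun a ha => isSelfAdjoint_lpMul _
  have hWb : ∀ a ha, ‖W a ha‖ ≤ w := fun a ha =>
    (norm_lpMul_le _ (by positivity) ((h.abs_layerPotential_le ha hV).mono fun x hx => by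
      rwa [Complex.norm_real])).trans (le_add_of_nonneg_right (by positivity))
  have hWsub : ∀ a ha, ‖W a ha - W 0 h0‖ ≤ v * b * (|a| * β) := fun a ha => by
    refine ContinuousLinearMap.opNorm_le_bound _ (by positivity) fun f => ?_
    refine Lp.norm_le_mul_norm_of_ae_le_mul ?_
    rw [sub_apply]
    filter_upwards [Lp.coeFn_sub (W a ha f) (W 0 h0 f),
      coeFn_lpMul (memLp_ofReal_top (h.memLp_layerPotential ha hV)) f,
      coeFn_lpMul (memLp_ofReal_top (h.memLp_layerPotential h0 hV)) f,
      h.abs_layerPotential_sub_le ha hV] with x h1 h2 h3 h4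
    rw [h1, Pi.sub_apply, h2, h3, ← sub_mul, norm_mul, ← Complex.ofReal_sub, Complex.norm_real]
    gcongr
    exact h4
  have hbound : 0 < coercivityBound κ C w q := by
    unfold coercivityBound
    positivity
  refine ⟨coercivityBound κ C w q, hbound, fun s hs => ?_⟩
  have hunit : ∀ a ha, IsUnit (energyOp κ B s - formPert B Qo (T a ha) (W a ha)) := fun a ha =>
    isUnit_of_coercive (by positivity)
      (coercive_energyOp_sub_formPert hB hκ0 hw0 hs hQq (hWb a ha) (hTb a ha))
  have hself : ∀ a ha, IsSelfAdjoint (formResolvent κ B s (formPert B Qo (T a ha) (W a ha))) :=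
    fun a ha => isSelfAdjoint_formResolvent hB (isSelfAdjoint_formPert hB hQs _ (hWs a ha))
  obtain ⟨L, hL0, hLe⟩ := norm_formResolvent_sub_le (M := Lp ℂ 2 (layerMeasure ρ β)) hB
    norm_besselOp_apply_le hκ1 hC0 hw0 hq hs
  refine ⟨formResolvent κ B s (formPert B Qo (T 0 h0) (W 0 h0)), ?_, hself 0 h0, L, hL0, ?_⟩
  · have hg := (hasFormGraph_deltaOperator h.isTraceMap_surface
      (h.memLp_transversalAverage hν hV)).add_mulOperator hQ
    rw [h.adjoint_transversalAverage hν h0 hV] at hg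
    exact hg.isResolventAt (hunit 0 h0)
  · rintro ε ⟨hε0, hε⟩
    obtain ⟨hεβ, hε1⟩ := lt_min_iff.1 hε
    have ha : 0 < ε / β := by positivity
    have ha1 : ε / β ≤ 1 := (div_le_one hp).2 hεβ.le
    have haa : |ε / β| ≤ 1 := by rwa [abs_of_pos ha]
    have haε : ε / β * β = ε := div_mul_cancel₀ _ hp.ne'
    refine ⟨formResolvent κ B s (formPert B Qo (T _ haa) (W _ haa)), ?_, hself _ haa, ?_⟩
    · have hg := (hasFormGraph_schrodinger
        (h.memLp_scaledPotential hν hβ ha ha1 hV)).add_mulOperator hQ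
      rw [h.besselOp_scaledPotential hν hβ ha ha1 haa hV] at hg
      rw [haε] at hg
      exact hg.isResolventAt (hunit _ haa)
    · refine hLe hε0 hε1.le hQs (hWs _ haa) hQq (hWb _ haa) (hWb _ h0) ?_ (hTb _ haa) (hTb _ h0)
        (hTs _ haa) fun x => ?_
      · refine (hWsub _ haa).trans ?_
        rw [abs_of_pos ha, haε, hw]
        gcongr
        exact le_add_of_nonneg_left (by positivity)
      · refine (h.toIsNormalLayer.norm_traceOp_sub_sq_le haa h0 x).trans ?_
        rw [← hC₂]
        refine mul_le_mul_of_nonneg_right ?_ (by positivity)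
        have : C₂ * (ε / β) ^ 2 = C₂ / β ^ 2 * ε ^ 2 := by ring
        rw [this, hC]
        gcongr
        exact le_add_of_nonneg_left (by positivity)

theorem tendsto_mul_one_add_abs_log (L : ℝ) :
    Tendsto (fun ε : ℝ => L * ε * (1 + |Real.log ε|)) (𝓝[>] 0) (𝓝 0) := by
  have h1 : Tendsto (fun ε : ℝ => ε) (𝓝[>] 0) (𝓝 0) := tendsto_nhdsWithin_of_tendsto_nhds tendsto_id
  have h2 : Tendsto (fun ε : ℝ => |ε * Real.log ε|) (𝓝[>] 0) (𝓝 0) := by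
    simpa using (Real.continuous_mul_log.abs.tendsto 0).mono_left nhdsWithin_le_nhds
  have h3 := (h1.add h2).const_mul L
  rw [add_zero, mul_zero] at h3
  refine h3.congr' ?_
  filter_upwards [self_mem_nhdsWithin] with ε hε
  rw [abs_mul, abs_of_pos (mem_Ioi.1 hε)]
  ring

theorem LayerModel.resolvent_convergence (h : LayerModel S ν β ρ p n J c b)
    (hν : S.IsUnitNormal ν) (hβ : S.LayerHypothesis ν β) {Q V : EucSp d → ℝ}
    (hQ : MemLp Q ∞ volume) (hV : MemLp V ∞ volume) :
    (∃ lam₀ : ℝ, lam₀ < 0 ∧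
      (∀ lam : ℝ, lam < lam₀ → (lam : ℂ) ∈ unboundedResolventSet
        (deltaOperator S.surfaceMeasure (transversalAverage ν β V) + mulOperator Q)) ∧
      (∀ᶠ ε in 𝓝[>] (0 : ℝ), ∀ lam : ℝ, lam < lam₀ → (lam : ℂ) ∈ unboundedResolventSet
        (schrodinger (S.scaledPotential ν β V ε) + mulOperator Q)) ∧
      ∀ lam : ℝ, lam < lam₀ → ∃ c : ℝ, 0 < c ∧ ∀ᶠ ε in 𝓝[>] (0 : ℝ),
        ‖unboundedResolvent (schrodinger (S.scaledPotential ν β V ε) + mulOperator Q) (lam : ℂ) -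
            unboundedResolvent (deltaOperator S.surfaceMeasure (transversalAverage ν β V) +
              mulOperator Q) (lam : ℂ)‖ ≤ c * ε * (1 + |Real.log ε|)) ∧
    NormResolventTendsto (fun ε => schrodinger (S.scaledPotential ν β V ε) + mulOperator Q) (𝓝[>] 0)
      (deltaOperator S.surfaceMeasure (transversalAverage ν β V) + mulOperator Q) := by
  have hp := h.pos
  obtain ⟨s₀, hs₀, hest⟩ := h.exists_resolvent_estimate hν hβ hQ hV
  have hev : ∀ᶠ ε in 𝓝[>] (0 : ℝ), ε ∈ Ioo 0 (min β 1) := Ioo_mem_nhdsGT (lt_min hp one_pos)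
  constructor
  · refine ⟨-s₀, by linarith, fun lam hlam => ?_, ?_, fun lam hlam => ?_⟩
    · obtain ⟨R₀, hR₀, -⟩ := hest (-lam) (by linarith)
      rw [neg_neg] at hR₀
      exact hR₀.mem_resolventSet
    -- The admissible range `(0, min β 1)` of `ε` does not depend on `lam`, which permits this order
    -- of quantifiers.
    · filter_upwards [hev] with ε hε lam hlam
      obtain ⟨R₀, -, -, L, -, hR⟩ := hest (-lam) (by linarith)
      obtain ⟨R, hR, -⟩ := hR ε hε
      rw [neg_neg] at hR
      exact hR.mem_resolventSet
    · obtain ⟨R₀, hR₀, -, L, hL, hR⟩ := hest (-lam) (by linarith)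
      refine ⟨L, hL, ?_⟩
      filter_upwards [hev] with ε hε
      obtain ⟨R, hR, -, hRR⟩ := hR ε hε
      rw [neg_neg] at hR hR₀
      rwa [hR.unboundedResolvent_eq, hR₀.unboundedResolvent_eq]
  · obtain ⟨R₀, hR₀, hR₀s, L, hL, hR⟩ := hest s₀ le_rfl
    refine normResolventTendsto_of_real (-s₀) (R := fun ε => unboundedResolvent
      (schrodinger (S.scaledPotential ν β V ε) + mulOperator Q) ((-s₀ : ℝ) : ℂ)) hR₀ hR₀s ?_ ?_
    · filter_upwards [hev] with ε hε
      obtain ⟨R, hR, hRs, -⟩ := hR ε hε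
      rw [hR.unboundedResolvent_eq]
      exact ⟨hR, hRs⟩
    · rw [tendsto_iff_norm_sub_tendsto_zero]
      refine squeeze_zero' (Eventually.of_forall fun _ => norm_nonneg _) ?_
        (tendsto_mul_one_add_abs_log L)
      filter_upwards [hev] with ε hε
      obtain ⟨R, hR, -, hRR⟩ := hR ε hε
      rwa [hR.unboundedResolvent_eq]

end LayerForm

/-! ### Polynomial bounds for `det (1 - t L)` -/

section PolyBound

-- Lagrange interpolation at `m + 1` fixed nodes in `[0, β)` expresses `P` by its values there, of
-- modulus at most `2`, and by fixed basis polynomials, each satisfying such an estimate at `0`.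
-- Hence `b` depends only on `m` and `β`.
open Polynomial in
theorem exists_bound_of_bounded_polynomial (m : ℕ) {β : ℝ} (hβ : 0 < β) :
    ∃ b : ℝ, 0 ≤ b ∧ ∀ P : ℝ[X], P.natDegree ≤ m → (∀ t ∈ Ioo (-β) β, |P.eval t| ≤ 2) →
      ∀ t ∈ Ioo (-β) β, |P.eval t - P.eval 0| ≤ b * |t| := by
  set s := Finset.range (m + 1) with hs
  set v : ℕ → ℝ := fun j => β * (j / (m + 1)) with hv
  have hm : (0 : ℝ) < m + 1 := by positivity
  have hinj : Set.InjOn v s := by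
    intro i _ j _ hij
    have h1 : (i : ℝ) / (m + 1) = j / (m + 1) := mul_left_cancel₀ hβ.ne' hij
    field_simp at h1
    exact_mod_cast h1
  have hmem : ∀ j ∈ s, v j ∈ Ioo (-β) β := by
    intro j hj
    have h1 : (j : ℝ) < m + 1 := by exact_mod_cast Finset.mem_range.1 hj
    have h2 : (j : ℝ) / (m + 1) < 1 := (div_lt_one hm).2 h1
    have h3 : 0 ≤ (j : ℝ) / (m + 1) := by positivity
    exact ⟨by simp only [hv]; nlinarith, by simp only [hv]; nlinarith⟩
  have hb : ∀ j, ∃ b : ℝ, 0 ≤ b ∧ ∀ t ∈ Icc (-β) β, |(Lagrange.basis s v j).divX.eval t| ≤ b := by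
    intro j
    obtain ⟨b, hb⟩ := isCompact_Icc.exists_bound_of_continuousOn (s := Icc (-β) β)
      ((Lagrange.basis s v j).divX.continuous.continuousOn)
    exact ⟨max b 0, le_max_right _ _, fun t ht => (hb t ht).trans (le_max_left _ _)⟩
  choose b hb0 hb using hb
  have hdiv : ∀ (R : ℝ[X]) (t : ℝ), R.eval t - R.eval 0 = t * R.divX.eval t := by
    intro R t
    conv_lhs => rw [← R.divX_mul_X_add]
    simp
    ring
  refine ⟨∑ j ∈ s, 2 * b j, Finset.sum_nonneg fun j _ => by have := hb0 j; positivity, ?_⟩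
  intro P hP hbd t ht
  have hP' : P = Lagrange.interpolate s v fun i => P.eval (v i) := by
    refine Lagrange.eq_interpolate hinj ?_
    rw [hs, Finset.card_range]
    exact (degree_le_of_natDegree_le hP).trans_lt (by exact_mod_cast Nat.lt_succ_self m)
  have he : ∀ t, P.eval t = ∑ j ∈ s, P.eval (v j) * (Lagrange.basis s v j).eval t := by
    intro t
    conv_lhs => rw [hP', Lagrange.interpolate_apply, eval_finsetSum]
    simp
  rw [he t, he 0, ← Finset.sum_sub_distrib, Finset.sum_mul]
  refine (Finset.abs_sum_le_sum_abs _ _).trans (Finset.sum_le_sum fun j hj => ?_)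
  rw [← mul_sub, hdiv, abs_mul, abs_mul]
  have h1 := hbd _ (hmem j hj)
  have h2 := hb j t ⟨ht.1.le, ht.2.le⟩
  calc _ ≤ 2 * (|t| * b j) := by gcongr
    _ = _ := by ring

/-- The determinant is the reversed characteristic polynomial of `L`, with value `1` at `t = 0`. The
linear bound is thus uniform over all `L` with bounded determinants, and no bound on the entries of
`L` enters. -/
theorem exists_bound_det_one_sub_smul (m : ℕ) {β : ℝ} (hβ : 0 < β) :
    ∃ b : ℝ, 0 ≤ b ∧ ∀ L : Matrix (Fin m) (Fin m) ℝ,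
      (∀ t ∈ Ioo (-β) β, |(1 - t • L).det| ≤ 2) →
      ∀ t ∈ Ioo (-β) β, |(1 - t • L).det - 1| ≤ b * |t| := by
  obtain ⟨b, hb0, hb⟩ := exists_bound_of_bounded_polynomial m hβ
  refine ⟨b, hb0, fun L hL t ht => ?_⟩
  have he : ∀ t, L.charpolyRev.eval t = (1 - t • L).det := by
    intro t
    rw [Matrix.charpolyRev, ← Polynomial.coe_evalRingHom, RingHom.map_det]
    congr 1
    ext i j
    simp [Matrix.one_apply, apply_ite]
    exact mul_comm _ _
  have hdeg : L.charpolyRev.natDegree ≤ m := by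
    rw [← Matrix.reverse_charpoly]
    refine (Polynomial.reverse_natDegree_le _).trans ?_
    rw [Matrix.charpoly_natDegree_eq_dim, Fintype.card_fin]
  have := hb L.charpolyRev hdeg (fun t ht => by rw [he]; exact hL t ht) t ht
  simpa [he] using this

end PolyBound

/-! ### Change of variables in normal coordinates -/

section NormalCoordinates

variable {m d : ℕ}

/-- The square of the determinant is the Gram determinant of the image of an orthonormal basis. -/
theorem sq_det_eq_gram {F κ : Type*} [NormedAddCommGroup F] [InnerProductSpace ℝ F] [Fintype κ]
    [DecidableEq κ] (b : OrthonormalBasis κ ℝ F) (L : F →ₗ[ℝ] F) :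
    LinearMap.det L ^ 2 = (Matrix.of fun i j => inner ℝ (L (b i)) (L (b j))).det := by
  have h : (Matrix.of fun i j => inner ℝ (L (b i)) (L (b j))) =
      (LinearMap.toMatrix b.toBasis b.toBasis L).transpose *
        LinearMap.toMatrix b.toBasis b.toBasis L := by
    ext i j
    simp only [Matrix.of_apply, Matrix.mul_apply, Matrix.transpose_apply, LinearMap.toMatrix_apply,
      OrthonormalBasis.coe_toBasis, OrthonormalBasis.coe_toBasis_repr_apply,
      OrthonormalBasis.repr_apply_apply]
    rw [← b.sum_inner_mul_inner]
    exact Finset.sum_congr rfl fun k _ => by rw [real_inner_comm]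
  rw [h, Matrix.det_mul, Matrix.det_transpose, LinearMap.det_toMatrix, sq]

/-- Change of variables for a map from `ℝᵐ × ℝ` to `ℝᵐ⁺¹`; the Jacobian is expressed by a Gram
determinant. -/
theorem lintegral_image_eq_lintegral_gram (hd : m + 1 = d) {A : Set (EucSp m × ℝ)}
    (hA : MeasurableSet A) {G : EucSp m × ℝ → EucSp d} {G' : EucSp m × ℝ → EucSp m × ℝ →L[ℝ] EucSp d}
    (hG : ∀ z ∈ A, HasFDerivWithinAt G (G' z) A z) (hinj : InjOn G A) {D : EucSp m × ℝ → ℝ}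
    (hD0 : ∀ z ∈ A, 0 ≤ D z)
    (hD : ∀ z ∈ A, D z ^ 2 = (Matrix.fromBlocks
      (Matrix.of fun k l => inner ℝ (G' z (EuclideanSpace.single k 1, 0))
        (G' z (EuclideanSpace.single l 1, 0)))
      (Matrix.of fun k (_ : Unit) => inner ℝ (G' z (EuclideanSpace.single k 1, 0)) (G' z (0, 1)))
      (Matrix.of fun (_ : Unit) l => inner ℝ (G' z (0, 1)) (G' z (EuclideanSpace.single l 1, 0)))
      (Matrix.of fun _ _ => inner ℝ (G' z (0, 1)) (G' z (0, 1)))).det) (k : EucSp d → ℝ≥0∞) :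
    ∫⁻ x in G '' A, k x = ∫⁻ z in A, ENNReal.ofReal (D z) * k (G z) := by
  have hfr : Module.finrank ℝ (EucSp d) = Module.finrank ℝ (WithLp 2 (EucSp m × ℝ)) := by
    rw [(WithLp.linearEquiv 2 ℝ (EucSp m × ℝ)).finrank_eq]
    simp [← hd]
  -- The product `EucSp m × ℝ` carries the sup norm; passing through the `L²` product yields a
  -- linear identification with `EucSp d` that preserves volume, so that the derivative becomes an
  -- endomorphism with a determinant.
  set Ψ : EucSp d ≃ₗᵢ[ℝ] WithLp 2 (EucSp m × ℝ) :=
    (stdOrthonormalBasis ℝ (EucSp d)).equiv (stdOrthonormalBasis ℝ (WithLp 2 (EucSp m × ℝ)))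
      (finCongr hfr) with hΨ
  set Λ : EucSp d ≃L[ℝ] EucSp m × ℝ :=
    Ψ.toContinuousLinearEquiv.trans (WithLp.prodContinuousLinearEquiv 2 ℝ (EucSp m) ℝ) with hΛ
  have hΛp : MeasurePreserving Λ volume volume :=
    (WithLp.volume_preserving_ofLp (EucSp m) ℝ).comp Ψ.measurePreserving
  have hΛe : MeasurableEmbedding Λ := Λ.toHomeomorph.measurableEmbedding
  set b : OrthonormalBasis (Fin m ⊕ Unit) ℝ (EucSp d) :=
    ((EuclideanSpace.basisFun (Fin m) ℝ).prod (OrthonormalBasis.singleton Unit ℝ)).map Ψ.symm with hb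
  have hbl : ∀ k, Λ (b (Sum.inl k)) = (EuclideanSpace.single k 1, 0) := by
    intro k
    simp [hb, hΛ]
  have hbr : ∀ k, Λ (b (Sum.inr k)) = (0, 1) := by
    intro k
    simp [hb, hΛ]
  have himg : G '' A = (G ∘ Λ) '' (Λ ⁻¹' A) := by
    rw [image_comp, image_preimage_eq _ Λ.surjective]
  have hder : ∀ x ∈ Λ ⁻¹' A, HasFDerivWithinAt (G ∘ Λ) ((G' (Λ x)) ∘L (Λ : EucSp d →L[ℝ] EucSp m × ℝ))
      (Λ ⁻¹' A) x := fun x hx =>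
    (hG _ hx).comp x Λ.hasFDerivWithinAt (mapsTo_preimage _ _)
  have hinj' : InjOn (G ∘ Λ) (Λ ⁻¹' A) := fun x hx y hy hxy => Λ.injective (hinj hx hy hxy)
  rw [himg, lintegral_image_eq_lintegral_abs_det_fderiv_mul volume (hΛe.measurable hA) hder hinj' k,
    ← hΛp.setLIntegral_comp_preimage_emb hΛe _ A]
  refine setLIntegral_congr_fun (hΛe.measurable hA) fun x hx => ?_
  simp only [Function.comp_apply]
  congr 2
  rw [← abs_of_nonneg (hD0 _ hx), ← sq_eq_sq_iff_abs_eq_abs, hD _ hx, ContinuousLinearMap.det,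
    sq_det_eq_gram b]
  congr 1
  ext i j
  rcases i with i | i <;> rcases j with j | j <;>
    simp [hbl, hbr]

end NormalCoordinates

/-! ### Differential geometry of a chart -/

section Chart

variable {m d : ℕ}

/-- `N` is a unit normal vector to the range of the injective map `A`. -/
structure IsNormalTo (A : EucSp m →L[ℝ] EucSp d) (N : EucSp d) : Prop where
  injective : Function.Injective A
  norm_eq_one : ‖N‖ = 1
  inner_eq_zero : ∀ h, inner ℝ N (A h) = 0

theorem injective_of_finrank_range {A : EucSp m →L[ℝ] EucSp d}
    (hA : Module.finrank ℝ (LinearMap.range (A : EucSp m →ₗ[ℝ] EucSp d)) = m) :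
    Function.Injective A := by
  have h := (A : EucSp m →ₗ[ℝ] EucSp d).finrank_range_add_finrank_ker
  rw [hA, finrank_euclideanSpace_fin] at h
  have h0 : Module.finrank ℝ (LinearMap.ker (A : EucSp m →ₗ[ℝ] EucSp d)) = 0 := by omega
  exact LinearMap.ker_eq_bot.1 (Submodule.finrank_eq_zero.1 h0)

theorem inner_eq_zero_of_basis {A : EucSp m →L[ℝ] EucSp d} {N : EucSp d}
    (h : ∀ k, inner ℝ N (A (EuclideanSpace.single k 1)) = 0) (x : EucSp m) :
    inner ℝ N (A x) = 0 := by
  have hx : x = ∑ j, x j • (EuclideanSpace.single j 1 : EucSp m) := by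
    ext i
    simp [Finset.sum_apply, Pi.single_apply]
  rw [hx, map_sum, inner_sum]
  exact Finset.sum_eq_zero fun j _ => by rw [map_smul, inner_smul_right, h, mul_zero]

/-- The orthogonal complement of the `m`-dimensional range of `A` in dimension `m + 1` is the line
spanned by `N`. -/
theorem IsNormalTo.eq_smul (hd : m + 1 = d) {A : EucSp m →L[ℝ] EucSp d} {N : EucSp d}
    (h : IsNormalTo A N) {v : EucSp d} (hv : ∀ x, inner ℝ v (A x) = 0) :
    v = (inner ℝ N v : ℝ) • N := by
  set R := LinearMap.range (A : EucSp m →ₗ[ℝ] EucSp d)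
  have hR : Module.finrank ℝ R = m := by
    rw [LinearMap.finrank_range_of_inj h.injective, finrank_euclideanSpace_fin]
  have hRo : Module.finrank ℝ Rᗮ = 1 := by
    have := R.finrank_add_finrank_orthogonal
    rw [hR, finrank_euclideanSpace_fin] at this
    omega
  have hmem : ∀ w : EucSp d, (∀ x, inner ℝ w (A x) = 0) → w ∈ Rᗮ := by
    intro w hw
    rw [Submodule.mem_orthogonal']
    rintro _ ⟨x, rfl⟩
    exact hw x
  have hN0 : (⟨N, hmem N h.inner_eq_zero⟩ : Rᗮ) ≠ 0 := by
    intro h0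
    have : N = 0 := congrArg Subtype.val h0
    have h1 := h.norm_eq_one
    rw [this, norm_zero] at h1
    exact zero_ne_one h1
  obtain ⟨a, ha⟩ := (finrank_eq_one_iff_of_nonzero' _ hN0).1 hRo ⟨v, hmem v hv⟩
  have ha' : a • N = v := congrArg Subtype.val ha
  rw [← ha', inner_smul_right, real_inner_self_eq_norm_sq, h.norm_eq_one]
  simp

theorem IsNormalTo.mem_range (hd : m + 1 = d) {A : EucSp m →L[ℝ] EucSp d} {N : EucSp d}
    (h : IsNormalTo A N) {v : EucSp d} (hv : inner ℝ N v = 0) : ∃ x, A x = v := by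
  set R := LinearMap.range (A : EucSp m →ₗ[ℝ] EucSp d)
  have hvR : v ∈ Rᗮᗮ := by
    rw [Submodule.mem_orthogonal]
    intro w hw
    have hw' := h.eq_smul hd (v := w) fun x =>
      (Submodule.mem_orthogonal' _ _).1 hw _ ⟨x, rfl⟩
    rw [hw', real_inner_smul_left, hv, mul_zero]
  rw [Submodule.orthogonal_orthogonal] at hvR
  exact hvR

theorem IsNormalTo.isUnit_adjoint_comp {A : EucSp m →L[ℝ] EucSp d} {N : EucSp d}
    (h : IsNormalTo A N) : IsUnit (ContinuousLinearMap.adjoint A ∘L A) := by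
  rw [ContinuousLinearMap.isUnit_iff_isUnit_toLinearMap, LinearMap.isUnit_iff_ker_eq_bot,
    LinearMap.ker_eq_bot']
  intro x hx
  have h1 : inner ℝ x ((ContinuousLinearMap.adjoint A ∘L A) x) = ‖A x‖ ^ 2 := by
    rw [ContinuousLinearMap.comp_apply, ContinuousLinearMap.adjoint_inner_right,
      real_inner_self_eq_norm_sq]
  have h2 : (ContinuousLinearMap.adjoint A ∘L A) x = 0 := hx
  rw [h2, inner_zero_right] at h1
  refine h.injective ?_
  rw [map_zero]
  exact norm_eq_zero.1 (pow_eq_zero_iff two_ne_zero |>.1 h1.symm)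

/-- The component of `v` orthogonal to the range of `A`. -/
noncomputable def normalPart (A : EucSp m →L[ℝ] EucSp d) (v : EucSp d) : EucSp d :=
  v - A (Ring.inverse (ContinuousLinearMap.adjoint A ∘L A) (ContinuousLinearMap.adjoint A v))

/-- Subtracting `A (A†A)⁻¹ A† v` leaves a vector annihilated by `A†`, hence a multiple of `N`. -/
theorem IsNormalTo.normalPart_eq (hd : m + 1 = d) {A : EucSp m →L[ℝ] EucSp d} {N : EucSp d}
    (h : IsNormalTo A N) (v : EucSp d) : normalPart A v = (inner ℝ N v : ℝ) • N := by
  have h1 : ContinuousLinearMap.adjoint A (normalPart A v) = 0 := by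
    have h2 : (ContinuousLinearMap.adjoint A ∘L A)
        (Ring.inverse (ContinuousLinearMap.adjoint A ∘L A) (ContinuousLinearMap.adjoint A v)) =
          ContinuousLinearMap.adjoint A v := by
      simpa using congrArg (fun B : EucSp m →L[ℝ] EucSp m => B (ContinuousLinearMap.adjoint A v))
        (Ring.mul_inverse_cancel _ h.isUnit_adjoint_comp)
    rw [normalPart, map_sub, sub_eq_zero]
    exact h2.symm
  have h3 := h.eq_smul hd (v := normalPart A v) fun x => by
    rw [← ContinuousLinearMap.adjoint_inner_left, h1, inner_zero_left]
  rw [h3]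
  congr 1
  rw [normalPart, inner_sub_right, h.inner_eq_zero, sub_zero]

theorem differentiableAt_adjoint (A : EucSp m →L[ℝ] EucSp d) :
    DifferentiableAt ℝ (fun A : EucSp m →L[ℝ] EucSp d => ContinuousLinearMap.adjoint A) A := by
  have h : IsBoundedLinearMap ℝ
      (fun A : EucSp m →L[ℝ] EucSp d => ContinuousLinearMap.adjoint A) :=
    { map_add := fun A B => map_add _ A B
      map_smul := fun c A => by simp
      bound := ⟨1, one_pos, fun A => by simp⟩ }
  exact h.differentiableAt

/-- A continuous unit normal field along a `C²` map is differentiable. -/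
theorem differentiableAt_normal (hd : m + 1 = d) {A : EucSp m → EucSp m →L[ℝ] EucSp d}
    {N : EucSp m → EucSp d} {u : EucSp m} (hA : DifferentiableAt ℝ A u)
    (hN : ContinuousAt N u) (h : ∀ᶠ w in 𝓝 u, IsNormalTo (A w) (N w)) : DifferentiableAt ℝ N u := by
  have hu := h.self_of_nhds
  -- The projection of the fixed vector `N u` to the normal line at `w` involves only `A w`, so it
  -- is differentiable; it equals `(N w, N u) N w`.
  set g : EucSp m → EucSp d := fun w => normalPart (A w) (N u) with hg
  have hAd : DifferentiableAt ℝ (fun w => ContinuousLinearMap.adjoint (A w)) u :=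
    (differentiableAt_adjoint (A u)).comp u hA
  have hinv : DifferentiableAt ℝ (fun w => Ring.inverse (ContinuousLinearMap.adjoint (A w) ∘L A w)) u :=
    DifferentiableAt.comp (g := Ring.inverse) u (differentiableAt_inverse hu.isUnit_adjoint_comp)
      (hAd.clm_comp hA)
  have hgd : DifferentiableAt ℝ g u :=
    (differentiableAt_const _).sub (hA.clm_apply (hinv.clm_apply
      (hAd.clm_apply (differentiableAt_const _))))
  have hge : ∀ᶠ w in 𝓝 u, g w = (inner ℝ (N w) (N u) : ℝ) • N w :=
    h.mono fun w hw => hw.normalPart_eq hd _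
  have hgu : g u = N u := by
    rw [hge.self_of_nhds, real_inner_self_eq_norm_sq, hu.norm_eq_one]
    simp
  -- Continuity of `N` fixes the sign near `u`, so that normalizing `g` recovers `N` and not `-N`.
  have hpos : ∀ᶠ w in 𝓝 u, 0 < (inner ℝ (N w) (N u) : ℝ) := by
    have hc : ContinuousAt (fun w => (inner ℝ (N w) (N u) : ℝ)) u := hN.inner continuousAt_const
    refine hc.eventually (lt_mem_nhds ?_)
    change (0 : ℝ) < inner ℝ (N u) (N u)
    rw [real_inner_self_eq_norm_sq, hu.norm_eq_one]
    norm_num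
  have hgu0 : g u ≠ 0 := by
    rw [hgu, ← norm_pos_iff, hu.norm_eq_one]
    exact one_pos
  have hfin : DifferentiableAt ℝ (fun w => ‖g w‖⁻¹ • g w) u :=
    ((hgd.norm ℝ hgu0).inv (norm_ne_zero_iff.2 hgu0)).smul hgd
  refine hfin.congr_of_eventuallyEq ?_
  filter_upwards [hge, hpos, h] with w h1 h2 h3
  rw [h1, norm_smul, h3.norm_eq_one, Real.norm_eq_abs, abs_of_pos h2, mul_one, smul_smul,
    inv_mul_cancel₀ h2.ne', one_smul]

/-- The matrix of the first fundamental form of a parametrization with derivative `A`. -/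
noncomputable def gramMatrix (A : EucSp m →L[ℝ] EucSp d) : Matrix (Fin m) (Fin m) ℝ :=
  Matrix.of fun k l => inner ℝ (A (EuclideanSpace.single k 1)) (A (EuclideanSpace.single l 1))

theorem det_gramMatrix_pos {A : EucSp m →L[ℝ] EucSp d} (hA : Function.Injective A) :
    0 < (gramMatrix A).det := by
  have hli : LinearIndependent ℝ fun k => A (EuclideanSpace.single k 1) := by
    have h1 := (EuclideanSpace.basisFun (Fin m) ℝ).toBasis.linearIndependent
    have h2 := h1.map' (A : EucSp m →ₗ[ℝ] EucSp d) (LinearMap.ker_eq_bot.2 hA)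
    simpa [Function.comp_def] using h2
  exact (Matrix.posDef_gram_of_linearIndependent hli).det_pos

theorem sum_smul_inner_sum_smul (A : EucSp m →L[ℝ] EucSp d) (X Z : Matrix (Fin m) (Fin m) ℝ)
    (k l : Fin m) : inner ℝ (∑ i, X i k • A (EuclideanSpace.single i 1))
      (∑ j, Z j l • A (EuclideanSpace.single j 1)) = (X.transpose * gramMatrix A * Z) k l := by
  simp only [sum_inner, inner_sum, real_inner_smul_left, real_inner_smul_right, Matrix.mul_apply,
    Matrix.transpose_apply, gramMatrix, Matrix.of_apply, Finset.sum_mul]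
  refine Finset.sum_congr rfl fun j _ => Finset.sum_congr rfl fun i _ => ?_
  ring

/-- The derivative of a unit normal field is tangential; its matrix is minus that of the
Weingarten map. -/
theorem IsNormalTo.exists_matrix (hd : m + 1 = d) {A A' : EucSp m →L[ℝ] EucSp d} {N : EucSp d}
    (h : IsNormalTo A N) (hA' : ∀ x, inner ℝ N (A' x) = 0) :
    ∃ L : Matrix (Fin m) (Fin m) ℝ,
      (gramMatrix A)⁻¹ * (Matrix.of fun k l => inner ℝ (A (EuclideanSpace.single k 1))
        (-(A' (EuclideanSpace.single l 1)))) = L ∧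
      ∀ l, A' (EuclideanSpace.single l 1) = -∑ k, L k l • A (EuclideanSpace.single k 1) := by
  choose y hy using fun l => h.mem_range hd (hA' (EuclideanSpace.single l 1))
  have hsum : ∀ l, A' (EuclideanSpace.single l 1) =
      ∑ k, y l k • A (EuclideanSpace.single k 1) := by
    intro l
    have hx : y l = ∑ j, y l j • (EuclideanSpace.single j 1 : EucSp m) := by
      ext i
      simp [Finset.sum_apply, Pi.single_apply]
    rw [← hy l]
    conv_lhs => rw [hx, map_sum]
    simp only [map_smul]
  -- Here `y l` are the coordinates of the tangential vector `A' e_l`; the sign is that of the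
  -- Weingarten map.
  refine ⟨-Matrix.of fun k l => y l k, ?_, fun l => ?_⟩
  · have h1 : (Matrix.of fun k l => inner ℝ (A (EuclideanSpace.single k 1))
        (-(A' (EuclideanSpace.single l 1)))) = gramMatrix A * -Matrix.of fun k l => y l k := by
      ext k l
      rw [Matrix.mul_neg, Matrix.neg_apply, Matrix.of_apply, inner_neg_right, hsum, inner_sum,
        Matrix.mul_apply]
      congr 1
      refine Finset.sum_congr rfl fun j _ => ?_
      rw [real_inner_smul_right, gramMatrix, Matrix.of_apply, Matrix.of_apply, mul_comm]
    rw [h1, Matrix.nonsing_inv_mul_cancel_left _ _ (det_gramMatrix_pos h.injective).ne'.isUnit]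
  · rw [hsum, ← Finset.sum_neg_distrib]
    refine Finset.sum_congr rfl fun k _ => ?_
    simp

/-- The tangential columns of `G'` are the vectors `A eᵢ` combined by `1 - t L`, and the last column
is the unit normal. The Gram matrix is therefore block diagonal with blocks `(1 - t L)ᵀ (gramMatrix
A) (1 - t L)` and `1`. -/
theorem IsNormalTo.det_normal_coordinates {A A' : EucSp m →L[ℝ] EucSp d} {N : EucSp d}
    (h : IsNormalTo A N) {L : Matrix (Fin m) (Fin m) ℝ}
    (hL : ∀ l, A' (EuclideanSpace.single l 1) = -∑ k, L k l • A (EuclideanSpace.single k 1))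
    (t : ℝ) {G' : EucSp m × ℝ →L[ℝ] EucSp d}
    (hG : ∀ x r, G' (x, r) = A x + t • A' x + r • N) :
    ((1 - t • L).det * √(gramMatrix A).det) ^ 2 = (Matrix.fromBlocks
      (Matrix.of fun k l => inner ℝ (G' (EuclideanSpace.single k 1, 0))
        (G' (EuclideanSpace.single l 1, 0)))
      (Matrix.of fun k (_ : Unit) => inner ℝ (G' (EuclideanSpace.single k 1, 0)) (G' (0, 1)))
      (Matrix.of fun (_ : Unit) l => inner ℝ (G' (0, 1)) (G' (EuclideanSpace.single l 1, 0)))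
      (Matrix.of fun _ _ => inner ℝ (G' (0, 1)) (G' (0, 1)))).det := by
  have h1 : ∀ k, G' (EuclideanSpace.single k 1, 0) =
      ∑ i, (1 - t • L) i k • A (EuclideanSpace.single i 1) := by
    intro k
    rw [hG, hL, zero_smul, add_zero]
    simp only [Matrix.sub_apply, Matrix.smul_apply, sub_smul, Finset.sum_sub_distrib, smul_neg,
      Finset.smul_sum, smul_smul, smul_eq_mul, Matrix.one_apply, ite_smul, one_smul, zero_smul,
      Finset.sum_ite_eq', Finset.mem_univ, if_true]
    rw [sub_eq_add_neg]
  have h2 : G' (0, 1) = N := by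
    rw [hG]
    simp
  have h3 : ∀ k, inner ℝ N (G' (EuclideanSpace.single k 1, 0)) = 0 := by
    intro k
    rw [h1, inner_sum]
    exact Finset.sum_eq_zero fun i _ => by rw [real_inner_smul_right, h.inner_eq_zero, mul_zero]
  have h4 : (Matrix.of fun (_ : Unit) l => (inner ℝ N (G' (EuclideanSpace.single l 1, 0)) : ℝ)) = 0 := by
    ext i j
    simp [h3]
  have h5 : (Matrix.of fun k l => (inner ℝ (G' (EuclideanSpace.single k 1, 0))
      (G' (EuclideanSpace.single l 1, 0)) : ℝ)) =
        (1 - t • L).transpose * gramMatrix A * (1 - t • L) := by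
    ext k l
    rw [Matrix.of_apply, h1, h1, sum_smul_inner_sum_smul]
  have h6 : (Matrix.of fun (_ _ : Unit) => (inner ℝ N N : ℝ)).det = 1 := by
    rw [Matrix.det_unique, Matrix.of_apply, real_inner_self_eq_norm_sq, h.norm_eq_one, one_pow]
  rw [h2, h4, Matrix.det_fromBlocks_zero₂₁, h5, h6, Matrix.det_mul, Matrix.det_mul, Matrix.det_transpose,
    mul_pow, Real.sq_sqrt (det_gramMatrix_pos h.injective).le]
  ring

end Chart

/-! ### The layer of a hypersurface in charts -/

namespace C2Hypersurface

variable {d : ℕ} {ι : Type*} {S : C2Hypersurface d ι} {ν : EucSp d → EucSp d} {β : ℝ}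

theorem chart_mem {i : ι} {u : EucSp (d - 1)} (hu : u ∈ S.U i) : S.φ i u ∈ S.V i ∩ S.carrier := by
  rw [← S.image_eq i]
  exact mem_image_of_mem _ hu

theorem continuousOn_chart (i : ι) : ContinuousOn (S.φ i) (S.U i) := (S.contDiffOn i).continuousOn

theorem injOn_chart (i : ι) : InjOn (S.φ i) (S.U i) :=
  injOn_iff_injective.2 (S.isEmbedding i).injective

theorem IsUnitNormal.continuousOn_chart (hν : S.IsUnitNormal ν) (i : ι) :
    ContinuousOn (fun u => ν (S.φ i u)) (S.U i) :=
  hν.continuousOn.comp (C2Hypersurface.continuousOn_chart i) fun _ hu => (chart_mem hu).2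

theorem IsUnitNormal.isNormalTo (hν : S.IsUnitNormal ν) {i : ι} {u : EucSp (d - 1)}
    (hu : u ∈ S.U i) : IsNormalTo (fderiv ℝ (S.φ i) u) (ν (S.φ i u)) where
  injective := injective_of_finrank_range (S.rank_eq i u hu)
  norm_eq_one := hν.norm_eq_one _ (chart_mem hu).2
  inner_eq_zero := inner_eq_zero_of_basis fun k => hν.normal i u hu k

theorem IsUnitNormal.differentiableAt_chart (hν : S.IsUnitNormal ν) (hd : d - 1 + 1 = d) {i : ι}
    {u : EucSp (d - 1)} (hu : u ∈ S.U i) : DifferentiableAt ℝ (fun w => ν (S.φ i w)) u := by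
  have hU := (S.isOpen_U i).mem_nhds hu
  have h1 : ContDiffAt ℝ 2 (S.φ i) u := (S.contDiffOn i).contDiffAt hU
  have h2 : ContDiffAt ℝ 1 (fderiv ℝ (S.φ i)) u := h1.fderiv_right (by norm_num)
  refine differentiableAt_normal hd (h2.differentiableAt (by norm_num))
    ((hν.continuousOn_chart i).continuousAt hU) ?_
  filter_upwards [hU] with w hw
  exact hν.isNormalTo hw

/-- Differentiation of `‖ν‖² = 1`. -/
theorem IsUnitNormal.inner_fderiv_eq_zero (hν : S.IsUnitNormal ν) (hd : d - 1 + 1 = d) {i : ι}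
    {u : EucSp (d - 1)} (hu : u ∈ S.U i) (x : EucSp (d - 1)) :
    inner ℝ (ν (S.φ i u)) (fderiv ℝ (fun w => ν (S.φ i w)) u x) = 0 := by
  have h1 := (hν.differentiableAt_chart hd hu).hasFDerivAt.norm_sq
  have h2 : HasFDerivAt (fun w => ‖ν (S.φ i w)‖ ^ 2) (0 : EucSp (d - 1) →L[ℝ] ℝ) u := by
    refine (hasFDerivAt_const (1 : ℝ) u).congr_of_eventuallyEq ?_
    filter_upwards [(S.isOpen_U i).mem_nhds hu] with w hw
    rw [hν.norm_eq_one _ (chart_mem hw).2, one_pow]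
  have h3 := congrArg (fun A : EucSp (d - 1) →L[ℝ] ℝ => A x) (h1.unique h2)
  simpa using h3

/-- The part of the layer over the image of a chart. -/
def chartLayer (S : C2Hypersurface d ι) (ν : EucSp d → EucSp d) (i : ι) (ε : ℝ) : Set (EucSp d) :=
  (fun z : EucSp d × ℝ => z.1 + z.2 • ν z.1) '' ((S.V i ∩ S.carrier) ×ˢ Ioo (-ε) ε)

theorem LayerHypothesis.mem_chartLayer_iff (hβ : S.LayerHypothesis ν β) {ε : ℝ} (hε : ε ≤ β)
    {i : ι} {x : EucSp d} (hx : x ∈ S.carrier) {t : ℝ} (ht : t ∈ Ioo (-ε) ε) :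
    x + t • ν x ∈ S.chartLayer ν i ε ↔ x ∈ S.V i := by
  have hsub : Ioo (-ε) ε ⊆ Ioo (-β) β := Ioo_subset_Ioo (by linarith) hε
  constructor
  · rintro ⟨z, ⟨hz, hz2⟩, hzx⟩
    have h1 : z = (x, t) := hβ.injOn ⟨hz.2, hsub hz2⟩ ⟨hx, hsub ht⟩ hzx
    rw [h1] at hz
    exact hz.1
  · exact fun h => ⟨(x, t), ⟨⟨h, hx⟩, ht⟩, rfl⟩

theorem chartLayer_subset (i : ι) (ε : ℝ) : S.chartLayer ν i ε ⊆ S.layer ν ε := by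
  rintro _ ⟨z, ⟨hz, hz2⟩, rfl⟩
  exact ⟨z.1, hz.2, z.2, hz2, rfl⟩

theorem chartLayer_eq_image (i : ι) (ε : ℝ) : S.chartLayer ν i ε =
    (fun z : EucSp (d - 1) × ℝ => S.φ i z.1 + z.2 • ν (S.φ i z.1)) '' (S.U i ×ˢ Ioo (-ε) ε) := by
  rw [chartLayer, ← S.image_eq i]
  ext x
  constructor
  · rintro ⟨⟨_, t⟩, ⟨⟨u, hu, rfl⟩, ht⟩, rfl⟩
    exact ⟨(u, t), ⟨hu, ht⟩, rfl⟩
  · rintro ⟨⟨u, t⟩, ⟨hu, ht⟩, rfl⟩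
    exact ⟨(S.φ i u, t), ⟨⟨u, hu, rfl⟩, ht⟩, rfl⟩

theorem measurableSet_chart_image (i : ι) : MeasurableSet (S.V i ∩ S.carrier) := by
  rw [← S.image_eq i]
  exact (S.isOpen_U i).measurableSet.image_of_continuousOn_injOn (continuousOn_chart i)
    (injOn_chart i)

theorem measurableSet_carrier [Countable ι] : MeasurableSet S.carrier := by
  have h : S.carrier = ⋃ i, S.V i ∩ S.carrier := by
    rw [← iUnion_inter]
    exact (inter_eq_right.2 S.subset_iUnion).symm
  rw [h]
  exact MeasurableSet.iUnion measurableSet_chart_image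

theorem LayerHypothesis.measurableSet_normal_image (hβ : S.LayerHypothesis ν β)
    (hν : S.IsUnitNormal ν) {ε : ℝ} (hε : ε ≤ β) {B : Set (EucSp d)} (hB : MeasurableSet B)
    (hBS : B ⊆ S.carrier) :
    MeasurableSet ((fun z : EucSp d × ℝ => z.1 + z.2 • ν z.1) '' (B ×ˢ Ioo (-ε) ε)) := by
  have hsub : B ×ˢ Ioo (-ε) ε ⊆ S.carrier ×ˢ Ioo (-β) β :=
    prod_mono hBS (Ioo_subset_Ioo (by linarith) hε)
  refine (hB.prod measurableSet_Ioo).image_of_continuousOn_injOn ?_ (hβ.injOn.mono hsub)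
  exact continuousOn_fst.add (continuousOn_snd.smul
    (hν.continuousOn.comp continuousOn_fst fun z hz => hBS hz.1))

theorem layer_eq_image (ε : ℝ) : S.layer ν ε =
    (fun z : EucSp d × ℝ => z.1 + z.2 • ν z.1) '' (S.carrier ×ˢ Ioo (-ε) ε) := by
  ext x
  constructor
  · rintro ⟨y, hy, t, ht, rfl⟩
    exact ⟨(y, t), ⟨hy, ht⟩, rfl⟩
  · rintro ⟨⟨y, t⟩, ⟨hy, ht⟩, rfl⟩
    exact ⟨y, hy, t, ht, rfl⟩

/-- The base point in the chart `y.1`, with value `0` outside of the domain of the chart. -/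
noncomputable def chartBase (S : C2Hypersurface d ι) (y : ι × EucSp (d - 1)) : EucSp d :=
  (S.U y.1).indicator (S.φ y.1) y.2

/-- The normal in the chart `y.1`, with value `0` outside of the domain of the chart. -/
noncomputable def chartNormal (S : C2Hypersurface d ι) (ν : EucSp d → EucSp d)
    (y : ι × EucSp (d - 1)) : EucSp d :=
  (S.U y.1).indicator (fun u => ν (S.φ y.1 u)) y.2

open Classical in
/-- The Jacobian `det (1 - t W)` in the chart, with value `1` outside of the domain of the chart. -/
noncomputable def chartJac (S : C2Hypersurface d ι) (ν : EucSp d → EucSp d)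
    (q : (ι × EucSp (d - 1)) × ℝ) : ℝ :=
  if q.1.2 ∈ S.U q.1.1 then (1 - q.2 • S.weingartenMatrix ν q.1.1 q.1.2).det else 1

theorem chartBase_apply {i : ι} {u : EucSp (d - 1)} (hu : u ∈ S.U i) :
    S.chartBase (i, u) = S.φ i u :=
  indicator_of_mem hu _

theorem chartNormal_apply {i : ι} {u : EucSp (d - 1)} (hu : u ∈ S.U i) :
    S.chartNormal ν (i, u) = ν (S.φ i u) :=
  indicator_of_mem (f := fun u => ν (S.φ i u)) hu

theorem chartJac_apply {i : ι} {u : EucSp (d - 1)} (hu : u ∈ S.U i) (t : ℝ) :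
    S.chartJac ν ((i, u), t) = (1 - t • S.weingartenMatrix ν i u).det :=
  if_pos hu

theorem measurable_det {X : Type*} [MeasurableSpace X] {m : ℕ} {M : X → Matrix (Fin m) (Fin m) ℝ}
    (h : ∀ i j, Measurable fun x => M x i j) : Measurable fun x => (M x).det := by
  simp only [Matrix.det_apply]
  exact Finset.measurable_fun_sum _ fun τ _ =>
    (Finset.measurable_fun_prod _ fun i _ => h _ _).const_smul _

theorem measurable_inv_entry {X : Type*} [MeasurableSpace X] {m : ℕ}
    {M : X → Matrix (Fin m) (Fin m) ℝ} (h : ∀ i j, Measurable fun x => M x i j) (i j : Fin m) :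
    Measurable fun x => (M x)⁻¹ i j := by
  simp only [Matrix.inv_def, Ring.inverse_eq_inv', Matrix.smul_apply, smul_eq_mul,
    Matrix.adjugate_apply]
  refine (measurable_det h).inv.mul (measurable_det fun k l => ?_)
  by_cases hk : k = j
  · subst hk
    simp
  · simpa [Matrix.updateRow_ne hk] using h k l

theorem measurable_metricMatrix (i : ι) (k l : Fin (d - 1)) :
    Measurable fun u => S.metricMatrix i u k l := by
  simp only [metricMatrix, Matrix.of_apply, chartPartial]
  exact (measurable_fderiv_apply_const ℝ _ _).inner (measurable_fderiv_apply_const ℝ _ _)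

/-- The derivative `fderiv` of an arbitrary map into a complete space is measurable, so the
behaviour of `ν ∘ φᵢ` outside `Uᵢ` is immaterial. -/
theorem measurable_weingartenMatrix (i : ι) (k l : Fin (d - 1)) :
    Measurable fun u => S.weingartenMatrix ν i u k l := by
  simp only [weingartenMatrix, Matrix.mul_apply, Matrix.of_apply]
  refine Finset.measurable_fun_sum _ fun j _ => ?_
  exact (measurable_inv_entry (measurable_metricMatrix i) k j).mul
    ((measurable_fderiv_apply_const ℝ _ _).inner (measurable_fderiv_apply_const ℝ _ _).neg)

theorem measurable_chartJac_slice (i : ι) :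
    Measurable fun z : EucSp (d - 1) × ℝ => S.chartJac ν ((i, z.1), z.2) := by
  refine Measurable.ite (measurable_fst (S.isOpen_U i).measurableSet) ?_ measurable_const
  refine measurable_det fun k l => ?_
  simp only [Matrix.sub_apply, Matrix.smul_apply, smul_eq_mul]
  exact measurable_const.sub (measurable_snd.mul ((measurable_weingartenMatrix i k l).comp
    measurable_fst))

theorem measurable_chartBase_slice (i : ι) : Measurable fun u => S.chartBase (i, u) :=
  measurable_indicator_of_continuousOn (S.isOpen_U i).measurableSet (continuousOn_chart i)

theorem IsUnitNormal.measurable_chartNormal_slice (hν : S.IsUnitNormal ν) (i : ι) :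
    Measurable fun u => S.chartNormal ν (i, u) :=
  measurable_indicator_of_continuousOn (S.isOpen_U i).measurableSet (hν.continuousOn_chart i)

/-- Integration over the layer above one chart, in normal coordinates. -/
theorem LayerHypothesis.lintegral_chartLayer (hβ : S.LayerHypothesis ν β) (hν : S.IsUnitNormal ν)
    (hd : d - 1 + 1 = d) {ε : ℝ} (hε : ε ≤ β) (i : ι) {k : EucSp d → ℝ≥0∞} (hk : Measurable k) :
    ∫⁻ x in S.chartLayer ν i ε, k x = ∫⁻ u in S.U i, ∫⁻ t in Ioo (-ε) ε,
      ENNReal.ofReal (S.chartJac ν ((i, u), t) * √(S.metricMatrix i u).det) *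
        k (S.chartBase (i, u) + t • S.chartNormal ν (i, u)) := by
  have hsub : Ioo (-ε) ε ⊆ Ioo (-β) β := Ioo_subset_Ioo (by linarith) hε
  set A := S.U i ×ˢ Ioo (-ε) ε with hA
  have hAo : IsOpen A := (S.isOpen_U i).prod isOpen_Ioo
  set G : EucSp (d - 1) × ℝ → EucSp d := fun z => S.φ i z.1 + z.2 • ν (S.φ i z.1) with hG
  set G' : EucSp (d - 1) × ℝ → EucSp (d - 1) × ℝ →L[ℝ] EucSp d := fun z =>
    (fderiv ℝ (S.φ i) z.1 + z.2 • fderiv ℝ (fun w => ν (S.φ i w)) z.1) ∘L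
      ContinuousLinearMap.fst ℝ (EucSp (d - 1)) ℝ +
    (ContinuousLinearMap.snd ℝ (EucSp (d - 1)) ℝ).smulRight (ν (S.φ i z.1)) with hG'
  have hder : ∀ z ∈ A, HasFDerivWithinAt G (G' z) A z := by
    rintro ⟨u, t⟩ ⟨hu, -⟩
    have h1 : HasFDerivAt (S.φ i) (fderiv ℝ (S.φ i) u) u :=
      (((S.contDiffOn i).contDiffAt ((S.isOpen_U i).mem_nhds hu)).differentiableAt
        (by norm_num)).hasFDerivAt
    have h2 := (hν.differentiableAt_chart hd hu).hasFDerivAt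
    have h3 : HasFDerivAt (fun z : EucSp (d - 1) × ℝ => S.φ i z.1) _ (u, t) :=
      HasFDerivAt.comp (g := S.φ i) (f := Prod.fst) (u, t) h1 hasFDerivAt_fst
    have h4 : HasFDerivAt (fun z : EucSp (d - 1) × ℝ => ν (S.φ i z.1)) _ (u, t) :=
      HasFDerivAt.comp (g := fun w => ν (S.φ i w)) (f := Prod.fst) (u, t) h2 hasFDerivAt_fst
    have h5 := h3.add (hasFDerivAt_snd.smul h4)
    refine (h5.congr_fderiv ?_).hasFDerivWithinAt
    ext x <;> simp [hG']
  have hinj : InjOn G A := by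
    rintro ⟨u, t⟩ ⟨hu, ht⟩ ⟨v, s⟩ ⟨hv, hs⟩ h
    have h1 : (S.φ i u, t) = (S.φ i v, s) :=
      hβ.injOn ⟨(chart_mem hu).2, hsub ht⟩ ⟨(chart_mem hv).2, hsub hs⟩ h
    rw [Prod.mk.injEq] at h1
    exact Prod.ext (injOn_chart i hu hv h1.1) h1.2
  obtain ⟨η, hη, hdet⟩ := hβ.det_mem
  rw [chartLayer_eq_image, lintegral_image_eq_lintegral_gram hd hAo.measurableSet hder hinj
    (D := fun z => S.chartJac ν ((i, z.1), z.2) * √(S.metricMatrix i z.1).det)]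
  · have hm : Measurable fun z : EucSp (d - 1) × ℝ =>
        ENNReal.ofReal (S.chartJac ν ((i, z.1), z.2) * √(S.metricMatrix i z.1).det) *
          k (S.chartBase (i, z.1) + z.2 • S.chartNormal ν (i, z.1)) := by
      have h1 := measurable_chartJac_slice (S := S) (ν := ν) i
      have h2 : Measurable fun z : EucSp (d - 1) × ℝ => √(S.metricMatrix i z.1).det :=
        ((measurable_det (measurable_metricMatrix i)).comp measurable_fst).sqrt
      have h3 : Measurable fun z : EucSp (d - 1) × ℝ => S.chartBase (i, z.1) :=
        (measurable_chartBase_slice i).comp measurable_fst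
      have h4 : Measurable fun z : EucSp (d - 1) × ℝ => S.chartNormal ν (i, z.1) :=
        (hν.measurable_chartNormal_slice i).comp measurable_fst
      exact (h1.mul h2).ennreal_ofReal.mul (hk.comp (h3.add (measurable_snd.smul h4)))
    rw [← lintegral_prod _ hm.aemeasurable, Measure.prod_restrict]
    refine setLIntegral_congr_fun hAo.measurableSet ?_
    rintro ⟨u, t⟩ ⟨hu, ht⟩
    simp only [chartBase_apply hu, chartNormal_apply hu, hG]
  · rintro ⟨u, t⟩ ⟨hu, ht⟩
    simp only [chartJac_apply hu]
    have := (hdet i u hu t (hsub ht)).1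
    exact mul_nonneg (by linarith [hη.2]) (Real.sqrt_nonneg _)
  · rintro ⟨u, t⟩ ⟨hu, ht⟩
    obtain ⟨L, hL, hL'⟩ := (hν.isNormalTo hu).exists_matrix hd (hν.inner_fderiv_eq_zero hd hu)
    have hW : S.weingartenMatrix ν i u = L := hL
    simp only [chartJac_apply hu, hW]
    exact (hν.isNormalTo hu).det_normal_coordinates hL' t fun x r => by simp [hG']

end C2Hypersurface

/-! ### Gluing the charts into one parametrization of the layer. -/

namespace C2Hypersurface

variable {d : ℕ} {ι : Type*} {S : C2Hypersurface d ι} {ν : EucSp d → EucSp d} {β : ℝ}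

/-- The number of charts over a point. -/
noncomputable def multiplicity [Fintype ι] (S : C2Hypersurface d ι) (x : EucSp d) : ℝ≥0∞ :=
  ∑ j, (S.V j).indicator (1 : EucSp d → ℝ≥0∞) x

theorem measurable_multiplicity [Fintype ι] : Measurable S.multiplicity :=
  Finset.measurable_fun_sum _ fun j _ => measurable_one.indicator (S.isOpen_V j).measurableSet

theorem multiplicity_eq_ncard [Fintype ι] (x : EucSp d) :
    S.multiplicity x = (({j | x ∈ S.V j} : Set ι).ncard : ℝ≥0∞) := by
  classical
  rw [Set.ncard_eq_toFinset_card', toFinset_ofPred, Finset.card_filter, multiplicity]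
  push_cast
  exact Finset.sum_congr rfl fun j _ => by simp [indicator_apply]

/-- The surface density in a chart, divided by the number of charts. -/
noncomputable def chartWeight [Fintype ι] (S : C2Hypersurface d ι) (i : ι) (u : EucSp (d - 1)) :
    ℝ≥0∞ :=
  ENNReal.ofReal √(S.metricMatrix i u).det * (S.multiplicity (S.chartBase (i, u)))⁻¹

theorem measurable_chartWeight [Fintype ι] (i : ι) : Measurable (S.chartWeight i) :=
  (measurable_det (measurable_metricMatrix i)).sqrt.ennreal_ofReal.mul
    (measurable_multiplicity.comp (measurable_chartBase_slice i)).inv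

theorem chartWeight_eq [Fintype ι] {i : ι} {u : EucSp (d - 1)} (hu : u ∈ S.U i) :
    S.chartWeight i u = ENNReal.ofReal (√(S.metricMatrix i u).det /
      ({j | S.φ i u ∈ S.V j} : Set ι).ncard) := by
  -- The chart `i` is itself counted, so no division by zero occurs, for which the conventions in
  -- `ℝ` and `ℝ≥0∞` differ.
  have hpos : 0 < ({j | S.φ i u ∈ S.V j} : Set ι).ncard :=
    (Set.ncard_pos (Set.toFinite _)).2 ⟨i, (chart_mem hu).1⟩
  rw [chartWeight, chartBase_apply hu, multiplicity_eq_ncard, ENNReal.ofReal_div_of_pos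
    (by exact_mod_cast hpos), ENNReal.ofReal_natCast, div_eq_mul_inv]

/-- The surface measure on the disjoint union of the charts. -/
noncomputable def chartMeasure [Fintype ι] [MeasurableSpace ι] (S : C2Hypersurface d ι) :
    Measure (ι × EucSp (d - 1)) :=
  Measure.sum fun i => ((volume.restrict (S.U i)).withDensity (S.chartWeight i)).map (Prod.mk i)

instance [Fintype ι] [MeasurableSpace ι] : SFinite S.chartMeasure := by
  unfold chartMeasure
  infer_instance

variable [Fintype ι] [MeasurableSpace ι] [MeasurableSingletonClass ι]

theorem lintegral_chartMeasure {F : ι × EucSp (d - 1) → ℝ≥0∞} (hF : Measurable F) :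
    ∫⁻ y, F y ∂S.chartMeasure = ∑ i, ∫⁻ u in S.U i, S.chartWeight i u * F (i, u) := by
  rw [chartMeasure, lintegral_sum_measure, tsum_fintype]
  refine Finset.sum_congr rfl fun i _ => ?_
  have hFi : Measurable fun u => F (i, u) := hF.comp measurable_prodMk_left
  rw [lintegral_map hF measurable_prodMk_left,
    lintegral_withDensity_eq_lintegral_mul _ (measurable_chartWeight i) hFi]
  rfl

theorem ae_chartMeasure : ∀ᵐ y ∂S.chartMeasure, y.2 ∈ S.U y.1 := by
  have hm : MeasurableSet {y : ι × EucSp (d - 1) | y.2 ∈ S.U y.1} := by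
    have h : {y : ι × EucSp (d - 1) | y.2 ∈ S.U y.1} = ⋃ i, ({i} : Set ι) ×ˢ S.U i := by
      ext y
      simp
    rw [h]
    exact MeasurableSet.iUnion fun i => (measurableSet_singleton i).prod (S.isOpen_U i).measurableSet
  rw [chartMeasure, Measure.ae_sum_iff]
  intro i
  rw [ae_map_iff measurable_prodMk_left.aemeasurable hm]
  exact (withDensity_absolutelyContinuous _ _).ae_le
    (ae_restrict_mem (S.isOpen_U i).measurableSet)

theorem measurable_chartBase : Measurable S.chartBase :=
  measurable_from_prod_countable_right fun i => measurable_chartBase_slice i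

theorem IsUnitNormal.measurable_chartNormal (hν : S.IsUnitNormal ν) :
    Measurable (S.chartNormal ν) :=
  measurable_from_prod_countable_right fun i => hν.measurable_chartNormal_slice i

theorem measurable_chartJac : Measurable (S.chartJac ν) := by
  have h : Measurable fun q : ι × (EucSp (d - 1) × ℝ) => S.chartJac ν ((q.1, q.2.1), q.2.2) :=
    measurable_from_prod_countable_right fun i => measurable_chartJac_slice i
  exact h.comp (MeasurableEquiv.prodAssoc (α := ι) (β := EucSp (d - 1)) (γ := ℝ)).measurable

theorem map_chartBase : S.chartMeasure.map S.chartBase = S.surfaceMeasure := by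
  rw [chartMeasure, Measure.map_sum measurable_chartBase.aemeasurable, surfaceMeasure]
  congr 1
  funext i
  have hd : ((volume : Measure (EucSp (d - 1))).restrict (S.U i)).withDensity (S.chartWeight i) =
      (volume.restrict (S.U i)).withDensity fun u => ENNReal.ofReal
        (√(S.metricMatrix i u).det / ({j | S.φ i u ∈ S.V j} : Set ι).ncard) := by
    refine withDensity_congr_ae ?_
    filter_upwards [ae_restrict_mem (S.isOpen_U i).measurableSet] with u hu
    exact chartWeight_eq hu
  rw [Measure.map_map measurable_chartBase measurable_prodMk_left, hd]
  refine Measure.map_congr ((withDensity_absolutelyContinuous _ _).ae_le ?_)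
  filter_upwards [ae_restrict_mem (S.isOpen_U i).measurableSet] with u hu
  exact chartBase_apply hu

/-- Integration over the layer in normal coordinates. -/
theorem LayerHypothesis.lintegral_layer (hβ : S.LayerHypothesis ν β) (hν : S.IsUnitNormal ν)
    (hd : d - 1 + 1 = d) {ε : ℝ} (hε : ε ≤ β) {k : EucSp d → ℝ≥0∞} (hk : Measurable k) :
    ∫⁻ x in S.layer ν ε, k x = ∫⁻ y, (∫⁻ t in Ioo (-ε) ε,
      k (S.chartBase y + t • S.chartNormal ν y) * ENNReal.ofReal (S.chartJac ν (y, t)))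
        ∂S.chartMeasure := by
  have hsub : Ioo (-ε) ε ⊆ Ioo (-β) β := Ioo_subset_Ioo (by linarith) hε
  obtain ⟨η, hη, hdet⟩ := hβ.det_mem
  -- The number of chart layers containing a point; the weight `1/M` distributes the integral over
  -- overlapping charts.
  set M : EucSp d → ℝ≥0∞ := fun x =>
    ∑ j, (S.chartLayer ν j ε).indicator (1 : EucSp d → ℝ≥0∞) x with hM
  have hms : ∀ i, MeasurableSet (S.chartLayer ν i ε) := fun i =>
    hβ.measurableSet_normal_image hν hε (measurableSet_chart_image i) inter_subset_right
  have hMm : Measurable M :=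
    Finset.measurable_fun_sum _ fun j _ => measurable_one.indicator (hms j)
  -- By injectivity of the normal map, `x + t ν(x)` lies over a chart only if `x` does, so this
  -- number is constant along normals and matches the weight in the surface measure.
  have hMv : ∀ x ∈ S.carrier, ∀ t ∈ Ioo (-ε) ε, M (x + t • ν x) = S.multiplicity x := by
    intro x hx t ht
    refine Finset.sum_congr rfl fun j _ => ?_
    by_cases h : x ∈ S.V j
    · rw [indicator_of_mem h, indicator_of_mem ((hβ.mem_chartLayer_iff hε hx ht).2 h)]
      rfl
    · rw [indicator_of_notMem h, indicator_of_notMem (mt (hβ.mem_chartLayer_iff hε hx ht).1 h)]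
  have hmul0 : ∀ x ∈ S.carrier, S.multiplicity x ≠ 0 ∧ S.multiplicity x ≠ ∞ := by
    intro x hx
    rw [multiplicity_eq_ncard]
    refine ⟨?_, ENNReal.natCast_ne_top _⟩
    obtain ⟨i, hi⟩ := mem_iUnion.1 (S.subset_iUnion hx)
    exact_mod_cast ((Set.ncard_pos (Set.toFinite {j | x ∈ S.V j})).2 ⟨i, hi⟩).ne'
  have hL : MeasurableSet (S.layer ν ε) := by
    rw [layer_eq_image]
    exact hβ.measurableSet_normal_image hν hε measurableSet_carrier subset_rfl
  have hkM : Measurable fun x => k x * (M x)⁻¹ := hk.mul hMm.inv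
  have h1 : ∫⁻ x in S.layer ν ε, k x = ∑ i, ∫⁻ x in S.chartLayer ν i ε, k x * (M x)⁻¹ := by
    have h2 : ∀ i, ∫⁻ x in S.chartLayer ν i ε, k x * (M x)⁻¹ = ∫⁻ x in S.layer ν ε,
        (S.chartLayer ν i ε).indicator (fun x => k x * (M x)⁻¹) x := fun i => by
      rw [setLIntegral_indicator (hms i), inter_eq_left.2 (chartLayer_subset i ε)]
    simp only [h2]
    rw [← lintegral_finsetSum _ fun i _ => hkM.indicator (hms i)]
    refine setLIntegral_congr_fun hL ?_
    rintro _ ⟨y, hy, t, ht, rfl⟩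
    have h3 : ∀ i, (S.chartLayer ν i ε).indicator (fun x => k x * (M x)⁻¹) (y + t • ν y) =
        (S.chartLayer ν i ε).indicator 1 (y + t • ν y) *
          (k (y + t • ν y) * (M (y + t • ν y))⁻¹) := fun i => by
      by_cases h : y + t • ν y ∈ S.chartLayer ν i ε
      · simp [h]
      · simp [h]
    simp only [h3]
    rw [← Finset.sum_mul]
    change k (y + t • ν y) = M (y + t • ν y) * (k (y + t • ν y) * (M (y + t • ν y))⁻¹)
    rw [hMv y hy t ht, mul_left_comm, ENNReal.mul_inv_cancel (hmul0 y hy).1 (hmul0 y hy).2, mul_one]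
  have hF : Measurable fun q : (ι × EucSp (d - 1)) × ℝ =>
      k (S.chartBase q.1 + q.2 • S.chartNormal ν q.1) * ENNReal.ofReal (S.chartJac ν q) := by
    have h1 := measurable_chartBase (S := S)
    have h2 := hν.measurable_chartNormal
    have h3 := measurable_chartJac (S := S) (ν := ν)
    fun_prop
  rw [h1, lintegral_chartMeasure hF.lintegral_prod_right']
  refine Finset.sum_congr rfl fun i _ => ?_
  rw [hβ.lintegral_chartLayer hν hd hε i hkM]
  refine setLIntegral_congr_fun (S.isOpen_U i).measurableSet fun u hu => ?_
  have hFu : Measurable fun t : ℝ => k (S.chartBase (i, u) + t • S.chartNormal ν (i, u)) *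
      ENNReal.ofReal (S.chartJac ν ((i, u), t)) := hF.comp measurable_prodMk_left
  rw [← lintegral_const_mul _ hFu]
  refine setLIntegral_congr_fun measurableSet_Ioo fun t ht => ?_
  have hJ : 0 ≤ S.chartJac ν ((i, u), t) := by
    rw [chartJac_apply hu]
    linarith [(hdet i u hu t (hsub ht)).1, hη.2]
  simp only [chartWeight, chartBase_apply hu, chartNormal_apply hu]
  rw [hMv _ (chart_mem hu).2 t ht, ENNReal.ofReal_mul hJ]
  ring

/-- The charts of a hypersurface give a model of its layers. -/
theorem LayerHypothesis.exists_layerModel (hβ : S.LayerHypothesis ν β) (hν : S.IsUnitNormal ν)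
    (hd : d - 1 + 1 = d) : ∃ (c : ℝ≥0) (b : ℝ), LayerModel S ν β S.chartMeasure S.chartBase
      (S.chartNormal ν) (S.chartJac ν) c b := by
  have hp := hβ.pos
  obtain ⟨η, hη, hdet⟩ := hβ.det_mem
  obtain ⟨b, hb0, hb⟩ := exists_bound_det_one_sub_smul (d - 1) hp
  have hη1 : 0 < 1 - η := by linarith [hη.2]
  have hJ : ∀ y, ∀ t ∈ Ioo (-β) β, 1 - η ≤ S.chartJac ν (y, t) := by
    rintro ⟨i, u⟩ t ht
    by_cases hu : u ∈ S.U i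
    · rw [chartJac_apply hu]
      exact (hdet i u hu t ht).1.le
    · rw [chartJac, if_neg hu]
      linarith [hη.1]
  have hL : MeasurableSet S.carrier := measurableSet_carrier
  -- The Jacobian is at least `1 - η`, so omitting it costs at most the factor `(1 - η)⁻¹`.
  refine ⟨(1 - η)⁻¹.toNNReal, b, ?_⟩
  exact
    { measurable_base := measurable_chartBase
      measurable_normal := hν.measurable_chartNormal
      norm_le := by
        rintro ⟨i, u⟩
        by_cases hu : u ∈ S.U i
        · rw [chartNormal_apply hu, hν.norm_eq_one _ (chart_mem hu).2]
        · simp [chartNormal, hu]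
      pos := hp
      lintegral_le := by
        intro k hk
        calc _ ≤ ∫⁻ y, (∫⁻ t in Ioo (-β) β, ((1 - η)⁻¹.toNNReal : ℝ≥0∞) *
              (k (S.chartBase y + t • S.chartNormal ν y) *
                ENNReal.ofReal (S.chartJac ν (y, t)))) ∂S.chartMeasure := by
              refine lintegral_mono fun y => setLIntegral_mono' measurableSet_Ioo fun t ht => ?_
              have h1 : (1 : ℝ≥0∞) ≤ ((1 - η)⁻¹.toNNReal : ℝ≥0∞) *
                  ENNReal.ofReal (S.chartJac ν (y, t)) := by
                change 1 ≤ ENNReal.ofReal (1 - η)⁻¹ * _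
                rw [← ENNReal.ofReal_mul (by positivity), ENNReal.one_le_ofReal]
                rw [inv_mul_eq_div, one_le_div hη1]
                exact hJ y t ht
              calc _ = k (S.chartBase y + t • S.chartNormal ν y) * 1 := (mul_one _).symm
                _ ≤ k (S.chartBase y + t • S.chartNormal ν y) * (((1 - η)⁻¹.toNNReal : ℝ≥0∞) *
                  ENNReal.ofReal (S.chartJac ν (y, t))) := by gcongr
                _ = _ := by ring
          _ = (1 - η)⁻¹.toNNReal * ∫⁻ x in S.layer ν β, k x := by
              rw [hβ.lintegral_layer hν hd le_rfl hk, ← lintegral_const_mul' _ _ ENNReal.coe_ne_top]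
              refine lintegral_congr fun y => ?_
              rw [lintegral_const_mul' _ _ ENNReal.coe_ne_top]
          _ ≤ _ := by
              gcongr
              exact Measure.restrict_le_self
      map_base := map_chartBase
      ae_base := by
        filter_upwards [ae_chartMeasure] with y hy
        obtain ⟨i, u⟩ := y
        rw [chartBase_apply hy, chartNormal_apply hy]
        exact ⟨(chart_mem hy).2, rfl⟩
      measurable_jac := measurable_chartJac
      jac_nonneg := fun y t ht => hη1.le.trans (hJ y t ht)
      bound_nonneg := hb0
      jac_sub_le := by
        rintro ⟨i, u⟩ t ht
        by_cases hu : u ∈ S.U i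
        · rw [chartJac_apply hu]
          -- As `η < 1`, the determinants lie in `(0, 2)`, the bound required by the interpolation
          -- argument.
          refine hb _ (fun r hr => ?_) t ht
          have h1 := hdet i u hu r hr
          rw [abs_le]
          exact ⟨by linarith [h1.1, hη.2], by linarith [h1.2, hη.2]⟩
        · rw [chartJac, if_neg hu, sub_self, abs_zero]
          positivity
      measurableSet_carrier := hL
      measurableSet_layer := fun ε hε => by
        rw [layer_eq_image]
        exact hβ.measurableSet_normal_image hν hε.2 hL subset_rfl
      lintegral_layer := fun ε hε k hk => hβ.lintegral_layer hν hd hε.2 hk }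

end C2Hypersurface

/-! ### The theorem. -/

theorem theorem1p1 {d : ℕ} (hd : 2 ≤ d) {ι : Type*} [Finite ι] (S : C2Hypersurface d ι)
    (ν : EucSp d → EucSp d) (hν : S.IsUnitNormal ν) (β : ℝ) (hβ : S.LayerHypothesis ν β)
    (Q V : EucSp d → ℝ) (hQ : MemLp Q ∞ volume) (hV : MemLp V ∞ volume)
    (hVsupp : ∀ᵐ x ∂(volume : Measure (EucSp d)), x ∉ S.layer ν β → V x = 0)
    (α : EucSp d → ℝ) (hα : α = transversalAverage ν β V)
    (A : L2Sp d →ₗ.[ℂ] L2Sp d) (hA : A = deltaOperator S.surfaceMeasure α)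
    (H : ℝ → (L2Sp d →ₗ.[ℂ] L2Sp d))
    (hH : ∀ ε, H ε = schrodinger (S.scaledPotential ν β V ε)) :
    MemLp α ∞ S.surfaceMeasure ∧
    (∃ lam₀ : ℝ, lam₀ < 0 ∧
      (∀ lam : ℝ, lam < lam₀ → (lam : ℂ) ∈ unboundedResolventSet (A + mulOperator Q)) ∧
      (∀ᶠ ε in 𝓝[>] (0 : ℝ), ∀ lam : ℝ, lam < lam₀ →
        (lam : ℂ) ∈ unboundedResolventSet (H ε + mulOperator Q)) ∧
      ∀ lam : ℝ, lam < lam₀ → ∃ c : ℝ, 0 < c ∧ ∀ᶠ ε in 𝓝[>] (0 : ℝ),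
        ‖unboundedResolvent (H ε + mulOperator Q) (lam : ℂ) -
            unboundedResolvent (A + mulOperator Q) (lam : ℂ)‖ ≤ c * ε * (1 + |Real.log ε|)) ∧
    NormResolventTendsto (fun ε => H ε + mulOperator Q) (𝓝[>] 0) (A + mulOperator Q) := by
  have hι := Fintype.ofFinite ι
  -- With the discrete `σ`-algebra on the finite index set, measurability on the disjoint union of
  -- the charts can be checked chart by chart.
  let mι : MeasurableSpace ι := ⊤
  have : MeasurableSingletonClass ι := ⟨fun _ => trivial⟩
  obtain rfl : H = fun ε => schrodinger (S.scaledPotential ν β V ε) := funext hH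
  subst hα hA
  obtain ⟨c, b, h⟩ := hβ.exists_layerModel hν (by omega)
  exact ⟨h.memLp_transversalAverage hν hV, h.resolvent_convergence hν hβ hQ hV⟩
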